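/- **Proposition 4.1.** Let $k$ be an algebraically closed field of characteristic $p>0$, let $X$ be a smooth projective variety over $k$ of dimension $d$, let $\Omega_X$ be its cotangent bundle and $F=F_X$ its Frobenius morphism. A *vector subbundle* of a vector bundle $V$ is a subsheaf $V'\subset V$ such that $V'$ and $V/V'$ are vector bundles (locally free $\mathcal O_X$-modules of finite rank). *Construction.* Let $W$ be an $\mathcal O_X$-module with a connection $\nabla:W\to W\otimes\Omega_X$. The second fundamental form of a subsheaf of modules $W'\subset W$ is the $\mathcal O_X$-linear composition $$S(W'):\ W'\hookrightarrow W\xrightarrow{\ \nabla\ }W\otimes\Omega_X\longrightarrow (W/W')\otimes\Omega_X .$$ Given $W_1\subset W$, put $W_0:=W$ and, for $i\ge 1$, $W_{i+1}:=\ker S(W_i)$. Let $E$ be a vector bundle on $X$. Take $W=E_0:=F^*F_*E$ with its Cartier connection, the connection for which all pulled-back sections $F^*s$ (with $s$ a local section of $F_*E$) are horizontal. Let $E_1:=\ker(F^*F_*E\to E)$ be the kernel of the natural surjection, so that $E_0/E_1=E$, and let $$F^*F_*E=E_0\supset E_1\supset E_2\supset\cdots,\qquad E_{i+1}:=\ker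 S(E_i)\quad(i\ge1),$$ be the resulting filtration. For each $i\ge1$ the form $S(E_i)$ induces a unique homomorphism $$\widetilde S(E_i):\ E_i/E_{i+1}\longrightarrow (E_{i-1}/E_i)\otimes\Omega_X ,$$ that is, a homomorphism whose composition with the quotient map $E_i\to E_i/E_{i+1}$ and the natural map $(E_{i-1}/E_i)\otimes\Omega_X\to(E_0/E_i)\otimes\Omega_X$ is $S(E_i)$. Iterating these homomorphisms (each tensored with the identity of the appropriate power of $\Omega_X$) gives $$S_i:=\widetilde S(E_1)\circ\cdots\circ\widetilde S(E_{i-1})\circ\widetilde S(E_i):\ E_i/E_{i+1}\longrightarrow E\otimes\Omega_X^{\otimes i}\qquad(i\ge1).$$ The following hold. 1. For every vector bundle $E$ and every $i\ge0$, $E_i$ is a vector bundle, and moreover a vector subbundle of $F^*F_*E$; and $E_i=0$ if $i>(p-1)d$. 2. For every vector bundle $E$ and every $i\ge1$, $S_i:E_i/E_{i+1}\to E\otimes\Omega_X^{\otimes i}$ is an injective homomorphism of vector bundles, identifying $E_i/E_{i+1}$ with a vector subbundle of $E\otimes\Omega_X^{\otimes i}$. 3. For $i\ge1$ let $\mathcal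 G_i\subset\Omega_X^{\otimes i}$ be the image of the homomorphism $S_i$ for $E=\mathcal O_X$. Then $\mathcal G_i$ is a vector subbundle of $\Omega_X^{\otimes i}$, and for every vector bundle $E$ the natural map $E\otimes\mathcal G_i\to E\otimes\Omega_X^{\otimes i}$ is injective and the image $S_i(E_i/E_{i+1})$ equals $E\otimes\mathcal G_i$ as a subsheaf of $E\otimes\Omega_X^{\otimes i}$. -/

import Mathlib

open CategoryTheory Limits AlgebraicGeometry Opposite TopologicalSpace

universe u

namespace FrobFil

noncomputable section

section Sheaves

/-! ### Sheafification and tensor products of sheaves of modules -/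

/-- The associated sheaf functor from presheaves of `𝒪_X`-modules to `𝒪_X`-modules. -/
def shf (X : Scheme.{u}) : X.PresheafOfModules ⥤ X.Modules :=
  PresheafOfModules.sheafification (R := X.ringCatSheaf) (𝟙 X.ringCatSheaf.obj)

/-- The presheaf of modules underlying a sheaf of modules. -/
abbrev toP {X : Scheme.{u}} (M : X.Modules) : X.PresheafOfModules := M.val

/-- The canonical map from a presheaf of modules to its associated sheaf. -/
def toShf {X : Scheme.{u}} (P : X.PresheafOfModules) : P ⟶ toP ((shf X).obj P) :=
  PresheafOfModules.homMk (CategoryTheory.toSheafify (Opens.grothendieckTopology X) P.presheaf)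
    (fun U r m ↦
      (((PresheafOfModules.sheafificationAdjunction (R := X.ringCatSheaf)
        (𝟙 X.ringCatSheaf.obj)).unit.app P).app U).hom.map_smul r m)

/-- The morphism from the associated sheaf of `P` to a sheaf `N` induced by `P ⟶ N`. -/
def shfLift {X : Scheme.{u}} {P : X.PresheafOfModules} {N : X.Modules} (g : P ⟶ toP N) :
    (shf X).obj P ⟶ N :=
  (PresheafOfModules.sheafificationHomEquiv (R := X.ringCatSheaf) (𝟙 X.ringCatSheaf.obj)).symm
    (PresheafOfModules.homMk ((PresheafOfModules.toPresheaf _).map g)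
      (fun U r m ↦ (g.app U).hom.map_smul r m))

lemma toShf_shfLift {X : Scheme.{u}} {P : X.PresheafOfModules} {N : X.Modules} (g : P ⟶ toP N) :
    toShf P ≫ (shfLift g).val = g := by
  apply (PresheafOfModules.toPresheaf _).map_injective
  have := PresheafOfModules.toPresheaf_map_sheafificationHomEquiv_def (R := X.ringCatSheaf)
    (𝟙 X.ringCatSheaf.obj) (shfLift g)
  unfold shfLift at this
  rw [Equiv.apply_symm_apply] at this
  exact this.symm

/-- The presheaf tensor product `U ↦ P(U) ⊗ Q(U)` over `𝒪_X(U)`. -/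
def preTens {X : Scheme.{u}} (P Q : X.PresheafOfModules) : X.PresheafOfModules :=
  PresheafOfModules.Monoidal.tensorObj (R := X.presheaf) P Q

/-- Functoriality of the presheaf tensor product. -/
def preTensHom {X : Scheme.{u}} {P P' Q Q' : X.PresheafOfModules} (g : P ⟶ P') (h : Q ⟶ Q') :
    preTens P Q ⟶ preTens P' Q' :=
  PresheafOfModules.Monoidal.tensorHom (R := X.presheaf) (M₁ := P) (M₂ := P') (M₃ := Q)
    (M₄ := Q') g h

/-- The tensor product of two sheaves of modules: the sheaf associated to
`U ↦ M(U) ⊗ N(U)`. -/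
def tens {X : Scheme.{u}} (M N : X.Modules) : X.Modules := (shf X).obj (preTens (toP M) (toP N))

/-- The tensor product of two morphisms of sheaves of modules. -/
def tensHom {X : Scheme.{u}} {M M' N N' : X.Modules} (g : M ⟶ M') (h : N ⟶ N') :
    tens M N ⟶ tens M' N' :=
  (shf X).map (preTensHom (P := toP M) (P' := toP M') (Q := toP N) (Q' := toP N') g.val h.val)

/-- The section `s ⊗ t` of `M ⊗ N` given by sections `s` of `M` and `t` of `N`. -/
def tmul {X : Scheme.{u}} {M N : X.Modules} {U : X.Opens} (s : Γ(M, U)) (t : Γ(N, U)) :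
    Γ(tens M N, U) :=
  (toShf (preTens (toP M) (toP N))).app (op U)
    (TensorProduct.tmul (M := Γ(M, U)) (N := Γ(N, U)) Γ(X, U) s t)

variable {X : Scheme.{u}} {M N M' N' : X.Modules} {U V : X.Opens}

lemma tmul_add (s : Γ(M, U)) (t t' : Γ(N, U)) : tmul s (t + t') = tmul s t + tmul s t' := by
  unfold tmul
  erw [TensorProduct.tmul_add, map_add]
  rfl

lemma add_tmul (s s' : Γ(M, U)) (t : Γ(N, U)) : tmul (s + s') t = tmul s t + tmul s' t := by
  unfold tmul
  erw [TensorProduct.add_tmul, map_add]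
  rfl

lemma smul_tmul' (r : Γ(X, U)) (s : Γ(M, U)) (t : Γ(N, U)) : tmul (r • s) t = r • tmul s t := by
  unfold tmul
  exact ((toShf (preTens (toP M) (toP N))).app (op U)).hom.map_smul r (TensorProduct.tmul (M := Γ(M, U)) (N := Γ(N, U)) Γ(X, U) s t)

lemma smul_tmul (r : Γ(X, U)) (s : Γ(M, U)) (t : Γ(N, U)) : tmul (r • s) t = tmul s (r • t) := by
  unfold tmul
  congr 1
  exact TensorProduct.smul_tmul (R := Γ(X, U)) (R' := Γ(X, U)) (M := Γ(M, U)) (N := Γ(N, U)) r s t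

lemma map_tmul (i : U ⟶ V) (s : Γ(M, V)) (t : Γ(N, V)) :
    (tens M N).presheaf.map i.op (tmul s t) = tmul (M.presheaf.map i.op s) (N.presheaf.map i.op t) := by
  unfold tmul
  exact (PresheafOfModules.naturality_apply (toShf (preTens (toP M) (toP N))) i.op _).symm

lemma tensHom_app_tmul (f : M ⟶ M') (g : N ⟶ N') (s : Γ(M, U)) (t : Γ(N, U)) :
    (tensHom f g).app U (tmul s t) = tmul (f.app U s) (g.app U t) := by
  unfold tmul
  have := toSheafify_naturality (Opens.grothendieckTopology X) ((PresheafOfModules.toPresheaf _).map (preTensHom (P := toP M) (P' := toP M') (Q := toP N) (Q' := toP N') f.val g.val))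
  exact congr(($this).app (op U) (TensorProduct.tmul (M := Γ(M, U)) (N := Γ(N, U)) Γ(X, U) s t)).symm

lemma tmul_zero (s : Γ(M, U)) : tmul s (0 : Γ(N, U)) = 0 := by
  have := tmul_add s (0 : Γ(N, U)) 0
  simpa using this

lemma zero_tmul (t : Γ(N, U)) : tmul (0 : Γ(M, U)) t = 0 := by
  have := add_tmul (0 : Γ(M, U)) 0 t
  simpa using this


section Algebra
open scoped TensorProduct

lemma exists_vanishesTrivially {R B P ι : Type*} [CommRing R] [AddCommGroup B] [Module R B] [AddCommGroup P]
    [Module R P] [Fintype ι] (b : ι → B) (p : ι → P) (h : ∑ i, b i ⊗ₜ[R] p i = 0) :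
    ∃ (m : ℕ) (c : Fin m → B),
      TensorProduct.VanishesTrivially R (Sum.elim b c) (Sum.elim p (fun _ ↦ (0 : P))) := by
  classical
  let G : (ι ⊕ B →₀ R) →ₗ[R] B := Finsupp.linearCombination R (Sum.elim b id)
  have hG : Function.Surjective G := fun x ↦ ⟨Finsupp.single (Sum.inr x) 1, by simp [G]⟩
  have hex : Function.Exact (LinearMap.ker G).subtype G := LinearMap.exact_subtype_ker_map G
  have hex' : Function.Exact (LinearMap.rTensor P (LinearMap.ker G).subtype) (LinearMap.rTensor P G) := by
    exact rTensor_exact (M := ↥(LinearMap.ker G)) P hex hG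
  obtain ⟨z, hz⟩ := (hex' (∑ i, Finsupp.single (Sum.inl i) (1 : R) ⊗ₜ[R] p i)).mp (by simpa [G] using h)
  obtain ⟨l, n, q, rfl⟩ := TensorProduct.exists_sum_tmul_eq z
  have hcoord : ∀ x : ι ⊕ B, Sum.elim p (fun _ ↦ (0 : P)) x = ∑ j, (n j : ι ⊕ B →₀ R) x • q j := by
    intro x
    have := congrArg (fun w ↦ TensorProduct.lid R P (LinearMap.rTensor P (Finsupp.lapply (R := R) x) w)) hz
    simp only [map_sum, LinearMap.rTensor_tmul, TensorProduct.lid_tmul, Submodule.subtype_apply, Finsupp.lapply_apply] at this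
    rw [this]
    cases x with
    | inl i => simp [Finsupp.single_apply]
    | inr y => simp
  let T : Finset B := Finset.univ.biUnion fun j ↦ ((n j : ι ⊕ B →₀ R).support).preimage Sum.inr (Sum.inr_injective.injOn)
  refine ⟨T.card, fun t ↦ (T.equivFin.symm t : B), l, fun x j ↦ (n j : ι ⊕ B →₀ R) (Sum.map id (fun t ↦ (T.equivFin.symm t : B)) x), q, ?_, ?_⟩
  · intro x
    rw [← hcoord]
    cases x <;> rfl
  · intro j
    have hj : G (n j) = 0 := (n j).2
    simp only [G] at hj
    rw [Fintype.sum_sum_type]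
    simp only [Sum.map_inl, Sum.map_inr, Sum.elim_inl, Sum.elim_inr, id]
    rw [T.equivFin.symm.sum_comp (fun t ↦ (n j : ι ⊕ B →₀ R) (Sum.inr (t : B)) • (t : B)),
      Finset.sum_coe_sort T (fun t ↦ (n j : ι ⊕ B →₀ R) (Sum.inr (t : B)) • (t : B))]
    rw [Finsupp.linearCombination_apply, Finsupp.sum_of_support_subset _ (s := Finset.univ.disjSum T) _ _ (by simp)] at hj
    · simpa [Finset.sum_disjSum] using hj
    · intro x hx
      cases x with
      | inl i => simp
      | inr y =>
        simp only [Finset.inr_mem_disjSum, T, Finset.mem_biUnion, Finset.mem_univ, true_and, Finset.mem_preimage]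
        exact ⟨j, hx⟩

end Algebra

section Site
open scoped TensorProduct
open PresheafOfModules.Monoidal

variable {C : Type*} [Category C] (J : GrothendieckTopology C)

lemma exists_sieve_le {U : C} {ι : Type*} [Finite ι] (S : ι → Sieve U) (hS : ∀ i, S i ∈ J U) :
    ∃ T ∈ J U, ∀ i, T ≤ S i := by
  classical
  cases nonempty_fintype ι
  have : ∀ s : Finset ι, ∃ T ∈ J U, ∀ i ∈ s, T ≤ S i := by
    intro s
    induction s using Finset.induction_on with
    | empty => exact ⟨⊤, J.top_mem _, by simp⟩
    | insert a s _ ih =>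
      obtain ⟨T, hT, h⟩ := ih
      refine ⟨S a ⊓ T, J.intersection_covering (hS a) hT, ?_⟩
      intro i hi
      rcases Finset.mem_insert.mp hi with rfl | hi
      · exact inf_le_left
      · exact inf_le_right.trans (h i hi)
  obtain ⟨T, hT, h⟩ := this Finset.univ
  exact ⟨T, hT, fun i ↦ h i (Finset.mem_univ _)⟩

variable {R : Cᵒᵖ ⥤ CommRingCat.{u}} {A B : PresheafOfModules.{u} (R ⋙ forget₂ CommRingCat RingCat)}
  (f : A ⟶ B) (P : PresheafOfModules.{u} (R ⋙ forget₂ CommRingCat RingCat))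

lemma locallySurjective_tensor [Presheaf.IsLocallySurjective J ((PresheafOfModules.toPresheaf _).map f)] :
    Presheaf.IsLocallySurjective J ((PresheafOfModules.toPresheaf _).map (tensorHom f (𝟙 P))) where
  imageSieve_mem {U} s := by
    change TensorProduct (R.obj (op U)) (B.obj (op U)) (P.obj (op U)) at s
    induction s with
    | zero =>
      convert J.top_mem U
      ext V i
      simp only [Sieve.top_apply, iff_true]
      exact ⟨0, (map_zero _).trans (map_zero _).symm⟩
    | tmul b q =>
      refine J.superset_covering ?_ (Presheaf.imageSieve_mem J ((PresheafOfModules.toPresheaf _).map f) (U := op U) b)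
      rintro V i ⟨a, ha⟩
      refine ⟨TensorProduct.tmul (R.obj (op V)) (M := A.obj (op V)) (N := P.obj (op V)) a (P.map i.op q), ?_⟩
      exact congrArg (fun z ↦ TensorProduct.tmul (R.obj (op V)) (M := B.obj (op V)) (N := P.obj (op V)) z (P.map i.op q)) ha
    | add x y hx hy =>
      refine J.superset_covering ?_ (J.intersection_covering hx hy)
      rintro V i ⟨⟨a, ha⟩, ⟨a', ha'⟩⟩
      exact ⟨a + a', (map_add _ a a').trans ((congr_arg₂ (· + ·) ha ha').trans (map_add _ x y).symm)⟩

lemma locallyInjective_tensor [Presheaf.IsLocallySurjective J ((PresheafOfModules.toPresheaf _).map f)]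
    [Presheaf.IsLocallyInjective J ((PresheafOfModules.toPresheaf _).map f)] :
    Presheaf.IsLocallyInjective J ((PresheafOfModules.toPresheaf _).map (tensorHom f (𝟙 P))) := by
  have hinj : ∀ (V : C) (w : A.obj (op V)), f.app (op V) w = 0 →
      Presheaf.equalizerSieve (F := A.presheaf) (X := op V) w (0 : A.obj (op V)) ∈ J V := fun V w hw ↦ by
    have h := Presheaf.equalizerSieve_mem J ((PresheafOfModules.toPresheaf _).map f) (X := op V) w (0 : A.obj (op V))
      (hw.trans (map_zero (f.app (op V)).hom).symm)
    exact h
  constructor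
  intro U x y h
  let t : TensorProduct (R.obj U) (A.obj U) (P.obj U) := x - y
  suffices hz : Presheaf.equalizerSieve (F := (tensorObj A P).presheaf) (X := U) t 0 ∈ J U.unop by
    refine J.superset_covering ?_ hz
    intro V i hi
    have h1 : (tensorObj A P).presheaf.map i.op t = 0 := hi.trans (map_zero _)
    exact sub_eq_zero.mp ((map_sub ((tensorObj A P).presheaf.map i.op).hom x y).symm.trans h1)
  have ht : (tensorHom f (𝟙 P)).app U t = 0 :=
    (map_sub ((tensorHom f (𝟙 P)).app U).hom x y).trans (sub_eq_zero.mpr h)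
  clear_value t
  obtain ⟨n, a, q, rfl⟩ := TensorProduct.exists_sum_tmul_eq t
  have ht' : ∑ x, TensorProduct.tmul (R.obj U) (M := B.obj U) (N := P.obj U) (f.app U (a x)) (q x) = 0 :=
    (map_sum ((tensorHom f (𝟙 P)).app U).hom _ _).symm.trans ht
  obtain ⟨m, c, l, r, z, hz, hr⟩ := exists_vanishesTrivially _ _ ht'
  obtain ⟨S, hS, hSc⟩ := exists_sieve_le J (fun j ↦ Presheaf.imageSieve (U := U.unop) ((PresheafOfModules.toPresheaf _).map f) (c j))
    (fun j ↦ Presheaf.imageSieve_mem J ((PresheafOfModules.toPresheaf _).map f) (U := U) (c j))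
  refine J.transitive hS _ fun V i hi ↦ ?_
  choose c' hc' using fun j ↦ hSc j i hi
  let e : Fin n ⊕ Fin m → A.obj (op V) := Sum.elim (fun x ↦ A.map i.op (a x)) c'
  have he : ∀ x, f.app (op V) (e x) = B.map i.op (Sum.elim (fun x ↦ f.app U (a x)) c x) := by
    intro x
    cases x with
    | inl x => exact PresheafOfModules.naturality_apply f i.op (a x)
    | inr x => exact hc' x
  let w : Fin l → A.obj (op V) := fun j ↦ ∑ x, R.map i.op (r x j) • e x
  have hw : ∀ j, f.app (op V) (w j) = 0 := by
    intro j
    have h1 : f.app (op V) (w j) = ∑ x, f.app (op V) (R.map i.op (r x j) • e x) := map_sum (f.app (op V)).hom _ _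
    have h2 : ∀ x, f.app (op V) (R.map i.op (r x j) • e x) = B.map i.op (r x j • Sum.elim (fun x ↦ f.app U (a x)) c x) := by
      intro x
      refine ((f.app (op V)).hom.map_smul (R.map i.op (r x j)) (e x)).trans ?_
      refine (congrArg (fun y ↦ R.map i.op (r x j) • y) (he x)).trans ?_
      exact (B.map_smul i.op (r x j) _).symm
    rw [h1, Finset.sum_congr rfl fun x _ ↦ h2 x]
    refine (map_sum (B.restrictₛₗ i.op) _ _).symm.trans ?_
    rw [hr j, map_zero]
  obtain ⟨S', hS', hS'w⟩ := exists_sieve_le J (fun j ↦ Presheaf.equalizerSieve (F := A.presheaf) (X := op V) (w j) (0 : A.obj (op V)))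
    (fun j ↦ hinj V (w j) (hw j))
  refine J.superset_covering ?_ hS'
  intro W j hj
  have hwj : ∀ o, A.map j.op (w o) = 0 := fun o ↦ (hS'w o j hj).trans (map_zero (A.map j.op).hom)
  refine Eq.trans ?_ (map_zero _).symm
  let e' : Fin n ⊕ Fin m → A.obj (op W) := fun x ↦ A.map j.op (e x)
  let z' : Fin n ⊕ Fin m → P.obj (op W) := fun x ↦ P.map j.op (P.map i.op (Sum.elim q (fun _ ↦ 0) x))
  have h1 : (tensorObj A P).presheaf.map (j ≫ i).op (∑ x, a x ⊗ₜ[R.obj U] q x) =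
      ∑ x, TensorProduct.tmul (R.obj (op W)) (M := A.obj (op W)) (N := P.obj (op W)) (e' x) (z' x) := by
    refine (map_sum ((tensorObj A P).presheaf.map (j ≫ i).op).hom _ _).trans ?_
    rw [Fintype.sum_sum_type]
    have h0 : ∀ y : Fin m, z' (Sum.inr y) = 0 := fun y ↦
      (congrArg (P.map j.op) (map_zero (P.map i.op).hom)).trans (map_zero (P.map j.op).hom)
    simp only [h0, TensorProduct.tmul_zero, Finset.sum_const_zero, add_zero]
    refine Finset.sum_congr rfl fun x _ ↦ ?_
    refine (tensorObj_map_tmul (j ≫ i).op (a x) (q x)).trans ?_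
    exact congr_arg₂ (fun u v ↦ TensorProduct.tmul (R.obj (op W)) (M := A.obj (op W)) (N := P.obj (op W)) u v)
      (A.map_comp_apply i.op j.op _) (P.map_comp_apply i.op j.op _)
  have h2 : ∀ x, z' x = ∑ o, R.map j.op (R.map i.op (r x o)) • P.map j.op (P.map i.op (z o)) := by
    intro x
    simp only [z']
    rw [hz x]
    refine (congrArg (P.map j.op) (map_sum (P.restrictₛₗ i.op) _ _)).trans ?_
    refine (map_sum (P.restrictₛₗ j.op) _ _).trans (Finset.sum_congr rfl fun o _ ↦ ?_)
    exact (congrArg (P.map j.op) (P.map_smul i.op (r x o) (z o))).trans (P.map_smul j.op _ _)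
  have h3 : ∀ o, ∑ x, R.map j.op (R.map i.op (r x o)) • e' x = 0 := by
    intro o
    refine Eq.trans ?_ (hwj o)
    refine ((map_sum (A.restrictₛₗ j.op) _ _).trans (Finset.sum_congr rfl fun x _ ↦ ?_)).symm
    exact A.map_smul j.op _ _
  refine h1.trans ?_
  exact TensorProduct.sum_tmul_eq_zero_of_vanishesTrivially _ ⟨l, _, _, h2, h3⟩
end Site

/-- Tensoring the canonical map from `P` to its associated sheaf with `Q` gives a map that
becomes an isomorphism after sheafification. -/
lemma isIso_shf_preTensHom (P Q : X.PresheafOfModules) :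
    IsIso ((shf X).map (preTensHom (toShf P) (𝟙 Q))) := by
  have h1 : Presheaf.IsLocallySurjective (Opens.grothendieckTopology X)
      ((PresheafOfModules.toPresheaf (X.presheaf ⋙ forget₂ CommRingCat RingCat)).map (toShf P)) :=
    inferInstanceAs (Presheaf.IsLocallySurjective (Opens.grothendieckTopology X)
      (CategoryTheory.toSheafify _ P.presheaf))
  have h2 : Presheaf.IsLocallyInjective (Opens.grothendieckTopology X)
      ((PresheafOfModules.toPresheaf (X.presheaf ⋙ forget₂ CommRingCat RingCat)).map (toShf P)) :=
    inferInstanceAs (Presheaf.IsLocallyInjective (Opens.grothendieckTopology X)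
      (CategoryTheory.toSheafify _ P.presheaf))
  have h3 := locallySurjective_tensor (R := X.presheaf) (A := P) (B := toP ((shf X).obj P))
    (Opens.grothendieckTopology X) (toShf P) Q
  have h4 := locallyInjective_tensor (R := X.presheaf) (A := P) (B := toP ((shf X).obj P))
    (Opens.grothendieckTopology X) (toShf P) Q
  have h5 := @GrothendieckTopology.W_of_isLocallyBijective _ _ (Opens.grothendieckTopology X)
    _ _ _ _ _ _ _ _ _ _ h4 h3
  have h6 := PresheafOfModules.inverseImage_W_toPresheaf_eq_inverseImage_isomorphisms
    (R := X.ringCatSheaf) (𝟙 X.ringCatSheaf.obj)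
  exact (congrFun (congrFun (congrFun h6 _) _) _).mp h5

/-- The associativity isomorphism of the presheaf tensor product. -/
def preAssoc (P Q S : X.PresheafOfModules) :
    preTens (preTens P Q) S ⟶ preTens P (preTens Q S) :=
  (MonoidalCategory.associator
    (C := PresheafOfModules.{u} (X.presheaf ⋙ forget₂ CommRingCat RingCat)) P Q S).hom

/-- The canonical map from the sheafification of the triple presheaf tensor product to the
iterated tensor product of sheaves. -/
def tensWhisk (M N P : X.Modules) :
    (shf X).obj (preTens (preTens (toP M) (toP N)) (toP P)) ⟶ tens (tens M N) P :=
  (shf X).map (preTensHom (toShf (preTens (toP M) (toP N))) (𝟙 (toP P)))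

lemma isIso_tensWhisk (M N P : X.Modules) : IsIso (tensWhisk M N P) :=
  isIso_shf_preTensHom (preTens (toP M) (toP N)) (toP P)

/-- The canonical map `(M ⊗ N) ⊗ P ⟶ M ⊗ (N ⊗ P)`, given by `(s ⊗ t) ⊗ u ↦ s ⊗ (t ⊗ u)`. -/
def tensAssoc (M N P : X.Modules) : tens (tens M N) P ⟶ tens M (tens N P) :=
  letI := isIso_tensWhisk M N P
  inv (tensWhisk M N P) ≫ (shf X).map (preAssoc (toP M) (toP N) (toP P)) ≫
    (shf X).map (preTensHom (𝟙 (toP M)) (toShf (preTens (toP N) (toP P))))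

lemma shf_map_app_toShf {P Q : X.PresheafOfModules} (g : P ⟶ Q) (x : P.obj (op U)) :
    ((shf X).map g).app U ((toShf P).app (op U) x) = (toShf Q).app (op U) (g.app (op U) x) := by
  have := toSheafify_naturality (Opens.grothendieckTopology X)
    ((PresheafOfModules.toPresheaf _).map g)
  exact congr(($this).app (op U) x).symm

lemma tensAssoc_app_tmul {P : X.Modules} (s : Γ(M, U)) (t : Γ(N, U)) (v : Γ(P, U)) :
    (tensAssoc M N P).app U (tmul (tmul s t) v) = tmul s (tmul t v) := by
  have := isIso_tensWhisk M N P
  let x : (preTens (preTens (toP M) (toP N)) (toP P)).obj (op U) :=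
    TensorProduct.tmul (M := TensorProduct Γ(X, U) Γ(M, U) Γ(N, U)) (N := Γ(P, U)) Γ(X, U)
      (TensorProduct.tmul Γ(X, U) s t) v
  have h1 : tmul (tmul s t) v = (tensWhisk M N P).app U
      ((toShf (preTens (preTens (toP M) (toP N)) (toP P))).app (op U) x) :=
    (shf_map_app_toShf (preTensHom (toShf (preTens (toP M) (toP N))) (𝟙 (toP P))) x).symm
  have h2 := congr(($(IsIso.hom_inv_id (tensWhisk M N P))).app U
      ((toShf (preTens (preTens (toP M) (toP N)) (toP P))).app (op U) x))
  rw [h1]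
  refine (congrArg (fun y ↦ ((shf X).map (preAssoc (toP M) (toP N) (toP P)) ≫
    (shf X).map (preTensHom (𝟙 (toP M)) (toShf (preTens (toP N) (toP P))))).app U y) h2).trans ?_
  refine (congrArg (fun y ↦ ((shf X).map (preTensHom (𝟙 (toP M))
    (toShf (preTens (toP N) (toP P))))).app U y)
      (shf_map_app_toShf (preAssoc (toP M) (toP N) (toP P)) x)).trans ?_
  exact shf_map_app_toShf (preTensHom (𝟙 (toP M)) (toShf (preTens (toP N) (toP P)))) _

/-- The structure sheaf as a module over itself. -/
abbrev structureModule (X : Scheme.{u}) : X.Modules := SheafOfModules.unit X.ringCatSheaf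

/-- The canonical map `𝒪_X ⊗ M ⟶ M`, given by `r ⊗ s ↦ r • s`. -/
def tensUnit (M : X.Modules) : tens (structureModule X) M ⟶ M :=
  shfLift (P := preTens (toP (structureModule X)) (toP M)) (MonoidalCategory.leftUnitor
    (C := PresheafOfModules.{u} (X.presheaf ⋙ forget₂ CommRingCat RingCat)) (toP M)).hom

lemma tensUnit_app_tmul (r : Γ(X, U)) (s : Γ(M, U)) :
    (tensUnit M).app U (tmul (M := structureModule X) r s) = r • s := by
  have h := toShf_shfLift (P := preTens (toP (structureModule X)) (toP M)) (N := M)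
    (MonoidalCategory.leftUnitor
      (C := PresheafOfModules.{u} (X.presheaf ⋙ forget₂ CommRingCat RingCat)) (toP M)).hom
  exact congr(($h).app (op U) (TensorProduct.tmul (M := Γ(X, U)) (N := Γ(M, U)) Γ(X, U) r s))


variable {k : CommRingCat.{u}}

/-- The structure map from the constant presheaf `k` to `𝒪_X`. -/
def constToPresheaf (f : X ⟶ Spec k) : (Functor.const (Opens X)ᵒᵖ).obj k ⟶ X.presheaf where
  app U := (Scheme.ΓSpecIso k).inv ≫ f.appTop ≫ X.presheaf.map (homOfLE le_top).op
  naturality U V i := by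
    simp only [Functor.const_obj_obj, Functor.const_obj_map, Category.id_comp, Category.assoc, ← Functor.map_comp]
    rfl

/-- The presheaf `U ↦ Ω_{𝒪_X(U)/k}` of Kähler differentials. -/
def preOmega (f : X ⟶ Spec k) : X.PresheafOfModules :=
  PresheafOfModules.DifferentialsConstruction.relativeDifferentials' (constToPresheaf f)

/-- The sheaf of Kähler differentials `Ω_X` of `X` over `k`. -/
def Omega (f : X ⟶ Spec k) : X.Modules := (shf X).obj (preOmega f)

/-- The exterior derivative `d : 𝒪_X ⟶ Ω_X` on sections over `U`. -/
def dd (f : X ⟶ Spec k) (U : X.Opens) : Γ(X, U) →+ Γ(Omega f, U) :=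
  AddMonoidHom.mk' (fun r ↦ (toShf (preOmega f)).app (op U)
    ((PresheafOfModules.DifferentialsConstruction.derivation' (constToPresheaf f)).d (X := op U) r)) (by
    intro a b
    erw [map_add, map_add]; rfl)

lemma dd_mul (f : X ⟶ Spec k) (a b : Γ(X, U)) : dd f U (a * b) = a • dd f U b + b • dd f U a := by
  have h := (PresheafOfModules.DifferentialsConstruction.derivation' (constToPresheaf f)).d_mul (X := op U) a b
  have h1 := congr((toShf (preOmega f)).app (op U) $h)
  have h2 := ((toShf (preOmega f)).app (op U)).hom.map_add (a • (PresheafOfModules.DifferentialsConstruction.derivation' (constToPresheaf f)).d (X := op U) b) (b • (PresheafOfModules.DifferentialsConstruction.derivation' (constToPresheaf f)).d (X := op U) a)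
  have h3 := ((toShf (preOmega f)).app (op U)).hom.map_smul a ((PresheafOfModules.DifferentialsConstruction.derivation' (constToPresheaf f)).d (X := op U) b)
  have h4 := ((toShf (preOmega f)).app (op U)).hom.map_smul b ((PresheafOfModules.DifferentialsConstruction.derivation' (constToPresheaf f)).d (X := op U) a)
  exact h1.trans (h2.trans (congr_arg₂ (· + ·) h3 h4))

lemma map_dd (f : X ⟶ Spec k) (i : U ⟶ V) (a : Γ(X, V)) :
    (Omega f).presheaf.map i.op (dd f V a) = dd f U (X.presheaf.map i.op a) := by
  have h := (PresheafOfModules.DifferentialsConstruction.derivation' (constToPresheaf f)).d_map i.op a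
  have h1 := congr((toShf (preOmega f)).app (op U) $h)
  exact ((PresheafOfModules.naturality_apply (toShf (preOmega f)) i.op _)).symm.trans h1.symm

/-- A connection on `W`: a map of abelian sheaves `∇ : W ⟶ W ⊗ Ω_X` satisfying the Leibniz rule
`∇ (r s) = r ∇ s + s ⊗ dr`. -/
structure Connection (f : X ⟶ Spec k) (W : X.Modules) where
  nabla (U : X.Opens) : Γ(W, U) →+ Γ(tens W (Omega f), U)
  map_nabla {U V : X.Opens} (i : U ⟶ V) (s : Γ(W, V)) :
    (tens W (Omega f)).presheaf.map i.op (nabla V s) = nabla U (W.presheaf.map i.op s)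
  leibniz {U : X.Opens} (r : Γ(X, U)) (s : Γ(W, U)) :
    nabla U (r • s) = r • nabla U s + tmul s (dd f U r)

/-- A morphism of sheaves of modules given by compatible linear maps on sections. -/
def homMk (φ : ∀ U : X.Opens, Γ(M, U) →+ Γ(N, U))
    (hmap : ∀ {U V : X.Opens} (i : U ⟶ V) (s : Γ(M, V)), N.presheaf.map i.op (φ V s) = φ U (M.presheaf.map i.op s))
    (hsmul : ∀ {U : X.Opens} (r : Γ(X, U)) (s : Γ(M, U)), φ U (r • s) = r • φ U s) : M ⟶ N where
  val := PresheafOfModules.homMk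
    { app U := AddCommGrpCat.ofHom (φ U.unop)
      naturality U V i := by ext s; exact (hmap i.unop s).symm }
    (fun _ r m ↦ hsmul r m)

lemma homMk_app {φ : ∀ U : X.Opens, Γ(M, U) →+ Γ(N, U)} {hmap hsmul} (s : Γ(M, U)) :
    (homMk φ hmap hsmul : M ⟶ N).app U s = φ U s := rfl


/-- The second fundamental form `W' ⟶ W ⟶ W ⊗ Ω_X ⟶ (W / W') ⊗ Ω_X` of a subsheaf `ι : W' ⟶ W`,
the composition of `ι`, the connection and the quotient map. -/
def secondForm {f : X ⟶ Spec k} {W : X.Modules} (D : Connection f W) {W' : X.Modules} (ι : W' ⟶ W) :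
    W' ⟶ tens (cokernel ι) (Omega f) :=
  homMk (fun U ↦ ((tensHom (cokernel.π ι) (𝟙 (Omega f))).app U).hom.comp ((D.nabla U).comp (ι.app U).hom))
    (by
      intro U V i s
      have h1 := congr(($(((tensHom (cokernel.π ι) (𝟙 (Omega f))).mapPresheaf.naturality i.op))) (D.nabla V (ι.app V s)))
      have h2 := congr(($((ι.mapPresheaf.naturality i.op))) s)
      refine h1.symm.trans ?_
      change (tensHom (cokernel.π ι) (𝟙 (Omega f))).app U ((tens W (Omega f)).presheaf.map i.op (D.nabla V (ι.app V s))) = _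
      rw [D.map_nabla]
      exact congr((tensHom (cokernel.π ι) (𝟙 (Omega f))).app U (D.nabla U $h2)).symm)
    (by
      intro U r s
      change (tensHom (cokernel.π ι) (𝟙 (Omega f))).app U (D.nabla U (ι.app U (r • s))) = r • (tensHom (cokernel.π ι) (𝟙 (Omega f))).app U (D.nabla U (ι.app U s))
      rw [Scheme.Modules.Hom.app_smul, D.leibniz, map_add, Scheme.Modules.Hom.app_smul, tensHom_app_tmul]
      have : (cokernel.π ι).app U (ι.app U s) = 0 :=
        congr(($(cokernel.condition ι)).app U s)
      rw [this]
      have : ∀ t, tmul (0 : Γ(cokernel ι, U)) (t : Γ(Omega f, U)) = 0 := by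
        intro t
        have := add_tmul (0 : Γ(cokernel ι, U)) 0 t
        simpa using this
      rw [this, add_zero])

/-- The ring endomorphism `x ↦ x ^ p` of a commutative ring in which `p = 0`. -/
def powHom (p : ℕ) [Fact p.Prime] (R : Type u) [CommRing R] (h : (p : R) = 0) : R →+* R where
  toFun x := x ^ p
  map_one' := one_pow p
  map_mul' a b := mul_pow a b p
  map_zero' := zero_pow (Fact.out : p.Prime).ne_zero
  map_add' a b := by
    obtain h' := add_pow_prime_eq (Fact.out : p.Prime) a b
    rw [h', h]; ring

lemma cast_eq_zero {k : Type u} [Field k] (p : ℕ) [CharP k p] (f : X ⟶ Spec (.of k)) (U : X.Opens) : (p : Γ(X, U)) = 0 := by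
  have := map_natCast ((constToPresheaf f).app (op U)).hom p
  rw [← this]
  have h : ((p : CommRingCat.of k)) = 0 := CharP.cast_eq_zero k p
  exact (congrArg ((constToPresheaf f).app (op U)).hom h).trans (map_zero _)

/-- The Frobenius morphism of `X`: the identity on points, and `s ↦ s ^ p` on functions. -/
def absFrobenius {k : Type u} [Field k] (p : ℕ) [Fact p.Prime] [CharP k p] (f : X ⟶ Spec (.of k)) : X ⟶ X where
  base := 𝟙 _
  c := { app U := CommRingCat.ofHom (powHom p Γ(X, U.unop) (cast_eq_zero p f U.unop))
         naturality U V i := by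
          ext s
          exact (map_pow (X.presheaf.map i).hom s p).symm }
  prop x := by
    constructor
    intro s hs
    obtain ⟨U, hx, t, rfl⟩ := TopCat.Presheaf.exists_germ_eq X.presheaf s
    change IsUnit ((X.presheaf.germ U x hx).hom t)
    rw [← isUnit_pow_iff (Fact.out : p.Prime).ne_zero, ← map_pow]
    have := PresheafedSpace.stalkMap_germ_apply (X := X.toPresheafedSpace) (Y := X.toPresheafedSpace)
      { base := 𝟙 _, c := { app U := CommRingCat.ofHom (powHom p Γ(X, U.unop) (cast_eq_zero p f U.unop))
                            naturality U V i := by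
                              ext s
                              exact (map_pow (X.presheaf.map i).hom s p).symm } } U x hx t
    exact (congrArg IsUnit this).mp hs

lemma absFrobenius_app {k : Type u} [Field k] (p : ℕ) [Fact p.Prime] [CharP k p] (f : X ⟶ Spec (.of k)) (U : X.Opens) (s : Γ(X, U)) :
   (absFrobenius p f).app U s = s ^ p := rfl
lemma absFrobenius_preimage {k : Type u} [Field k] (p : ℕ) [Fact p.Prime] [CharP k p] (f : X ⟶ Spec (.of k)) (U : X.Opens) :
   (absFrobenius p f) ⁻¹ᵁ U = U := rfl
/-- Sections over `U` of the sheaf of first order jets of `W`: the abelian group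
`W(U) × (W ⊗ Ω)(U)`, with `r • (s, ω) = (r s, r ω + s ⊗ dr)`, so that a linear section of the
first projection is the same as a connection on `W`. -/
def JetSec (f : X ⟶ Spec k) (W : X.Modules) (U : X.Opens) : Type u := Γ(W, U) × Γ(tens W (Omega f), U)

instance (f : X ⟶ Spec k) (W : X.Modules) (U : X.Opens) : AddCommGroup (JetSec f W U) :=
  inferInstanceAs (AddCommGroup (Γ(W, U) × Γ(tens W (Omega f), U)))

instance (f : X ⟶ Spec k) (W : X.Modules) (U : X.Opens) : Module Γ(X, U) (JetSec f W U) where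
  smul r x := (r • x.1, r • x.2 + tmul x.1 (dd f U r))
  one_smul x := by
    refine Prod.ext (one_smul _ _) ?_
    change (1 : Γ(X, U)) • x.2 + tmul x.1 (dd f U 1) = x.2
    have : dd f U 1 = 0 := by simpa using dd_mul f (1 : Γ(X, U)) 1
    rw [this, tmul_zero, one_smul, add_zero]
  mul_smul r s x := by
    refine Prod.ext (mul_smul _ _ _) ?_
    change (r * s) • x.2 + tmul x.1 (dd f U (r * s)) =
      r • (s • x.2 + tmul x.1 (dd f U s)) + tmul (s • x.1) (dd f U r)
    rw [dd_mul, tmul_add, ← smul_tmul, ← smul_tmul, smul_tmul' r, smul_add, mul_smul, add_assoc]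
  smul_zero r := by
    refine Prod.ext (smul_zero _) ?_
    change r • (0 : Γ(tens W (Omega f), U)) + tmul (0 : Γ(W, U)) (dd f U r) = 0
    rw [zero_tmul, smul_zero, add_zero]
  smul_add r x y := by
    refine Prod.ext (smul_add _ _ _) ?_
    change r • (x.2 + y.2) + tmul (x.1 + y.1) (dd f U r) =
      (r • x.2 + tmul x.1 (dd f U r)) + (r • y.2 + tmul y.1 (dd f U r))
    rw [add_tmul, smul_add]; abel
  add_smul r s x := by
    refine Prod.ext (add_smul _ _ _) ?_
    change (r + s) • x.2 + tmul x.1 (dd f U (r + s)) =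
      (r • x.2 + tmul x.1 (dd f U r)) + (s • x.2 + tmul x.1 (dd f U s))
    rw [map_add, tmul_add, add_smul]; abel
  zero_smul x := by
    refine Prod.ext (zero_smul _ _) ?_
    change (0 : Γ(X, U)) • x.2 + tmul x.1 (dd f U 0) = 0
    rw [map_zero, tmul_zero, zero_smul, add_zero]

lemma JetSec.smul_def (f : X ⟶ Spec k) (W : X.Modules) (U : X.Opens) (r : Γ(X, U)) (x : JetSec f W U) :
    r • x = (r • x.1, r • x.2 + tmul x.1 (dd f U r)) := rfl

/-- The sheaf of jets as a presheaf of abelian groups. -/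
def jetPresheaf (f : X ⟶ Spec k) (W : X.Modules) : (Opens X)ᵒᵖ ⥤ Ab.{u} where
  obj U := AddCommGrpCat.of (JetSec f W U.unop)
  map {U V} i := AddCommGrpCat.ofHom
    (AddMonoidHom.prodMap (W.presheaf.map i).hom ((tens W (Omega f)).presheaf.map i).hom :
      (Γ(W, U.unop) × Γ(tens W (Omega f), U.unop)) →+ Γ(W, V.unop) × Γ(tens W (Omega f), V.unop))
  map_id U := by
    ext x
    exact Prod.ext congr($(W.presheaf.map_id U) x.1) congr($((tens W (Omega f)).presheaf.map_id U) x.2)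
  map_comp i j := by
    ext x
    exact Prod.ext congr($(W.presheaf.map_comp i j) x.1) congr($((tens W (Omega f)).presheaf.map_comp i j) x.2)

instance (f : X ⟶ Spec k) (W : X.Modules) (U : (Opens X)ᵒᵖ) : Module (X.ringCatSheaf.obj.obj U) ((jetPresheaf f W).obj U) :=
  inferInstanceAs (Module Γ(X, U.unop) (JetSec f W U.unop))

lemma jet_isSheaf (f : X ⟶ Spec k) (W : X.Modules) : TopCat.Presheaf.IsSheaf (X := X) (jetPresheaf f W) := by
  rw [TopCat.Presheaf.isSheaf_iff_isSheaf_comp (forget Ab)]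
  apply TopCat.Presheaf.isSheaf_of_isSheafUniqueGluing_types
  intro ι U sf hsf
  obtain ⟨s, hs, hs'⟩ := TopCat.Sheaf.existsUnique_gluing ⟨W.presheaf, W.isSheaf⟩ U (fun i ↦ (sf i : JetSec f W (U i)).1)
    (fun i j ↦ congrArg Prod.fst (hsf i j))
  obtain ⟨t, ht, ht'⟩ := TopCat.Sheaf.existsUnique_gluing ⟨(tens W (Omega f)).presheaf, (tens W (Omega f)).isSheaf⟩ U (fun i ↦ (sf i : JetSec f W (U i)).2)
    (fun i j ↦ congrArg Prod.snd (hsf i j))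
  refine ⟨((s, t) : JetSec f W _), fun i ↦ Prod.ext (hs i) (ht i), ?_⟩
  intro y hy
  exact Prod.ext (hs' _ fun i ↦ congrArg Prod.fst (hy i)) (ht' _ fun i ↦ congrArg Prod.snd (hy i))

/-- The sheaf of first order jets of `W`. -/
def jet (f : X ⟶ Spec k) (W : X.Modules) : X.Modules where
  val := PresheafOfModules.ofPresheaf (R := X.ringCatSheaf.obj) (jetPresheaf f W) (by
    intro U V i r m
    refine Prod.ext (W.map_smul i.unop r m.1) ?_
    refine (map_add ((tens W (Omega f)).presheaf.map i).hom _ _).trans ?_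
    exact congr_arg₂ (· + ·) ((tens W (Omega f)).map_smul i.unop r m.2)
     ((map_tmul i.unop m.1 (dd f U.unop r)).trans (congrArg _ (map_dd f i.unop r))))
  isSheaf := jet_isSheaf f W

/-- The projection from jets of `W` to `W`. -/
def jetFst (f : X ⟶ Spec k) (W : X.Modules) : jet f W ⟶ W :=
  homMk (fun U ↦ AddMonoidHom.fst Γ(W, U) Γ(tens W (Omega f), U)) (fun _ _ ↦ rfl) (fun _ _ ↦ rfl)

/-- The Frobenius pullback `F^* G`. -/
abbrev frobPull {k : Type u} [Field k] (p : ℕ) [Fact p.Prime] [CharP k p] (f : X ⟶ Spec (.of k)) (G : X.Modules) : X.Modules :=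
  (Scheme.Modules.pullback (absFrobenius p f)).obj G

/-- The canonical homomorphism `G ⟶ F_* F^* G`. -/
def frobUnit {k : Type u} [Field k] (p : ℕ) [Fact p.Prime] [CharP k p] (f : X ⟶ Spec (.of k)) (G : X.Modules) :
    G ⟶ (Scheme.Modules.pushforward (absFrobenius p f)).obj (frobPull p f G) :=
  (Scheme.Modules.pullbackPushforwardAdjunction (absFrobenius p f)).unit.app G

/-- The pulled back section `F^* s` of `F^* G`. -/
def frobSec {k : Type u} [Field k] (p : ℕ) [Fact p.Prime] [CharP k p] (f : X ⟶ Spec (.of k)) (G : X.Modules) (U : X.Opens) :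
    Γ(G, U) →+ Γ(frobPull p f G, U) := ((frobUnit p f G).app U).hom

lemma dd_pow (f : X ⟶ Spec k) (r : Γ(X, U)) (n : ℕ) : dd f U (r ^ n) = ((n : Γ(X, U)) * r ^ (n - 1)) • dd f U r := by
  induction n with
  | zero =>
    have : dd f U 1 = 0 := by simpa using dd_mul f (1 : Γ(X, U)) 1
    simp [this]
  | succ n ih =>
    rw [pow_succ, dd_mul, ih, smul_smul, ← add_smul]
    congr 1
    cases n with
    | zero => simp
    | succ n => simp only [Nat.cast_add, Nat.cast_one, add_tsub_cancel_right]; ring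

lemma dd_frob {k : Type u} [Field k] (p : ℕ) [Fact p.Prime] [CharP k p] (f : X ⟶ Spec (.of k)) (r : Γ(X, U)) :
    dd f U (r ^ p) = 0 := by
  rw [dd_pow, cast_eq_zero p f, zero_mul, zero_smul]

/-- The homomorphism `G ⟶ F_* (jets of F^* G)` sending `s` to `(F^* s, 0)`. It is linear because
`d (r ^ p) = 0`. -/
def jetOfUnit {k : Type u} [Field k] (p : ℕ) [Fact p.Prime] [CharP k p] (f : X ⟶ Spec (.of k)) (G : X.Modules) :
    G ⟶ (Scheme.Modules.pushforward (absFrobenius p f)).obj (jet f (frobPull p f G)) :=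
  homMk (fun U ↦ (AddMonoidHom.inl Γ(frobPull p f G, U) Γ(tens (frobPull p f G) (Omega f), U)).comp
      (frobSec p f G U))
    (fun {U V} i s ↦ Prod.ext congr($((frobUnit p f G).mapPresheaf.naturality i.op) s).symm (map_zero ((tens (frobPull p f G) (Omega f)).presheaf.map i.op).hom))
    (fun {U} r s ↦ Prod.ext ((frobUnit p f G).app_smul r s) (by
      change (0 : Γ(tens (frobPull p f G) (Omega f), U)) =
        (r ^ p) • (0 : Γ(tens (frobPull p f G) (Omega f), U)) + tmul (frobSec p f G U s) (dd f U (r ^ p))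
      rw [dd_frob, tmul_zero, smul_zero, add_zero]))

/-- The homomorphism `F^* G ⟶ jets of F^* G` adjoint to `s ↦ (F^* s, 0)`. It is a section of the
projection to `F^* G`, that is, a connection. -/
def frobJet {k : Type u} [Field k] (p : ℕ) [Fact p.Prime] [CharP k p] (f : X ⟶ Spec (.of k)) (G : X.Modules) :
    frobPull p f G ⟶ jet f (frobPull p f G) :=
  ((Scheme.Modules.pullbackPushforwardAdjunction (absFrobenius p f)).homEquiv _ _).symm (jetOfUnit p f G)

lemma frobJet_fst {k : Type u} [Field k] (p : ℕ) [Fact p.Prime] [CharP k p] (f : X ⟶ Spec (.of k)) (G : X.Modules) :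
    frobJet p f G ≫ jetFst f _ = 𝟙 _ := by
  apply ((Scheme.Modules.pullbackPushforwardAdjunction (absFrobenius p f)).homEquiv _ _).injective
  unfold frobJet
  rw [Adjunction.homEquiv_naturality_right, Equiv.apply_symm_apply, Adjunction.homEquiv_id]
  rfl

/-- The Cartier connection on `F^* G`: the connection for which all pulled back sections `F^* s`
are horizontal (see `cartier_unit`). -/
def cartier {k : Type u} [Field k] (p : ℕ) [Fact p.Prime] [CharP k p] (f : X ⟶ Spec (.of k)) (G : X.Modules) :
    Connection f (frobPull p f G) where
  nabla U := (AddMonoidHom.snd Γ(frobPull p f G, U) Γ(tens (frobPull p f G) (Omega f), U)).comp ((frobJet p f G).app U).hom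
  map_nabla i s := congrArg Prod.snd congr($((frobJet p f G).mapPresheaf.naturality i.op) s).symm
  leibniz {U} r s := by
    have h := congrArg Prod.snd ((frobJet p f G).app_smul r s)
    have h2 : ((frobJet p f G).app U s).1 = s := congr(($(frobJet_fst p f G)).app U s)
    refine h.trans ?_
    change r • ((frobJet p f G).app U s).2 + tmul ((frobJet p f G).app U s).1 _ = _
    rw [h2]
    rfl

lemma cartier_unit {k : Type u} [Field k] (p : ℕ) [Fact p.Prime] [CharP k p] (f : X ⟶ Spec (.of k)) (G : X.Modules) (s : Γ(G, U)) :
    (cartier p f G).nabla U (frobSec p f G U s) = 0 := by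
  have h := (Scheme.Modules.pullbackPushforwardAdjunction (absFrobenius p f)).homEquiv_unit (f := frobJet p f G)
  unfold frobJet at h
  rw [Equiv.apply_symm_apply] at h
  exact congrArg Prod.snd congr(($h).app U s).symm

/-! ### The filtration defined by a connection and a subsheaf -/

section Filtration

variable {k : CommRingCat.{u}} {f : X ⟶ Spec k} {W W₁ : X.Modules}

/-- The filtration `W = W_0 ⊇ W_1 ⊇ W_2 ⊇ ⋯` of a sheaf of modules `W` with a connection,
starting from a given `ι : W_1 ⟶ W`: each `W_{i+1}`, for `i ≥ 1`, is the kernel of the second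
fundamental form of `W_i`. The `i`-th term is given together with its map to `W`. -/
def filtration (D : Connection f W) (ι : W₁ ⟶ W) : ℕ → Over W
  | 0 => Over.mk (𝟙 W)
  | 1 => Over.mk ι
  | n + 2 => Over.mk (kernel.ι (secondForm D (filtration D ι (n + 1)).hom) ≫
      (filtration D ι (n + 1)).hom)

/-- The inclusion `W_{n+1} ⟶ W_n`. -/
def filtrationStep (D : Connection f W) (ι : W₁ ⟶ W) :
    ∀ n : ℕ, (filtration D ι (n + 1)).left ⟶ (filtration D ι n).left
  | 0 => ι
  | n + 1 => kernel.ι (secondForm D (filtration D ι (n + 1)).hom)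

lemma filtrationStep_hom (D : Connection f W) (ι : W₁ ⟶ W) (n : ℕ) :
    filtrationStep D ι n ≫ (filtration D ι n).hom = (filtration D ι (n + 1)).hom := by
  cases n with
  | zero => exact Category.comp_id ι
  | succ n => rfl

/-- The graded piece `W_n / W_{n+1}`. -/
def graded (D : Connection f W) (ι : W₁ ⟶ W) (n : ℕ) : X.Modules :=
  cokernel (filtrationStep D ι n)

/-- The canonical map `W_n / W_{n+1} ⟶ W / W_{n+1}`. -/
def gradedIncl (D : Connection f W) (ι : W₁ ⟶ W) (n : ℕ) :
    graded D ι n ⟶ cokernel (filtration D ι (n + 1)).hom :=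
  cokernel.map (filtrationStep D ι n) (filtration D ι (n + 1)).hom (𝟙 _) (filtration D ι n).hom
    (by rw [filtrationStep_hom, Category.id_comp])

/-- A morphism `t : W_{n+1} / W_{n+2} ⟶ (W_n / W_{n+1}) ⊗ Ω` is induced by the second fundamental
form of `W_{n+1}` if the composition
`W_{n+1} ⟶ W_{n+1} / W_{n+2} ⟶ (W_n / W_{n+1}) ⊗ Ω ⟶ (W / W_{n+1}) ⊗ Ω` is that form. -/
def IsInduced (D : Connection f W) (ι : W₁ ⟶ W) (n : ℕ)
    (t : graded D ι (n + 1) ⟶ tens (graded D ι n) (Omega f)) : Prop :=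
  cokernel.π (filtrationStep D ι (n + 1)) ≫ t ≫ tensHom (gradedIncl D ι n) (𝟙 (Omega f)) =
    secondForm D (filtration D ι (n + 1)).hom

open Classical in
/-- The homomorphism `W_{n+1} / W_{n+2} ⟶ (W_n / W_{n+1}) ⊗ Ω` induced by the second fundamental
form of `W_{n+1}` (it exists and is unique when `Ω` is locally free; the value is `0` if there is
no such homomorphism). -/
def gradedForm (D : Connection f W) (ι : W₁ ⟶ W) (n : ℕ) :
    graded D ι (n + 1) ⟶ tens (graded D ι n) (Omega f) :=
  if h : ∃ t, IsInduced D ι n t then h.choose else 0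

/-- The tensor power `Ω^{⊗(n+1)}`. -/
def omegaPow (f : X ⟶ Spec k) : ℕ → X.Modules
  | 0 => Omega f
  | n + 1 => tens (omegaPow f n) (Omega f)

/-- The iterated homomorphism `W_{n+1} / W_{n+2} ⟶ (W / W_1) ⊗ Ω^{⊗(n+1)}`. -/
def iteratedForm (D : Connection f W) (ι : W₁ ⟶ W) :
    ∀ n : ℕ, graded D ι (n + 1) ⟶ tens (graded D ι 0) (omegaPow f n)
  | 0 => gradedForm D ι 0
  | n + 1 => gradedForm D ι (n + 1) ≫ tensHom (iteratedForm D ι n) (𝟙 (Omega f)) ≫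
      tensAssoc (graded D ι 0) (omegaPow f n) (Omega f)

end Filtration

/-! ### The canonical filtration of `F^* F_* E` -/

section Canonical

variable {k : Type u} [Field k] (p : ℕ) [Fact p.Prime] [CharP k p] (f : X ⟶ Spec (.of k))
  (E : X.Modules)

/-- The sheaf `F_* E`. -/
abbrev frobPush : X.Modules := (Scheme.Modules.pushforward (absFrobenius p f)).obj E

/-- The natural homomorphism `F^* F_* E ⟶ E`. -/
def frobCounit : frobPull p f (frobPush p f E) ⟶ E :=
  (Scheme.Modules.pullbackPushforwardAdjunction (absFrobenius p f)).counit.app E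

/-- The canonical filtration `E_0 ⊇ E_1 ⊇ E_2 ⊇ ⋯` of `E_0 = F^* F_* E`: `E_1` is the kernel of
`F^* F_* E ⟶ E`, and the other terms come from the Cartier connection. -/
def canFil (i : ℕ) : Over (frobPull p f (frobPush p f E)) :=
  filtration (cartier p f (frobPush p f E)) (kernel.ι (frobCounit p f E)) i

/-- The graded piece `E_i / E_{i+1}`. -/
def canGr (i : ℕ) : X.Modules :=
  graded (cartier p f (frobPush p f E)) (kernel.ι (frobCounit p f E)) i

/-- The homomorphism `E_0 / E_1 ⟶ E` induced by `F^* F_* E ⟶ E`. -/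
def canGrZero : canGr p f E 0 ⟶ E :=
  cokernel.desc _ (frobCounit p f E) (kernel.condition (frobCounit p f E))

/-- The homomorphism `S_{n+1} : E_{n+1} / E_{n+2} ⟶ E ⊗ Ω^{⊗(n+1)}`. -/
def canForm (n : ℕ) : canGr p f E (n + 1) ⟶ tens E (omegaPow f n) :=
  iteratedForm (cartier p f (frobPush p f E)) (kernel.ι (frobCounit p f E)) n ≫
    tensHom (canGrZero p f E) (𝟙 (omegaPow f n))

/-- The inclusion of `G_{n+1}` into `Ω^{⊗(n+1)}`, where `G_{n+1}` is the image of the homomorphism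
`S_{n+1}` for `E = 𝒪_X`. -/
def gSubIncl (n : ℕ) :
    image (canForm p f (structureModule X) n ≫ tensUnit (omegaPow f n)) ⟶ omegaPow f n :=
  image.ι _

end Canonical

/-! ### Vector bundles and projective varieties -/

/-- A vector bundle: a sheaf of modules that is locally isomorphic to a free module of finite
rank. -/
def IsVectorBundle (M : X.Modules) : Prop :=
  ∀ x : X, ∃ (U : X.Opens) (n : ℕ), x ∈ U ∧
    Nonempty (M.restrict U.ι ≅
      (SheafOfModules.free (R := U.toScheme.ringCatSheaf) (ULift.{u} (Fin n))))

/-- A morphism exhibits `M` as a vector subbundle of `N`: it is injective, and both `M` and the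
quotient `N / M` are vector bundles. -/
structure IsSubbundle (φ : M ⟶ N) : Prop where
  isVectorBundle : IsVectorBundle M
  mono : Mono φ
  isVectorBundle_cokernel : IsVectorBundle (cokernel φ)

attribute [local instance] MvPolynomial.gradedAlgebra

/-- `f : X ⟶ Spec k` is projective: `X` is isomorphic over `k` to a closed subscheme of some
projective space `Proj k[x_0, …, x_n]`. -/
def IsProjective {k : Type u} [Field k] (f : X ⟶ Spec (.of k)) : Prop :=
  ∃ (n : ℕ) (i : X ⟶ Proj (MvPolynomial.homogeneousSubmodule (Fin (n + 1)) k)),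
    IsClosedImmersion i ∧
      i ≫ Proj.toSpecZero (MvPolynomial.homogeneousSubmodule (Fin (n + 1)) k) ≫
        Spec.map (CommRingCat.ofHom
          (algebraMap k (MvPolynomial.homogeneousSubmodule (Fin (n + 1)) k 0))) = f

end Sheaves

end

end FrobFil

/-! Everything is local, so the proof computes in frames. Near a point choose étale coordinates t_1,
…, t_n (functions whose differentials form a frame of Ω) and a frame e_l of E. Two facts of
commutative algebra in characteristic p carry the computation. The monomials t^β with 0 ≤ β_j < p
form a p-basis: locally every function is uniquely ∑ c_β^p t^β (`existsUnique_sum_pow_mul`). And the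
t_j are algebraically independent over k, so n ≤ dim X (`le_ringKrullDim`).

By the first fact F_*E has the frame t^β e_l, hence F^*F_*E has the frame F^*(t^β e_l). Pass to
w_{α,l} = ∏_j (1⊗t_j − t_j⊗1)^{α_j} e_l; the matrix of binomial coefficients that does this is
inverted by replacing t with −t (`isFrame_shiftSec`). Since pulled back sections are horizontal,
∇w_{α,l} = −∑_j α_j w_{α−ε_j,l} ⊗ dt_j (`nabla_shiftSec`), and the natural map to E sends w_{0,l} to
e_l and every other w_{α,l} to 0 (`frobCounit_shiftSec`). A nonzero α_j is less than p, hence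
invertible.

It follows by induction that E_i is free on the w_{α,l} with |α| ≥ i (`IsAdapted.lift_and_coeff`):
the second fundamental form lowers the degree by one, and two different exponents lowered in the
same direction stay different, so no cancellation can hide a component of degree i. This makes E_i a
subbundle, and E_i = 0 for i > (p−1)d because |α| ≤ (p−1)n ≤ (p−1)d.

On graded pieces the same formula describes the induced forms, and iterating it gives S_i(w_{α,l}) =
e_l ⊗ σ_α, where σ_α is a weighted sum over sequences of i directions leading from α to 0 and does
not involve E (`canForm_shiftClass`). A sequence has nonzero weight for at most one α of degree i,
and every such α has a sequence whose weight is a unit (`exists_path`). So the matrix of S_i has an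
invertible diagonal block, and S_i is a subbundle. For E = 𝒪_X the σ_α span G_i; for general E the
image is spanned by the e_l ⊗ σ_α, which is E ⊗ G_i.

The induction on the filtration needs only a degree, lowering maps and coefficients; these are
isolated in `IsAdapted`. -/

namespace FrobFil

noncomputable section

/-! ### Restriction of sections, and local criteria -/

section Res

variable {X : Scheme.{u}} {M N : X.Modules} {U V W : X.Opens}

/-- Restriction of sections of a sheaf of modules to a smaller open set. -/
def res (h : V ≤ U) : Γ(M, U) →+ Γ(M, V) := (M.presheaf.map (homOfLE h).op).hom

/-- Restriction of functions to a smaller open set. -/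
def rres (h : V ≤ U) : Γ(X, U) →+* Γ(X, V) := (X.presheaf.map (homOfLE h).op).hom

lemma res_res (h : V ≤ U) (h' : W ≤ V) (s : Γ(M, U)) : res h' (res h s) = res (h'.trans h) s :=
  (congr($(M.presheaf.map_comp (homOfLE h).op (homOfLE h').op) s)).symm

lemma res_self (s : Γ(M, U)) : res (le_refl U) s = s :=
  congr($(M.presheaf.map_id (op U)) s)

lemma rres_rres (h : V ≤ U) (h' : W ≤ V) (s : Γ(X, U)) :
    rres h' (rres h s) = rres (h'.trans h) s :=
  (congr($(X.presheaf.map_comp (homOfLE h).op (homOfLE h').op) s)).symm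

lemma rres_self (s : Γ(X, U)) : rres (le_refl U) s = s :=
  congr($(X.presheaf.map_id (op U)) s)

lemma res_smul (h : V ≤ U) (r : Γ(X, U)) (s : Γ(M, U)) : res h (r • s) = rres h r • res h s :=
  M.map_smul (homOfLE h) r s

lemma app_res (φ : M ⟶ N) (h : V ≤ U) (s : Γ(M, U)) :
    φ.app V (res h s) = res h (φ.app U s) :=
  congr($(φ.mapPresheaf.naturality (homOfLE h).op) s)

lemma app_sum {A : Type*} (φ : M ⟶ N) (S : Finset A) (g : A → Γ(M, U)) :
    φ.app U (∑ a ∈ S, g a) = ∑ a ∈ S, φ.app U (g a) :=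
  map_sum (φ.app U).hom g S

lemma app_comp {L : X.Modules} (φ : M ⟶ N) (ψ : N ⟶ L) (s : Γ(M, U)) :
    (φ ≫ ψ).app U s = ψ.app U (φ.app U s) := rfl

lemma app_eq_zero_of_comp {L : X.Modules} {φ : M ⟶ N} {ψ : N ⟶ L} (h : φ ≫ ψ = 0)
    (s : Γ(M, U)) : ψ.app U (φ.app U s) = 0 := congr(($h).app U s)

/-- Sections that agree locally are equal. -/
lemma eq_of_locally {s t : Γ(M, U)} (h : ∀ x ∈ U, ∃ (V : X.Opens) (hV : V ≤ U), x ∈ V ∧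
    res hV s = res hV t) : s = t := by
  choose V hV hx heq using h
  refine TopCat.Sheaf.eq_of_locally_eq' ⟨M.presheaf, M.isSheaf⟩ (fun x : U ↦ V x x.2) U
    (fun x ↦ homOfLE (hV x x.2)) (fun x hxU ↦ ?_) s t (fun x ↦ heq x x.2)
  exact Opens.mem_iSup.mpr ⟨⟨x, hxU⟩, hx x hxU⟩

lemma req_of_locally {s t : Γ(X, U)} (h : ∀ x ∈ U, ∃ (V : X.Opens) (hV : V ≤ U), x ∈ V ∧
    rres hV s = rres hV t) : s = t := by
  choose V hV hx heq using h
  refine TopCat.Sheaf.eq_of_locally_eq' X.sheaf (fun x : U ↦ V x x.2) U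
    (fun x ↦ homOfLE (hV x x.2)) (fun x hxU ↦ ?_) s t (fun x ↦ heq x x.2)
  exact Opens.mem_iSup.mpr ⟨⟨x, hxU⟩, hx x hxU⟩

/-- Locally defined sections that agree on the overlaps can be glued. -/
lemma exists_rglue (V : U → X.Opens) (hV : ∀ x, V x ≤ U) (hx : ∀ x, x.1 ∈ V x)
    (c : ∀ x, Γ(X, V x))
    (hc : ∀ x y, rres (inf_le_left : V x ⊓ V y ≤ V x) (c x) = rres (inf_le_right : V x ⊓ V y ≤ V y) (c y)) :
    ∃ s : Γ(X, U), ∀ x, rres (hV x) s = c x := by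
  obtain ⟨s, hs, -⟩ := TopCat.Sheaf.existsUnique_gluing' X.sheaf V U (fun x ↦ homOfLE (hV x))
    (fun x hxU ↦ Opens.mem_iSup.mpr ⟨⟨x, hxU⟩, hx _⟩) c (fun x y ↦ hc x y)
  exact ⟨s, hs⟩

lemma hom_eq_of_locally {φ ψ : M ⟶ N} (h : ∀ (U : X.Opens) (s : Γ(M, U)), ∀ x ∈ U,
    ∃ (V : X.Opens) (hV : V ≤ U), x ∈ V ∧ φ.app V (res hV s) = ψ.app V (res hV s)) : φ = ψ := by
  ext U s
  refine eq_of_locally fun x hx ↦ ?_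
  obtain ⟨V, hV, hxV, e⟩ := h U s x hx
  exact ⟨V, hV, hxV, by rw [← app_res, ← app_res, e]⟩

/-! ### Monomorphisms, kernels and epimorphisms on sections -/

lemma app_injective (φ : M ⟶ N) [Mono φ] (U : X.Opens) : Function.Injective (φ.app U) := by
  have : Mono ((Scheme.Modules.toPresheaf X).map φ) := inferInstance
  have : Mono (φ.mapPresheaf.app (op U)) := (NatTrans.mono_iff_mono_app _).mp this (op U)
  exact (AddCommGrpCat.mono_iff_injective _).mp this

lemma mono_of_injective {φ : M ⟶ N} (h : ∀ (U : X.Opens) (s : Γ(M, U)), φ.app U s = 0 → s = 0) :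
    Mono φ := by
  refine Preadditive.mono_of_cancel_zero _ fun {P} g hg ↦ ?_
  ext U s
  exact h U _ congr(($hg).app U s)

/-- A section killed by a morphism comes from any kernel. -/
lemma exists_of_isKernel {L : X.Modules} {ι : L ⟶ M} {φ : M ⟶ N} (w : ι ≫ φ = 0)
    (hk : IsLimit (KernelFork.ofι ι w)) (s : Γ(M, U)) (hs : φ.app U s = 0) :
    ∃ t, ι.app U t = s := by
  -- Evaluation on `U` preserves finite limits, so kernels of sheaves are computed on sections.
  let F : X.Modules ⥤ ModuleCat _ := SheafOfModules.evaluation X.ringCatSheaf (op U)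
  have : F.PreservesZeroMorphisms := ⟨fun _ _ ↦ rfl⟩
  have : PreservesFiniteLimits F :=
    inferInstanceAs (PreservesFiniteLimits (SheafOfModules.evaluation X.ringCatSheaf (op U)))
  have hk' := KernelFork.mapIsLimit (KernelFork.ofι ι w) hk F
  have hex : (ShortComplex.mk (F.map ι) (F.map φ) (by rw [← F.map_comp, w, F.map_zero])).Exact :=
    ShortComplex.exact_of_f_is_kernel _ hk'
  rw [ShortComplex.moduleCat_exact_iff] at hex
  exact hex s hs

lemma exists_of_kernel (φ : M ⟶ N) (s : Γ(M, U)) (hs : φ.app U s = 0) :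
    ∃ t, (kernel.ι φ).app U t = s :=
  exists_of_isKernel (kernel.condition φ) (kernelIsKernel φ) s hs

/-- For a monomorphism, a section that vanishes in the cokernel comes from the subobject. -/
lemma exists_of_cokernel (φ : M ⟶ N) [Mono φ] (s : Γ(N, U)) (hs : (cokernel.π φ).app U s = 0) :
    ∃ t, φ.app U t = s :=
  exists_of_isKernel (cokernel.condition φ) (Abelian.monoIsKernelOfCokernel _ (colimit.isColimit _)) s hs

lemma toShf_res {P : X.PresheafOfModules} (h : V ≤ U) (s : P.obj (op U)) :
    res (M := (shf X).obj P) h ((toShf P).app (op U) s) =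
      (toShf P).app (op V) (P.map (homOfLE h).op s) :=
  (PresheafOfModules.naturality_apply (toShf P) (homOfLE h).op s).symm

lemma exists_toShf_eq (P : X.PresheafOfModules) (s : Γ((shf X).obj P, U)) (x : X) (hx : x ∈ U) :
    ∃ (V : X.Opens) (h : V ≤ U), x ∈ V ∧ ∃ t : P.obj (op V), (toShf P).app (op V) t = res h s := by
  have h1 : Presheaf.IsLocallySurjective (Opens.grothendieckTopology X)
      ((PresheafOfModules.toPresheaf (X.presheaf ⋙ forget₂ CommRingCat RingCat)).map (toShf P)) :=
    inferInstanceAs (Presheaf.IsLocallySurjective (Opens.grothendieckTopology X)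
      (CategoryTheory.toSheafify _ P.presheaf))
  obtain ⟨V, i, ⟨t, ht⟩, hxV⟩ := h1.imageSieve_mem (U := U) s x hx
  exact ⟨V, leOfHom i, hxV, t, ht⟩

lemma exists_map_eq_zero (P : X.PresheafOfModules) (s : P.obj (op U)) (hs : (toShf P).app (op U) s = 0)
    (x : X) (hx : x ∈ U) : ∃ (V : X.Opens) (h : V ≤ U), x ∈ V ∧ P.map (homOfLE h).op s = 0 := by
  have h2 : Presheaf.IsLocallyInjective (Opens.grothendieckTopology X)
      ((PresheafOfModules.toPresheaf (X.presheaf ⋙ forget₂ CommRingCat RingCat)).map (toShf P)) :=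
    inferInstanceAs (Presheaf.IsLocallyInjective (Opens.grothendieckTopology X)
      (CategoryTheory.toSheafify _ P.presheaf))
  obtain ⟨V, i, hi, hxV⟩ := h2.equalizerSieve_mem (X := op U) s (0 : P.obj (op U))
    (hs.trans (map_zero ((toShf P).app (op U)).hom).symm) x hx
  exact ⟨V, leOfHom i, hxV, hi.trans (map_zero (P.map i.op).hom)⟩

end Res

/-! ### Local membership in a subpresheaf -/

section Quotient

variable {X : Scheme.{u}} {M N : X.Modules} {U V W : X.Opens}

/-- If every morphism from `N` that vanishes on a subpresheaf `S` vanishes, then the sections of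
`N` belong locally to `S`. -/
lemma locally_mem_of_hom_eq_zero (S : (toP N).Submodule)
    (hS : ∀ (Q : X.Modules) (q : N ⟶ Q),
      (∀ (U : X.Opens) (s : (toP N).obj (op U)), s ∈ S.obj (op U) → q.val.app (op U) s = 0) → q = 0)
    (s : Γ(N, U)) (x : X) (hx : x ∈ U) :
    ∃ (V : X.Opens) (h : V ≤ U), x ∈ V ∧ res h s ∈ S.obj (op V) := by
  -- The map from `N` to the sheafified presheaf quotient `N / S` kills `S`, hence vanishes. A
  -- section therefore dies in the sheafification of `N / S`, so locally it already dies in `N / S`.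
  let C := cokernel S.ι
  let π : toP N ⟶ C := cokernel.π S.ι
  let q : N ⟶ (shf X).obj C := ⟨π ≫ toShf C⟩
  have hq : q = 0 := by
    refine hS _ _ fun U s hs ↦ ?_
    have h1 : π.app (op U) s = 0 :=
      congr(($(cokernel.condition S.ι)).app (op U) (⟨s, hs⟩ : S.obj (op U)))
    exact (congrArg ((toShf C).app (op U)) h1).trans (map_zero ((toShf C).app (op U)).hom)
  have h0 : (toShf C).app (op U) (π.app (op U) s) = 0 := congr(($hq).app U s)
  obtain ⟨V, h, hxV, hz⟩ := exists_map_eq_zero C _ h0 x hx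
  refine ⟨V, h, hxV, ?_⟩
  have h1 : π.app (op V) (res h s) = 0 :=
    (PresheafOfModules.naturality_apply π (homOfLE h).op s).trans hz
  let F := PresheafOfModules.evaluation X.ringCatSheaf.obj (op V)
  have hex : (ShortComplex.mk S.ι π (cokernel.condition _)).Exact :=
    ShortComplex.exact_cokernel S.ι
  have hex' := hex.map F
  rw [ShortComplex.moduleCat_exact_iff] at hex'
  obtain ⟨t, ht⟩ := hex' (res h s) h1
  rw [← ht]
  exact t.2

/-- Epimorphisms are locally surjective. -/
lemma exists_app_eq_of_epi (φ : M ⟶ N) [Epi φ] (s : Γ(N, U)) (x : X) (hx : x ∈ U) :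
    ∃ (V : X.Opens) (h : V ≤ U), x ∈ V ∧ ∃ t : Γ(M, V), φ.app V t = res h s := by
  let S : (toP N).Submodule :=
    { obj U := LinearMap.range (φ.val.app U).hom
      map {U V} i := by
        rintro _ ⟨s, rfl⟩
        exact ⟨M.val.map i s, PresheafOfModules.naturality_apply φ.val i s⟩ }
  exact locally_mem_of_hom_eq_zero S (fun Q q hq ↦ by
    refine (cancel_epi φ).mp ?_
    rw [comp_zero]
    ext U s
    exact hq U _ ⟨s, rfl⟩) s x hx

/-- A morphism whose values come locally from a subobject factors through it. -/
lemma exists_factor {M' : X.Modules} (φ : M ⟶ N) (ψ : M' ⟶ N) [Mono ψ]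
    (h : ∀ (U : X.Opens) (s : Γ(M, U)), ∀ x ∈ U, ∃ (V : X.Opens) (hV : V ≤ U), x ∈ V ∧
      ∃ t : Γ(M', V), ψ.app V t = φ.app V (res hV s)) : ∃ χ : M ⟶ M', χ ≫ ψ = φ := by
  have : φ ≫ cokernel.π ψ = 0 := by
    refine hom_eq_of_locally fun U s x hx ↦ ?_
    obtain ⟨V, hV, hxV, t, ht⟩ := h U s x hx
    refine ⟨V, hV, hxV, ?_⟩
    rw [app_comp, ← ht]
    exact app_eq_zero_of_comp (cokernel.condition ψ) t
  let l := Abelian.monoLift ψ φ this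
  exact ⟨l, Abelian.monoLift_comp ψ φ this⟩

end Quotient

/-! ### Local frames -/

section Frames

variable {X : Scheme.{u}} {M N : X.Modules} {U V W : X.Opens} {A B : Type*}

/-- The sections `b a`, for `a ∈ S`, are linearly independent over every open subset of `U`. -/
def IsIndep (M : X.Modules) (U : X.Opens) (S : Finset A) (b : A → Γ(M, U)) : Prop :=
  ∀ (V : X.Opens) (h : V ≤ U) (c : A → Γ(X, V)), ∑ a ∈ S, c a • res h (b a) = 0 → ∀ a ∈ S, c a = 0

/-- The sections `b a`, for `a ∈ S`, are a basis of `M` over every open subset of `U`. -/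
structure IsFrame (M : X.Modules) (U : X.Opens) (S : Finset A) (b : A → Γ(M, U)) : Prop where
  gen (V : X.Opens) (h : V ≤ U) (s : Γ(M, V)) : ∃ c : A → Γ(X, V), s = ∑ a ∈ S, c a • res h (b a)
  ind : IsIndep M U S b

lemma IsIndep.coeff_eq {S : Finset A} {b : A → Γ(M, U)} (hb : IsIndep M U S b) (h : V ≤ U)
    {c c' : A → Γ(X, V)} (e : ∑ a ∈ S, c a • res h (b a) = ∑ a ∈ S, c' a • res h (b a)) :
    ∀ a ∈ S, c a = c' a := by
  intro a ha
  refine sub_eq_zero.mp (hb V h (fun a ↦ c a - c' a) ?_ a ha)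
  simp only [sub_smul, Finset.sum_sub_distrib, e, sub_self]

lemma res_sum {S : Finset A} (h : V ≤ U) (c : A → Γ(X, U)) (b : A → Γ(M, U)) :
    res h (∑ a ∈ S, c a • b a) = ∑ a ∈ S, rres h (c a) • res h (b a) := by
  rw [map_sum]
  exact Finset.sum_congr rfl fun a _ ↦ res_smul h _ _

lemma IsIndep.congr {S : Finset A} {n n' : A → Γ(M, U)} (hn : IsIndep M U S n)
    (h : ∀ a ∈ S, n' a = n a) : IsIndep M U S n' := fun V hV c hc ↦
  hn V hV c (by rw [← hc]; exact Finset.sum_congr rfl fun a ha ↦ by rw [h a ha])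

lemma isIndep_of_local {S : Finset A} {b : A → Γ(M, U)}
    (hind : ∀ (V : X.Opens) (h : V ≤ U) (c : A → Γ(X, V)), ∑ a ∈ S, c a • res h (b a) = 0 →
      ∀ x ∈ V, ∃ (W : X.Opens) (hW : W ≤ V), x ∈ W ∧ ∀ a ∈ S, rres hW (c a) = 0) :
    IsIndep M U S b := by
  intro V h c hc a ha
  refine req_of_locally fun x hx ↦ ?_
  obtain ⟨W, hW, hxW, h0⟩ := hind V h c hc x hx
  exact ⟨W, hW, hxW, by rw [h0 a ha, map_zero]⟩

/-- Being a frame can be checked locally. -/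
lemma isFrame_of_local {S : Finset A} {b : A → Γ(M, U)}
    (hgen : ∀ (V : X.Opens) (h : V ≤ U) (s : Γ(M, V)), ∀ x ∈ V, ∃ (W : X.Opens) (hW : W ≤ V), x ∈ W ∧
      ∃ c : A → Γ(X, W), res hW s = ∑ a ∈ S, c a • res (hW.trans h) (b a))
    (hind : ∀ (V : X.Opens) (h : V ≤ U) (c : A → Γ(X, V)), ∑ a ∈ S, c a • res h (b a) = 0 →
      ∀ x ∈ V, ∃ (W : X.Opens) (hW : W ≤ V), x ∈ W ∧ ∀ a ∈ S, rres hW (c a) = 0) :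
    IsFrame M U S b := by
  classical
  have hI := isIndep_of_local hind
  refine ⟨fun V h s ↦ ?_, hI⟩
  choose W hW hxW c hc using fun x : V ↦ hgen V h s x x.2
  -- Independence makes the local coefficients unique, so they agree on overlaps and glue.
  have hglue : ∀ a ∈ S, ∃ r : Γ(X, V), ∀ x, rres (hW x) r = c x a := by
    intro a ha
    refine exists_rglue W hW hxW (fun x ↦ c x a) fun x y ↦ ?_
    refine hI.coeff_eq (V := W x ⊓ W y) (inf_le_left.trans ((hW x).trans h))
      (c := fun a ↦ rres inf_le_left (c x a)) (c' := fun a ↦ rres inf_le_right (c y a)) ?_ a ha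
    have h1 := congrArg (res (inf_le_left : W x ⊓ W y ≤ W x)) (hc x)
    have h2 := congrArg (res (inf_le_right : W x ⊓ W y ≤ W y)) (hc y)
    simp only [res_sum, res_res] at h1 h2
    exact h1.symm.trans h2
  choose r hr using hglue
  refine ⟨fun a ↦ if ha : a ∈ S then r a ha else 0, eq_of_locally fun x hx ↦ ?_⟩
  refine ⟨W ⟨x, hx⟩, hW _, hxW _, ?_⟩
  rw [hc ⟨x, hx⟩, res_sum]
  refine Finset.sum_congr rfl fun a ha ↦ ?_
  rw [dif_pos ha, hr, res_res]

lemma IsIndep.restrict {S : Finset A} {b : A → Γ(M, U)} (hb : IsIndep M U S b) (h : V ≤ U) :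
    IsIndep M V S fun a ↦ res h (b a) := fun W hW c hc a ha ↦
  hb W (hW.trans h) c (by simpa only [res_res] using hc) a ha

lemma IsFrame.restrict {S : Finset A} {b : A → Γ(M, U)} (hb : IsFrame M U S b) (h : V ≤ U) :
    IsFrame M V S fun a ↦ res h (b a) where
  gen W hW s := by simpa only [res_res] using hb.gen W (hW.trans h) s
  ind := hb.ind.restrict h

/-- Frames can be reindexed. -/
lemma IsFrame.reindex {S : Finset A} {b : A → Γ(M, U)} (hb : IsFrame M U S b) {T : Finset B}
    (e : B → A) (he : Set.BijOn e T S) {b' : B → Γ(M, U)} (hb' : ∀ t ∈ T, b' t = b (e t)) :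
    IsFrame M U T b' := by
  classical
  have hsum : ∀ (V : X.Opens) (h : V ≤ U) (c : A → Γ(X, V)), ∑ t ∈ T, c (e t) • res h (b' t) =
      ∑ a ∈ S, c a • res h (b a) := fun V h c ↦
    Finset.sum_nbij e (fun t ht ↦ he.mapsTo ht) he.injOn he.surjOn
      (fun t ht ↦ by rw [hb' t ht])
  refine ⟨fun V h s ↦ ?_, fun V h c hc t ht ↦ ?_⟩
  · obtain ⟨c, hc⟩ := hb.gen V h s
    exact ⟨fun t ↦ c (e t), hc.trans (hsum V h c).symm⟩
  · have : Nonempty B := ⟨t⟩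
    choose! g hg hg' using fun a (ha : a ∈ S) ↦ he.surjOn ha
    have hge : ∀ t ∈ T, g (e t) = t := fun t ht ↦
      he.injOn (hg _ (he.mapsTo ht)) ht (hg' _ (he.mapsTo ht))
    have h1 := hb.ind V h (fun a ↦ c (g a)) (by
      rw [← hsum, ← hc]
      exact Finset.sum_congr rfl fun t ht ↦ by rw [hge t ht]) (e t) (he.mapsTo ht)
    rwa [hge t ht] at h1

lemma IsFrame.congr {S : Finset A} {b b' : A → Γ(M, U)} (hb : IsFrame M U S b)
    (h : ∀ a ∈ S, b' a = b a) : IsFrame M U S b' :=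
  hb.reindex id (Set.bijOn_id _) h

/-- Change of frame by an invertible matrix. -/
lemma IsFrame.change [DecidableEq A] [DecidableEq B] {S : Finset A} {T : Finset B}
    {b : A → Γ(M, U)} (hb : IsFrame M U S b) (b' : B → Γ(M, U)) (P : B → A → Γ(X, U))
    (Q : A → B → Γ(X, U)) (hP : ∀ t ∈ T, b' t = ∑ a ∈ S, P t a • b a)
    (hPQ : ∀ t ∈ T, ∀ t' ∈ T, ∑ a ∈ S, P t a * Q a t' = if t = t' then 1 else 0)
    (hQP : ∀ a ∈ S, ∀ a' ∈ S, ∑ t ∈ T, Q a t * P t a' = if a = a' then 1 else 0) :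
    IsFrame M U T b' := by
  have key : ∀ (V : X.Opens) (h : V ≤ U) (c : B → Γ(X, V)), ∑ t ∈ T, c t • res h (b' t) =
      ∑ a ∈ S, (∑ t ∈ T, c t * rres h (P t a)) • res h (b a) := by
    intro V h c
    simp only [Finset.sum_smul]
    rw [Finset.sum_comm]
    refine Finset.sum_congr rfl fun t ht ↦ ?_
    rw [hP t ht, res_sum, Finset.smul_sum]
    simp only [smul_smul]
  refine ⟨fun V h s ↦ ?_, fun V h c hc t' ht' ↦ ?_⟩
  · obtain ⟨c, rfl⟩ := hb.gen V h s
    refine ⟨fun t ↦ ∑ a ∈ S, c a * rres h (Q a t), ?_⟩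
    rw [key]
    refine Finset.sum_congr rfl fun a ha ↦ ?_
    congr 1
    simp only [Finset.sum_mul, mul_assoc]
    rw [Finset.sum_comm]
    simp only [← Finset.mul_sum, ← map_mul, ← map_sum]
    rw [Finset.sum_congr rfl (g := fun a' ↦ if a' = a then c a' else 0)]
    · rw [Finset.sum_ite_eq' S a c, if_pos ha]
    · intro a' ha'
      rw [hQP a' ha' a ha]
      split_ifs <;> simp
  · rw [key] at hc
    have h1 := hb.ind V h _ hc
    have h2 : ∑ a ∈ S, (∑ t ∈ T, c t * rres h (P t a)) * rres h (Q a t') = 0 :=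
      Finset.sum_eq_zero fun a ha ↦ by rw [h1 a ha, zero_mul]
    simp only [Finset.sum_mul, mul_assoc] at h2
    rw [Finset.sum_comm] at h2
    simp only [← Finset.mul_sum, ← map_mul, ← map_sum] at h2
    rw [Finset.sum_congr rfl (g := fun t ↦ if t = t' then c t else 0)] at h2
    · rwa [Finset.sum_ite_eq' T t' c, if_pos ht'] at h2
    · intro t ht
      rw [hPQ t ht t' ht']
      split_ifs <;> simp

lemma app_sum_smul (φ : M ⟶ N) (S : Finset A) (h : V ≤ U) (c : A → Γ(X, V)) (b : A → Γ(M, U)) :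
    φ.app V (∑ a ∈ S, c a • res h (b a)) = ∑ a ∈ S, c a • res h (φ.app U (b a)) := by
  rw [app_sum]
  exact Finset.sum_congr rfl fun a _ ↦ by rw [Scheme.Modules.Hom.app_smul, app_res]

/-- Frames over small open sets detect whether a local property of sections holds. -/
lemma exists_le_of_nhds {p : X.Opens → Prop} (hp : ∀ x : X, ∃ U : X.Opens, x ∈ U ∧ p U)
    (U : X.Opens) (x : X) (hx : x ∈ U) : ∃ U' : X.Opens, p U' ∧ ∃ V : X.Opens, V ≤ U ∧ V ≤ U' ∧ x ∈ V := by
  obtain ⟨U', hxU', h⟩ := hp x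
  exact ⟨U', h, U ⊓ U', inf_le_left, inf_le_right, hx, hxU'⟩

/-- An isomorphism carries frames to frames. -/
lemma IsFrame.map_iso {S : Finset A} {b : A → Γ(M, U)} (hb : IsFrame M U S b) (φ : M ⟶ N)
    [IsIso φ] : IsFrame N U S fun a ↦ φ.app U (b a) := by
  have e1 : ∀ (V : X.Opens) (s : Γ(N, V)), φ.app V ((inv φ).app V s) = s := fun V s ↦
    congr(($(IsIso.inv_hom_id φ)).app V s)
  have e2 : ∀ (V : X.Opens) (s : Γ(M, V)), (inv φ).app V (φ.app V s) = s := fun V s ↦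
    congr(($(IsIso.hom_inv_id φ)).app V s)
  refine ⟨fun V h s ↦ ?_, fun V h c hc ↦ hb.ind V h c ?_⟩
  · obtain ⟨c, hc⟩ := hb.gen V h ((inv φ).app V s)
    exact ⟨c, by rw [← app_sum_smul, ← hc, e1]⟩
  · rw [← app_sum_smul] at hc
    rw [← e2 V (∑ a ∈ S, _), hc, map_zero]

lemma IsFrame.app_eq_zero {S : Finset A} {b : A → Γ(M, U)} (hb : IsFrame M U S b) {φ : M ⟶ N}
    (hφ : IsIndep N U S fun a ↦ φ.app U (b a)) (h : V ≤ U) (s : Γ(M, V)) (hs : φ.app V s = 0) :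
    s = 0 := by
  obtain ⟨c, rfl⟩ := hb.gen V h s
  rw [app_sum_smul] at hs
  exact Finset.sum_eq_zero fun a ha ↦ by rw [hφ V h c hs a ha, zero_smul]

lemma mono_of_local {φ : M ⟶ N} (h : ∀ x : X, ∃ U : X.Opens, x ∈ U ∧
    ∀ V ≤ U, ∀ s : Γ(M, V), φ.app V s = 0 → s = 0) : Mono φ := by
  refine mono_of_injective fun U s hs ↦ eq_of_locally fun x hx ↦ ?_
  obtain ⟨U', h', V, hV, hV', hxV⟩ := exists_le_of_nhds h U x hx
  exact ⟨V, hV, hxV, by rw [h' V hV' (res hV s) (by rw [app_res, hs, map_zero]), map_zero]⟩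

/-- The sections of a presheaf of modules form a module over the functions. -/
instance presheafModule (P : X.PresheafOfModules) (U : X.Opens) : Module Γ(X, U) (P.obj (op U)) :=
  (P.obj (op U)).isModule

/-- Restriction of sections of a presheaf of modules. -/
def pres {P : X.PresheafOfModules} (h : V ≤ U) : P.obj (op U) →+ P.obj (op V) :=
  (P.map (homOfLE h).op).hom.toAddMonoidHom

lemma pres_smul {P : X.PresheafOfModules} (h : V ≤ U) (r : Γ(X, U)) (s : P.obj (op U)) :
    pres h (r • s) = rres h r • pres h s :=
  P.map_smul (homOfLE h).op r s

lemma pres_pres {P : X.PresheafOfModules} (h : V ≤ U) (h' : W ≤ V) (s : P.obj (op U)) :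
    pres h' (pres h s) = pres (h'.trans h) s :=
  (P.map_comp_apply (homOfLE h).op (homOfLE h').op s).symm

lemma toShf_app_smul {P : X.PresheafOfModules} (r : Γ(X, U)) (s : P.obj (op U)) :
    (toShf P).app (op U) (r • s) = (r • (toShf P).app (op U) s : Γ((shf X).obj P, U)) :=
  ((toShf P).app (op U)).hom.map_smul r s

/-- A frame of a presheaf on a basis of open sets gives a frame of the associated sheaf. -/
lemma isFrame_shf (P : X.PresheafOfModules) (S : Finset A) (b : A → P.obj (op U))
    (hP : ∀ V ≤ U, ∀ x ∈ V, ∃ (W : X.Opens) (_ : W ≤ V) (hWU : W ≤ U), x ∈ W ∧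
      (∀ s : P.obj (op W), ∃ c : A → Γ(X, W), s = ∑ a ∈ S, c a • pres hWU (b a)) ∧
      ∀ c : A → Γ(X, W), ∑ a ∈ S, c a • pres hWU (b a) = 0 → ∀ a ∈ S, c a = 0) :
    IsFrame ((shf X).obj P) U S fun a ↦ (toShf P).app (op U) (b a) := by
  have hlin : ∀ (W : X.Opens) (hWU : W ≤ U) (c : A → Γ(X, W)),
      (toShf P).app (op W) (∑ a ∈ S, c a • pres hWU (b a)) =
        ∑ a ∈ S, c a • res (M := (shf X).obj P) hWU ((toShf P).app (op U) (b a)) := by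
    intro W hWU c
    refine (map_sum ((toShf P).app (op W)).hom _ _).trans (Finset.sum_congr rfl fun a _ ↦ ?_)
    refine (toShf_app_smul (c a) _).trans ?_
    rw [toShf_res]
    rfl
  refine isFrame_of_local (fun V h s x hx ↦ ?_) fun V h c hc x hx ↦ ?_
  · obtain ⟨V', hV', hxV', t, ht⟩ := exists_toShf_eq P s x hx
    obtain ⟨W, hW, hWU, hxW, hgen, -⟩ := hP V' (hV'.trans h) x hxV'
    refine ⟨W, hW.trans hV', hxW, ?_⟩
    obtain ⟨c, hc⟩ := hgen (P.map (homOfLE hW).op t)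
    refine ⟨c, ?_⟩
    rw [← hlin, ← hc, ← res_res hV' hW, ← ht, toShf_res]
  · have h0 : (toShf P).app (op V) (∑ a ∈ S, c a • pres h (b a)) = 0 :=
      (hlin V h c).trans hc
    obtain ⟨V', hV', hxV', hz⟩ := exists_map_eq_zero P _ h0 x hx
    obtain ⟨W, hW, hWU, hxW, -, hind⟩ := hP V' (hV'.trans h) x hxV'
    refine ⟨W, hW.trans hV', hxW, hind _ ?_⟩
    have h1 : pres (hW.trans hV') (∑ a ∈ S, c a • pres h (b a)) = 0 := by
      rw [← pres_pres hV' hW]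
      exact (congrArg (pres hW) hz).trans (map_zero _)
    rw [map_sum] at h1
    simpa only [pres_smul, pres_pres] using h1

/-- Frames are families on a finset of an ambient type, with coefficients off the finset irrelevant.
Passing to a `Module.Basis` on the subtype gives access to the basis of a tensor product in
`tensor_coordinates`. -/
lemma exists_basis_of_coordinates {R P : Type*} [CommRing R] [AddCommGroup P] [Module R P]
    {S : Finset A} {b : A → P} (hg : ∀ s : P, ∃ c : A → R, s = ∑ a ∈ S, c a • b a)
    (hi : ∀ c : A → R, ∑ a ∈ S, c a • b a = 0 → ∀ a ∈ S, c a = 0) :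
    ∃ B : Module.Basis S R P, ∀ a, B a = b a := by
  classical
  refine ⟨Module.Basis.mk (v := fun a : S ↦ b a) ?_ ?_, fun a ↦ Module.Basis.mk_apply _ _ a⟩
  · rw [Fintype.linearIndependent_iff]
    intro g hg' a
    have := hi (fun a ↦ if h : a ∈ S then g ⟨a, h⟩ else 0) (by
      rw [← hg', ← Finset.sum_coe_sort S]
      exact Finset.sum_congr rfl fun a _ ↦ by rw [dif_pos a.2]) a a.2
    simpa using this
  · intro s _
    obtain ⟨c, rfl⟩ := hg s
    exact Submodule.sum_mem _ fun a ha ↦ Submodule.smul_mem _ _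
      (Submodule.subset_span ⟨⟨a, ha⟩, rfl⟩)

lemma tensor_coordinates {R P Q : Type*} [CommRing R] [AddCommGroup P] [AddCommGroup Q] [Module R P]
    [Module R Q] {S : Finset A} {T : Finset B} {b : A → P} {b' : B → Q}
    (hg : ∀ s : P, ∃ c : A → R, s = ∑ a ∈ S, c a • b a)
    (hi : ∀ c : A → R, ∑ a ∈ S, c a • b a = 0 → ∀ a ∈ S, c a = 0)
    (hg' : ∀ s : Q, ∃ c : B → R, s = ∑ a ∈ T, c a • b' a)
    (hi' : ∀ c : B → R, ∑ a ∈ T, c a • b' a = 0 → ∀ a ∈ T, c a = 0) :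
    (∀ s : TensorProduct R P Q, ∃ c : A × B → R,
      s = ∑ a ∈ S ×ˢ T, c a • TensorProduct.tmul R (b a.1) (b' a.2)) ∧
    ∀ c : A × B → R, ∑ a ∈ S ×ˢ T, c a • TensorProduct.tmul R (b a.1) (b' a.2) = 0 →
      ∀ a ∈ S ×ˢ T, c a = 0 := by
  classical
  obtain ⟨B₁, hB₁⟩ := exists_basis_of_coordinates hg hi
  obtain ⟨B₂, hB₂⟩ := exists_basis_of_coordinates hg' hi'
  have hsum : ∀ c : A × B → R, ∑ a ∈ S ×ˢ T, c a • TensorProduct.tmul R (b a.1) (b' a.2) =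
      ∑ x : S × T, c (x.1, x.2) • B₁.tensorProduct B₂ x := by
    intro c
    rw [Finset.sum_product, ← Finset.sum_coe_sort S, Fintype.sum_prod_type]
    refine Finset.sum_congr rfl fun a _ ↦ ?_
    rw [← Finset.sum_coe_sort T]
    refine Finset.sum_congr rfl fun a' _ ↦ ?_
    rw [Module.Basis.tensorProduct_apply, hB₁, hB₂]
  refine ⟨fun s ↦ ⟨fun x ↦ if h : x.1 ∈ S ∧ x.2 ∈ T then
    (B₁.tensorProduct B₂).repr s (⟨x.1, h.1⟩, ⟨x.2, h.2⟩) else 0, ?_⟩, fun c hc a ha ↦ ?_⟩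
  · rw [hsum, ← (B₁.tensorProduct B₂).sum_repr s]
    refine Finset.sum_congr rfl fun x _ ↦ ?_
    simp
  · rw [hsum] at hc
    rw [Finset.mem_product] at ha
    exact Fintype.linearIndependent_iff.mp (B₁.tensorProduct B₂).linearIndependent
      (fun x ↦ c (x.1, x.2)) hc (⟨a.1, ha.1⟩, ⟨a.2, ha.2⟩)

/-- The tensor product of two frames. -/
lemma IsFrame.tmul {S : Finset A} {b : A → Γ(M, U)} (hb : IsFrame M U S b) {T : Finset B}
    {b' : B → Γ(N, U)} (hb' : IsFrame N U T b') :
    IsFrame (tens M N) U (S ×ˢ T) fun a ↦ tmul (b a.1) (b' a.2) := by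
  refine isFrame_shf (preTens (toP M) (toP N)) (S ×ˢ T)
    (fun a ↦ TensorProduct.tmul (M := Γ(M, U)) (N := Γ(N, U)) Γ(X, U) (b a.1) (b' a.2)) ?_
  intro V hV x hx
  have key := tensor_coordinates (R := Γ(X, V)) (P := Γ(M, V)) (Q := Γ(N, V))
    (hb.gen V hV) (hb.ind V hV) (hb'.gen V hV) (hb'.ind V hV)
  have hsum : ∀ c : A × B → Γ(X, V), ∑ a ∈ S ×ˢ T, c a •
      TensorProduct.tmul (M := Γ(M, V)) (N := Γ(N, V)) Γ(X, V) (res hV (b a.1)) (res hV (b' a.2)) =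
      ∑ a ∈ S ×ˢ T, c a • pres (P := preTens (toP M) (toP N)) hV
        (TensorProduct.tmul (M := Γ(M, U)) (N := Γ(N, U)) Γ(X, U) (b a.1) (b' a.2)) := fun c ↦ rfl
  refine ⟨V, le_refl V, hV, hx, fun s ↦ ?_, fun c hc ↦ ?_⟩
  · obtain ⟨c, hc⟩ := key.1 s
    exact ⟨c, hc.trans (hsum c)⟩
  · exact key.2 c ((hsum c).trans hc)

end Frames

/-! ### Vector bundles and frames -/

section Bundles

variable {X : Scheme.{u}} {M N : X.Modules} {U V W : X.Opens} {A B : Type*}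

lemma isIso_of_bijective {φ : M ⟶ N} (h : ∀ U, Function.Bijective (φ.app U)) : IsIso φ := by
  rw [Scheme.Modules.Hom.isIso_iff_isIso_app]
  intro U
  exact (ConcreteCategory.isIso_iff_bijective _).mpr (h U)

lemma IsFrame.bijective {S : Finset A} {b : A → Γ(M, U)} (hb : IsFrame M U S b) {φ : M ⟶ N}
    (hφ : IsFrame N U S fun a ↦ φ.app U (b a)) (h : V ≤ U) : Function.Bijective (φ.app V) := by
  constructor
  · exact (injective_iff_map_eq_zero (φ.app V).hom).mpr (hb.app_eq_zero hφ.ind h)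
  · intro s
    obtain ⟨c, rfl⟩ := hφ.gen V h s
    exact ⟨_, app_sum_smul φ S h c b⟩

/-- The structure sheaf as an object of the category of modules. -/
def unitMod (Y : Scheme.{u}) : Y.Modules := structureModule Y

/-- The unit section of the structure sheaf. -/
def oneSec (Y : Scheme.{u}) (U : Y.Opens) : Γ(unitMod Y, U) := (1 : Γ(Y, U))

lemma exists_eq_smul_oneSec (s : Γ(unitMod X, U)) : ∃ r : Γ(X, U), s = r • oneSec X U :=
  ⟨s, (mul_one (M := Γ(X, U)) s).symm⟩

lemma smul_oneSec_injective {r r' : Γ(X, U)} (h : r • oneSec X U = r' • oneSec X U) : r = r' :=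
  (mul_one (M := Γ(X, U)) r).symm.trans (h.trans (mul_one (M := Γ(X, U)) r'))

lemma res_oneSec (h : V ≤ U) : res h (oneSec X U) = oneSec X V :=
  map_one (rres h)

/-- A free sheaf of modules as an object of the category of modules. -/
def freeMod (Y : Scheme.{u}) (I : Type u) : Y.Modules := SheafOfModules.free (R := Y.ringCatSheaf) I

/-- The inclusion of the `i`-th summand of a free sheaf. -/
def freeIncl (Y : Scheme.{u}) {I : Type u} (i : I) : unitMod Y ⟶ freeMod Y I :=
  Sigma.ι (C := Y.Modules) (fun _ : I ↦ structureModule Y) i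

/-- The morphism from a free sheaf given by the images of the summands. -/
def freeDesc {I : Type u} (g : I → (unitMod X ⟶ M)) : freeMod X I ⟶ M :=
  Sigma.desc (C := X.Modules) (f := fun _ : I ↦ structureModule X) g

lemma freeIncl_desc {I : Type u} (g : I → (unitMod X ⟶ M)) (i : I) :
    freeIncl X i ≫ freeDesc g = g i :=
  Sigma.ι_desc (C := X.Modules) (f := fun _ : I ↦ structureModule X) _ _

lemma freeMod_hom_ext {I : Type u} {φ ψ : freeMod X I ⟶ M}
    (h : ∀ i, freeIncl X i ≫ φ = freeIncl X i ≫ ψ) : φ = ψ :=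
  Sigma.hom_ext (C := X.Modules) (f := fun _ : I ↦ structureModule X) _ _ h

/-- The `i`-th basis section of a free sheaf of modules. -/
def freeSec (Y : Scheme.{u}) {I : Type u} (i : I) : Γ(freeMod Y I, ⊤) :=
  (freeIncl Y i).app ⊤ (oneSec Y ⊤)

lemma app_smul_oneSec (φ : unitMod X ⟶ M) (r : Γ(X, U)) :
    φ.app U (r • oneSec X U) = r • res le_top (φ.app ⊤ (oneSec X ⊤)) := by
  rw [Scheme.Modules.Hom.app_smul, ← app_res, res_oneSec]

lemma isFrame_free (Y : Scheme.{u}) {I : Type u} [Fintype I] :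
    IsFrame (freeMod Y I) ⊤ Finset.univ (freeSec Y (I := I)) := by
  classical
  -- The coordinate projections: for finite `I` they exhibit the coproduct as a biproduct, and both
  -- frame axioms follow by evaluating the biproduct identities on sections.
  let p (i : I) : freeMod Y I ⟶ unitMod Y := freeDesc fun j ↦ if i = j then 𝟙 _ else 0
  have h1 : ∀ i j, freeIncl Y j ≫ p i = if i = j then 𝟙 _ else 0 := fun i j ↦ freeIncl_desc _ _
  have h2 : ∑ i, p i ≫ freeIncl Y i = 𝟙 _ := by
    refine freeMod_hom_ext fun j ↦ ?_
    rw [Preadditive.comp_sum, Category.comp_id, Finset.sum_eq_single j]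
    · rw [← Category.assoc, h1, if_pos rfl, Category.id_comp]
    · intro i _ hij
      rw [← Category.assoc, h1, if_neg hij, zero_comp]
    · simp
  have hsum : ∀ (V : Y.Opens) (s : Γ(freeMod Y I, V)) (S : Finset I),
      Scheme.Modules.Hom.app (∑ i ∈ S, p i ≫ freeIncl Y i) V s = ∑ i ∈ S, (freeIncl Y i).app V ((p i).app V s) := by
    intro V s S
    induction S using Finset.induction_on with
    | empty => simp
    | insert a S ha ih =>
      rw [Finset.sum_insert ha, Finset.sum_insert ha, ← ih]
      rfl
  constructor
  · intro V _ s
    choose c hc using fun i ↦ exists_eq_smul_oneSec ((p i).app V s)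
    refine ⟨c, ?_⟩
    refine Eq.trans congr(Scheme.Modules.Hom.app $h2 V s).symm ?_
    rw [hsum]
    exact Finset.sum_congr rfl fun i _ ↦ by rw [hc, app_smul_oneSec]; rfl
  · intro V _ c hc i _
    have h3 : ∑ i, (freeIncl Y i).app V (c i • oneSec Y V) = 0 := by
      rw [← hc]
      exact Finset.sum_congr rfl fun i _ ↦ app_smul_oneSec _ _
    have h4 := congrArg ((p i).app V) h3
    rw [app_sum, map_zero, Finset.sum_eq_single i] at h4
    · have h5 : c i • oneSec Y V = (0 : Γ(Y, V)) • oneSec Y V := by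
        rw [zero_smul, ← h4]
        exact (congr(Scheme.Modules.Hom.app $(h1 i i) V (c i • oneSec Y V)).trans (by rw [if_pos rfl]; rfl)).symm
      exact smul_oneSec_injective h5
    · intro j _ hj
      exact congr(Scheme.Modules.Hom.app $(h1 i j) V (c j • oneSec Y V)).trans (by rw [if_neg (Ne.symm hj)]; rfl)
    · simp

lemma restrict_smul (V : U.toScheme.Opens) (r : Γ(X, U.ι ''ᵁ V)) (s : Γ(M, U.ι ''ᵁ V)) :
    (show Γ(M.restrict U.ι, V) from ((show Γ(U, V) from r) • (show Γ(M.restrict U.ι, V) from s))) = r • s := by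
  have := Scheme.Opens.ι_appIso U V
  change ((U.ι.appIso V).inv r • s : Γ(M, U.ι ''ᵁ V)) = _
  rw [this]
  rfl

lemma exists_eq_image {V : U.toScheme.Opens} (h : W ≤ U.ι ''ᵁ V) :
    ∃ W' : U.toScheme.Opens, W = U.ι ''ᵁ W' ∧ W' ≤ V := by
  refine ⟨U.ι ⁻¹ᵁ W, ?_, ?_⟩
  · rw [Scheme.Hom.image_preimage_eq_opensRange_inf]
    have : W ≤ U.ι.opensRange := h.trans (by
      rintro _ ⟨y, _, rfl⟩
      exact ⟨y, rfl⟩)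
    exact (inf_eq_right.mpr this).symm
  · exact (U.ι.preimage_mono h).trans (U.ι.preimage_image_eq V).le

/-- Open subsets of the subscheme `U` are the open subsets of `X` inside `U`, with the same
functions and sections, so both sides quantify over the same data. -/
lemma isFrame_restrict_iff {V : U.toScheme.Opens} {S : Finset A} {b : A → Γ(M, U.ι ''ᵁ V)} :
    IsFrame (M.restrict U.ι) V S b ↔ IsFrame M (U.ι ''ᵁ V) S b := by
  have hsum : ∀ (W : U.toScheme.Opens) (h : W ≤ V) (c : A → Γ(X, U.ι ''ᵁ W)),
    (show Γ(M.restrict U.ι, W) from ∑ a ∈ S, (show Γ(U, W) from c a) • (res (M := M.restrict U.ι) h (b a))) =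
      ∑ a ∈ S, c a • res (U.ι.image_mono h) (b a) := fun W h c ↦
    Finset.sum_congr rfl fun a _ ↦ restrict_smul W (c a) (res (U.ι.image_mono h) (b a))
  constructor
  · intro hb
    constructor
    · intro W hW s
      obtain ⟨W', rfl, h⟩ := exists_eq_image hW
      obtain ⟨c, hc⟩ := hb.gen W' h s
      exact ⟨c, hc.trans (hsum W' h c)⟩
    · intro W hW c hc
      obtain ⟨W', rfl, h⟩ := exists_eq_image hW
      exact hb.ind W' h c ((hsum W' h c).trans hc)
  · intro hb
    constructor
    · intro W hW s
      obtain ⟨c, hc⟩ := hb.gen (U.ι ''ᵁ W) (U.ι.image_mono hW) s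
      exact ⟨c, hc.trans (hsum W hW c).symm⟩
    · intro W hW c hc
      exact hb.ind (U.ι ''ᵁ W) (U.ι.image_mono hW) c ((hsum W hW c).symm.trans hc)

/-- The morphism from the structure sheaf given by a global section. -/
def ofSec (s : Γ(M, ⊤)) : unitMod X ⟶ M :=
  homMk (M := unitMod X) (fun U ↦ (LinearMap.toSpanSingleton Γ(X, U) Γ(M, U) (res le_top s)).toAddMonoidHom)
    (fun {U V} i r ↦ by
      change M.presheaf.map i.op ((show Γ(X, V) from r) • res le_top s) = _
      rw [Scheme.Modules.map_smul]
      congr 1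
      exact res_res (le_top) (leOfHom i) s)
    (fun r s ↦ (LinearMap.toSpanSingleton Γ(X, _) Γ(M, _) (res le_top _)).map_smul r s)

lemma ofSec_oneSec (s : Γ(M, ⊤)) : (ofSec s).app ⊤ (oneSec X ⊤) = s := by
  refine (one_smul Γ(X, ⊤) (res le_top s)).trans ?_
  exact res_self s

/-- Vector bundles have frames near every point. -/
lemma IsVectorBundle.exists_frame (hM : IsVectorBundle M) (x : X) :
    ∃ U : X.Opens, x ∈ U ∧ ∃ (n : ℕ) (b : Fin n → Γ(M, U)), IsFrame M U Finset.univ b := by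
  obtain ⟨U, n, hxU, ⟨e⟩⟩ := hM x
  refine ⟨U.ι ''ᵁ ⊤, by simpa using hxU, n, ?_⟩
  let e' : M.restrict U.ι ≅ freeMod U.toScheme (ULift.{u} (Fin n)) := e
  have h1 := (isFrame_free U.toScheme (I := ULift.{u} (Fin n))).map_iso e'.inv
  have h2 := isFrame_restrict_iff.mp h1
  exact ⟨_, h2.reindex ULift.up (by simpa only [Finset.coe_univ, Set.bijOn_univ] using ULift.up_bijective) (fun t _ ↦ rfl)⟩

/-- A frame defines a morphism from a free sheaf on `U` that is bijective on sections over every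
open subset, hence is an isomorphism. The arbitrary index set is first renumbered by `Fin S.card`.
-/
lemma isVectorBundle_of_frames (h : ∀ x : X, ∃ U : X.Opens, x ∈ U ∧
    ∃ (A : Type) (S : Finset A) (b : A → Γ(M, U)), IsFrame M U S b) : IsVectorBundle M := by
  intro x
  obtain ⟨U, hxU, A, S, b, hb⟩ := h x
  refine ⟨U, S.card, hxU, ?_⟩
  have hU : U.ι ''ᵁ ⊤ ≤ U := by simp
  have h1 := isFrame_restrict_iff.mpr (hb.restrict hU)
  let e : ULift.{u} (Fin S.card) → A := fun i ↦ S.equivFin.symm i.down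
  have h2 := h1.reindex (T := Finset.univ) e (by
    refine ⟨fun i _ ↦ (S.equivFin.symm i.down).2, ?_, ?_⟩
    · intro i _ j _ hij
      exact ULift.down_injective (S.equivFin.symm.injective (Subtype.ext hij))
    · intro a ha
      exact ⟨⟨S.equivFin ⟨a, ha⟩⟩, by simp, by simp [e]⟩) (fun t _ ↦ rfl)
  let g : ULift.{u} (Fin S.card) → (unitMod U.toScheme ⟶ M.restrict U.ι) := fun i ↦
    ofSec (M := M.restrict U.ι) (res hU (b (e i)))
  have hg : ∀ i, (freeDesc g).app ⊤ (freeSec U.toScheme i) = res hU (b (e i)) := by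
    intro i
    have h3 := congr(Scheme.Modules.Hom.app $(freeIncl_desc g i) ⊤ (oneSec _ ⊤))
    exact h3.trans (ofSec_oneSec (M := M.restrict U.ι) (res hU (b (e i))))
  have : IsIso (freeDesc g) := isIso_of_bijective fun V ↦
    (isFrame_free U.toScheme).bijective (h2.congr fun i _ ↦ hg i) le_top
  exact ⟨(asIso (freeDesc g)).symm⟩

end Bundles

/-! ### Frames of subobjects and quotients -/

section Subbundles

variable {X : Scheme.{u}} {M N : X.Modules} {U V W : X.Opens} {A B : Type*} [DecidableEq A]

/-- The frame of a subobject given by a part of a frame of the ambient module. -/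
lemma isFrame_sub {φ : M ⟶ N} [Mono φ] {S S' : Finset A} (hS : S' ⊆ S) {n : A → Γ(N, U)}
    (hn : IsFrame N U S n) {m : A → Γ(M, U)} (hm : ∀ a ∈ S', φ.app U (m a) = n a)
    (hc : ∀ (V : X.Opens) (h : V ≤ U) (t : Γ(M, V)) (c : A → Γ(X, V)),
      φ.app V t = ∑ a ∈ S, c a • res h (n a) → ∀ a ∈ S, a ∉ S' → c a = 0) :
    IsFrame M U S' m := by
  have key : ∀ (V : X.Opens) (h : V ≤ U) (c : A → Γ(X, V)),
      φ.app V (∑ a ∈ S', c a • res h (m a)) = ∑ a ∈ S', c a • res h (n a) := fun V h c ↦ by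
    rw [app_sum_smul]
    exact Finset.sum_congr rfl fun a ha ↦ by rw [hm a ha]
  refine ⟨fun V h s ↦ ?_, fun V h c hc0 ↦ ?_⟩
  · obtain ⟨c, hc'⟩ := hn.gen V h (φ.app V s)
    refine ⟨c, app_injective φ V ?_⟩
    rw [key, hc']
    exact (Finset.sum_subset hS fun a ha ha' ↦ by rw [hc V h s c hc' a ha ha', zero_smul]).symm
  · have h1 : ∑ a ∈ S, (if a ∈ S' then c a else 0) • res h (n a) = 0 := by
      rw [← Finset.sum_subset hS fun a ha ha' ↦ by rw [if_neg ha', zero_smul]]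
      rw [Finset.sum_congr rfl fun a ha ↦ by rw [if_pos ha], ← key, hc0, map_zero]
    intro a ha
    have := hn.ind V h _ h1 a (hS ha)
    rwa [if_pos ha] at this

/-- The frame of a quotient given by a part of a frame of the ambient module. -/
lemma isFrame_cokernel {φ : M ⟶ N} [Mono φ] {S S' : Finset A} (hS : S' ⊆ S) {n : A → Γ(N, U)}
    (hn : IsFrame N U S n) {m : A → Γ(M, U)} (hM : IsFrame M U S' m)
    (hm : ∀ a ∈ S', φ.app U (m a) = n a) :
    IsFrame (cokernel φ) U (S \ S') fun a ↦ (cokernel.π φ).app U (n a) := by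
  have key : ∀ (V : X.Opens) (h : V ≤ U) (c : A → Γ(X, V)),
      φ.app V (∑ a ∈ S', c a • res h (m a)) = ∑ a ∈ S', c a • res h (n a) := fun V h c ↦ by
    rw [app_sum_smul]
    exact Finset.sum_congr rfl fun a ha ↦ by rw [hm a ha]
  refine isFrame_of_local (fun V h s x hx ↦ ?_) (fun V h c hc x hx ↦ ?_)
  · obtain ⟨W, hW, hxW, t, ht⟩ := exists_app_eq_of_epi (cokernel.π φ) s x hx
    obtain ⟨c, rfl⟩ := hn.gen W (hW.trans h) t
    refine ⟨W, hW, hxW, c, ?_⟩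
    rw [← ht, ← Finset.sum_sdiff hS, map_add, ← key, app_sum_smul,
      app_eq_zero_of_comp (cokernel.condition φ), add_zero]
  · refine ⟨V, le_refl V, hx, ?_⟩
    rw [← app_sum_smul] at hc
    obtain ⟨t, ht⟩ := exists_of_cokernel φ _ hc
    obtain ⟨c', rfl⟩ := hM.gen V h t
    rw [key] at ht
    -- A combination of the remaining `n a` that lies in the subobject is also a combination of the
    -- `n a` with `a ∈ S'`; the difference is a relation in the whole frame.
    have h1 : ∑ a ∈ S, (if a ∈ S' then - c' a else c a) • res h (n a) = 0 := by
      rw [← Finset.sum_sdiff hS]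
      rw [Finset.sum_congr (s₁ := S \ S') rfl fun a ha ↦ by rw [if_neg (Finset.mem_sdiff.mp ha).2],
        Finset.sum_congr (s₁ := S') rfl fun a ha ↦ by rw [if_pos ha, neg_smul],
        Finset.sum_neg_distrib, ht, add_neg_cancel]
    intro a ha
    have := hn.ind V h _ h1 a (Finset.sdiff_subset ha)
    rw [if_neg (Finset.mem_sdiff.mp ha).2] at this
    rw [this, map_zero]

lemma isIndep_of_subset {S S' : Finset A} (hS : S' ⊆ S) {n : A → Γ(N, U)} (hn : IsIndep N U S n) :
    IsIndep N U S' n := by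
  intro V h c hc a ha
  have h1 : ∑ a ∈ S, (if a ∈ S' then c a else 0) • res h (n a) = 0 := by
    rw [← Finset.sum_subset hS fun a ha ha' ↦ by rw [if_neg ha', zero_smul],
      Finset.sum_congr rfl fun a ha ↦ by rw [if_pos ha], hc]
  have := hn V h _ h1 a (hS ha)
  rwa [if_pos ha] at this

/-- A morphism is a subbundle if locally it carries a frame to a part of a frame. -/
lemma isSubbundle_of_frames {φ : M ⟶ N} (h : ∀ x : X, ∃ U : X.Opens, x ∈ U ∧
    ∃ (A : Type) (_ : DecidableEq A) (S S' : Finset A) (n : A → Γ(N, U)) (m : A → Γ(M, U)),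
      S' ⊆ S ∧ IsFrame N U S n ∧ IsFrame M U S' m ∧ ∀ a ∈ S', φ.app U (m a) = n a) :
    IsSubbundle φ := by
  have hmono : Mono φ := by
    refine mono_of_local fun x ↦ ?_
    obtain ⟨U, hxU, A, _, S, S', n, m, hS, hn, hM, hm⟩ := h x
    exact ⟨U, hxU, fun V hV s hs ↦ hM.app_eq_zero ((isIndep_of_subset hS hn.ind).congr hm) hV s hs⟩
  refine ⟨isVectorBundle_of_frames fun x ↦ ?_, hmono, isVectorBundle_of_frames fun x ↦ ?_⟩
  · obtain ⟨U, hxU, A, _, S, S', n, m, hS, hn, hM, hm⟩ := h x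
    exact ⟨U, hxU, A, S', m, hM⟩
  · obtain ⟨U, hxU, A, _, S, S', n, m, hS, hn, hM, hm⟩ := h x
    exact ⟨U, hxU, A, S \ S', _, isFrame_cokernel hS hn hM hm⟩

/-- Replacing some members of a frame by sections with an invertible diagonal matrix of
coefficients at those members. -/
lemma IsFrame.replace {T S : Finset A} (hS : S ⊆ T) {n : A → Γ(N, U)} (hn : IsFrame N U T n)
    (v : A → Γ(N, U)) (P : A → A → Γ(X, U)) (hv : ∀ a ∈ S, v a = ∑ b ∈ T, P a b • n b)
    (hP : ∀ a ∈ S, ∀ b ∈ S, a ≠ b → P a b = 0) (hu : ∀ a ∈ S, IsUnit (P a a)) :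
    IsFrame N U T fun a ↦ if a ∈ S then v a else n a := by
  -- The change of frame is block triangular: on `S` the block is diagonal with unit entries, off
  -- `S` it is the identity, and the `v a` may also involve the `n b` with `b ∉ S`. Coefficients are
  -- solved for on `S` first and then corrected off `S`.
  have key : ∀ (V : X.Opens) (h : V ≤ U) (c : A → Γ(X, V)),
      ∑ a ∈ T, c a • res h (if a ∈ S then v a else n a) =
        ∑ b ∈ T, (∑ a ∈ S, c a * rres h (P a b) + if b ∈ S then 0 else c b) • res h (n b) := by
    intro V h c
    simp only [add_smul, Finset.sum_add_distrib, Finset.sum_smul]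
    rw [Finset.sum_comm, ← Finset.sum_sdiff hS, add_comm]
    congr 1
    · refine Finset.sum_congr rfl fun a ha ↦ ?_
      rw [if_pos ha, hv a ha, res_sum, Finset.smul_sum]
      simp only [mul_smul]
    · rw [← Finset.sum_sdiff hS, Finset.sum_eq_zero (s := S) fun a ha ↦ by rw [if_pos ha, zero_smul], add_zero]
      exact Finset.sum_congr rfl fun a ha ↦ by
        rw [if_neg (Finset.mem_sdiff.mp ha).2, if_neg (Finset.mem_sdiff.mp ha).2]
  have hdiag : ∀ (V : X.Opens) (h : V ≤ U) (c : A → Γ(X, V)), ∀ b ∈ S,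
      ∑ a ∈ S, c a * rres h (P a b) = c b * rres h (P b b) := fun V h c b hb ↦
    Finset.sum_eq_single_of_mem b hb fun a ha hab ↦ by rw [hP a ha b hb hab, map_zero, mul_zero]
  refine ⟨fun V h s ↦ ?_, fun V h c hc ↦ ?_⟩
  · obtain ⟨c, rfl⟩ := hn.gen V h s
    choose! w hw using fun a ha ↦ (hu a ha).exists_left_inv
    refine ⟨fun a ↦ if a ∈ S then c a * rres h (w a) else
      c a - ∑ b ∈ S, c b * rres h (w b) * rres h (P b a), ?_⟩
    rw [key]
    refine Finset.sum_congr rfl fun b hb ↦ ?_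
    congr 1
    by_cases hbS : b ∈ S
    · rw [hdiag V h _ b hbS, if_pos hbS, if_pos hbS, mul_assoc, ← map_mul, hw b hbS, map_one]
      simp
    · rw [if_neg hbS, if_neg hbS, Finset.sum_congr rfl fun a ha ↦ by rw [if_pos ha]]
      ring
  · rw [key] at hc
    have h0 := hn.ind V h _ hc
    have h1 : ∀ a ∈ S, c a = 0 := by
      intro a ha
      have := h0 a (hS ha)
      rw [hdiag V h c a ha, if_pos ha, add_zero] at this
      exact ((hu a ha).map (rres h)).mul_left_eq_zero.mp this
    intro a ha
    by_cases haS : a ∈ S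
    · exact h1 a haS
    · have := h0 a ha
      rwa [if_neg haS, Finset.sum_eq_zero (s := S) fun b hb ↦ by rw [h1 b hb, zero_mul], zero_add] at this

/-- A criterion for subbundles: the matrix of the morphism in suitable local frames has an
invertible diagonal block. -/
lemma isSubbundle_of_matrix {φ : M ⟶ N} (h : ∀ x : X, ∃ U : X.Opens, x ∈ U ∧
    ∃ (A B : Type) (_ : DecidableEq B) (S : Finset A) (T : Finset B) (m : A → Γ(M, U))
      (n : B → Γ(N, U)) (κ : A → B) (P : A → B → Γ(X, U)),
      IsFrame M U S m ∧ IsFrame N U T n ∧ Set.MapsTo κ S T ∧ Set.InjOn κ S ∧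
      (∀ a ∈ S, φ.app U (m a) = ∑ b ∈ T, P a b • n b) ∧
      (∀ a ∈ S, ∀ a' ∈ S, a ≠ a' → P a (κ a') = 0) ∧ ∀ a ∈ S, IsUnit (P a (κ a))) :
    IsSubbundle φ := by
  classical
  refine isSubbundle_of_frames fun x ↦ ?_
  obtain ⟨U, hxU, A, B, _, S, T, m, n, κ, P, hM, hN, hκ, hκ', hφ, hP, hu⟩ := h x
  -- The empty frame is separate because `Function.invFunOn`, used to invert `κ` on `S`, needs an
  -- inhabited source.
  rcases S.eq_empty_or_nonempty with rfl | ⟨a₀, ha₀⟩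
  · exact ⟨U, hxU, B, inferInstance, T, ∅, n, fun _ ↦ 0, by simp, hN,
      ⟨fun V h s ↦ ⟨0, by obtain ⟨c, rfl⟩ := hM.gen V h s; simp⟩, fun V h c hc ↦ by simp⟩, by simp⟩
  have : Nonempty A := ⟨a₀⟩
  let g := Function.invFunOn κ S
  have hg : ∀ a ∈ S, g (κ a) = a := fun a ha ↦ hκ'.leftInvOn_invFunOn ha
  have hsub : S.image κ ⊆ T := by
    intro b hb
    obtain ⟨a, ha, rfl⟩ := Finset.mem_image.mp hb
    exact hκ ha
  have hM' : IsFrame M U (S.image κ) fun b ↦ m (g b) := by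
    refine hM.reindex g ⟨?_, ?_, ?_⟩ fun _ _ ↦ rfl
    · intro b hb
      obtain ⟨a, ha, rfl⟩ := Finset.mem_image.mp hb
      rw [hg a ha]; exact ha
    · intro b hb b' hb' e
      obtain ⟨a, ha, rfl⟩ := Finset.mem_image.mp hb
      obtain ⟨a', ha', rfl⟩ := Finset.mem_image.mp hb'
      rw [hg a ha, hg a' ha'] at e
      rw [e]
    · intro a ha
      exact ⟨κ a, Finset.mem_coe.mpr (Finset.mem_image_of_mem κ ha), hg a ha⟩
  have hN' := hN.replace hsub (fun b ↦ φ.app U (m (g b))) (fun b b' ↦ P (g b) b') (by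
      intro b hb
      obtain ⟨a, ha, rfl⟩ := Finset.mem_image.mp hb
      simp only [hg a ha, hφ a ha]) (by
      intro b hb b' hb' hne
      obtain ⟨a, ha, rfl⟩ := Finset.mem_image.mp hb
      obtain ⟨a', ha', rfl⟩ := Finset.mem_image.mp hb'
      simp only [hg a ha]
      exact hP a ha a' ha' fun e ↦ hne (by rw [e])) (by
      intro b hb
      obtain ⟨a, ha, rfl⟩ := Finset.mem_image.mp hb
      simp only [hg a ha]
      exact hu a ha)
  exact ⟨U, hxU, B, inferInstance, T, S.image κ, _, _, hsub, hN', hM', fun b hb ↦ (if_pos hb).symm⟩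

lemma IsVectorBundle.of_iso (hM : IsVectorBundle M) (e : M ≅ N) : IsVectorBundle N :=
  isVectorBundle_of_frames fun x ↦ by
    obtain ⟨U, hxU, n, b, hb⟩ := hM.exists_frame x
    exact ⟨U, hxU, Fin n, _, _, hb.map_iso e.hom⟩

lemma IsSubbundle.iso_comp {M' : X.Modules} {φ : M ⟶ N} (hφ : IsSubbundle φ) (e : M' ≅ M) :
    IsSubbundle (e.hom ≫ φ) where
  isVectorBundle := hφ.isVectorBundle.of_iso e.symm
  mono := by have := hφ.mono; infer_instance
  isVectorBundle_cokernel := hφ.isVectorBundle_cokernel.of_iso (cokernelEpiComp e.hom φ).symm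

end Subbundles

/-! ### Frames of Frobenius pullbacks -/

section FrobeniusPullback

variable {X : Scheme.{u}} {M N : X.Modules} {U V W : X.Opens} {A B : Type*}

/-- The coordinate functions of a frame. -/
def IsFrame.coord {S : Finset A} {b : A → Γ(M, U)} (hb : IsFrame M U S b) (a : A) (h : V ≤ U)
    (s : Γ(M, V)) : Γ(X, V) := (hb.gen V h s).choose a

lemma IsFrame.sum_coord {S : Finset A} {b : A → Γ(M, U)} (hb : IsFrame M U S b) (h : V ≤ U)
    (s : Γ(M, V)) : ∑ a ∈ S, hb.coord a h s • res h (b a) = s := (hb.gen V h s).choose_spec.symm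

lemma IsFrame.coord_eq {S : Finset A} {b : A → Γ(M, U)} (hb : IsFrame M U S b) (h : V ≤ U)
    {s : Γ(M, V)} {c : A → Γ(X, V)} (e : ∑ a ∈ S, c a • res h (b a) = s) {a : A} (ha : a ∈ S) :
    hb.coord a h s = c a :=
  hb.ind.coeff_eq h ((hb.sum_coord h s).trans e.symm) a ha

lemma IsFrame.coord_add {S : Finset A} {b : A → Γ(M, U)} (hb : IsFrame M U S b) (h : V ≤ U)
    (s t : Γ(M, V)) {a : A} (ha : a ∈ S) :
    hb.coord a h (s + t) = hb.coord a h s + hb.coord a h t :=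
  hb.coord_eq h (c := fun a ↦ hb.coord a h s + hb.coord a h t)
    (by simp only [add_smul, Finset.sum_add_distrib, sum_coord]) ha

lemma IsFrame.coord_smul {S : Finset A} {b : A → Γ(M, U)} (hb : IsFrame M U S b) (h : V ≤ U)
    (r : Γ(X, V)) (s : Γ(M, V)) {a : A} (ha : a ∈ S) :
    hb.coord a h (r • s) = r * hb.coord a h s :=
  hb.coord_eq h (c := fun a ↦ r * hb.coord a h s)
    (by simp only [mul_smul, ← Finset.smul_sum, sum_coord]) ha

lemma IsFrame.coord_res {S : Finset A} {b : A → Γ(M, U)} (hb : IsFrame M U S b) (h : V ≤ U)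
    (h' : W ≤ V) (s : Γ(M, V)) {a : A} (ha : a ∈ S) :
    hb.coord a (h'.trans h) (res h' s) = rres h' (hb.coord a h s) :=
  hb.coord_eq _ (c := fun a ↦ rres h' (hb.coord a h s))
    (by conv_rhs => rw [← hb.sum_coord h s, res_sum]
        simp only [res_res]) ha

variable {k : Type u} [Field k] (p : ℕ) [Fact p.Prime] [CharP k p] (f : X ⟶ Spec (.of k))

lemma frobSec_smul (G : X.Modules) (r : Γ(X, U)) (s : Γ(G, U)) :
    frobSec p f G U (r • s) = r ^ p • frobSec p f G U s :=
  (frobUnit p f G).app_smul r s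

lemma frobSec_res (G : X.Modules) (h : V ≤ U) (s : Γ(G, U)) :
    frobSec p f G V (res h s) = res h (frobSec p f G U s) :=
  app_res (frobUnit p f G) h s

lemma frobPull_hom_eq_zero {G Q : X.Modules} (q : frobPull p f G ⟶ Q)
    (hq : ∀ (U : X.Opens) (s : Γ(G, U)), q.app U (frobSec p f G U s) = 0) : q = 0 := by
  apply ((Scheme.Modules.pullbackPushforwardAdjunction (absFrobenius p f)).homEquiv _ _).injective
  rw [Adjunction.homEquiv_unit, Adjunction.homEquiv_unit, Functor.map_zero, comp_zero]
  ext U s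
  exact hq U s

lemma exists_frobPull_hom {G Q : X.Modules}
    (θ : G ⟶ (Scheme.Modules.pushforward (absFrobenius p f)).obj Q) :
    ∃ q : frobPull p f G ⟶ Q, ∀ (U : X.Opens) (s : Γ(G, U)), q.app U (frobSec p f G U s) = θ.app U s := by
  let e := (Scheme.Modules.pullbackPushforwardAdjunction (absFrobenius p f)).homEquiv G Q
  refine ⟨e.symm θ, fun U s ↦ ?_⟩
  have h := (Scheme.Modules.pullbackPushforwardAdjunction (absFrobenius p f)).homEquiv_unit
    (f := e.symm θ)
  rw [Equiv.apply_symm_apply] at h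
  exact congr(($h).app U s).symm

/-- The sections of `F^* G` are locally combinations of pulled back sections. -/
lemma frobPull_locally_mem_span (G : X.Modules) (s : Γ(frobPull p f G, U)) (x : X) (hx : x ∈ U) :
    ∃ (V : X.Opens) (h : V ≤ U), x ∈ V ∧
      res h s ∈ Submodule.span Γ(X, V) (Set.range (frobSec p f G V)) := by
  -- By adjunction a morphism out of F^*G that kills all pulled back sections is zero, so
  -- `locally_mem_of_hom_eq_zero` applies to the subpresheaf they span. No explicit model of the
  -- pullback is needed.
  let S : (toP (frobPull p f G)).Submodule :=
    { obj U := Submodule.span (X.ringCatSheaf.obj.obj U) (Set.range (frobSec p f G U.unop))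
      map {U V} i := by
        rw [Submodule.span_le]
        rintro _ ⟨s, rfl⟩
        refine Submodule.subset_span ⟨res (leOfHom i.unop) s, ?_⟩
        exact frobSec_res p f G (leOfHom i.unop) s }
  exact locally_mem_of_hom_eq_zero S (fun Q q hq ↦ frobPull_hom_eq_zero p f q fun U s ↦
    hq U _ (Submodule.subset_span ⟨s, rfl⟩)) s x hx

/-- The direct image to `X` of the structure sheaf of an open subscheme. -/
def openUnit (U : X.Opens) : X.Modules := (Scheme.Modules.pushforward U.ι).obj (unitMod U.toScheme)

/-- The open set `V ∩ U`, as the image of an open subset of `U`. -/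
abbrev meetOpen (U V : X.Opens) : X.Opens := U.ι ''ᵁ (U.ι ⁻¹ᵁ V)

lemma meetOpen_le_left (U V : X.Opens) : meetOpen U V ≤ U := by
  rw [meetOpen, Scheme.Hom.image_preimage_eq_opensRange_inf]
  simp

lemma meetOpen_le_right (U V : X.Opens) : meetOpen U V ≤ V := by
  rw [meetOpen, Scheme.Hom.image_preimage_eq_opensRange_inf]
  simp

lemma le_meetOpen (h : V ≤ U) : V ≤ meetOpen U V := by
  rw [meetOpen, Scheme.Hom.image_preimage_eq_opensRange_inf]
  simpa using h

lemma openUnit_smul (r : Γ(X, V)) (s : Γ(X, meetOpen U V)) :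
    (show Γ(X, meetOpen U V) from (r • (show Γ(openUnit U, V) from s))) =
      rres (meetOpen_le_right U V) r * s := by
  change (show Γ(X, meetOpen U V) from U.ι.app V r) * s = _
  congr 1

/-- The pulled back sections of a frame form a frame of the Frobenius pullback. -/
lemma IsFrame.frobSec {G : X.Modules} {S : Finset A} {b : A → Γ(G, U)} (hb : IsFrame G U S b) :
    IsFrame (frobPull p f G) U S fun a ↦ frobSec p f G U (b a) := by
  classical
  refine isFrame_of_local (fun V h s x hx ↦ ?_) (fun V h c hc x hx ↦ ⟨V, le_refl V, hx, fun a ha ↦ ?_⟩)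
  · obtain ⟨W, hW, hxW, hs⟩ := frobPull_locally_mem_span p f G s x hx
    refine ⟨W, hW, hxW, ?_⟩
    have : ∀ t ∈ Submodule.span Γ(X, W) (Set.range (FrobFil.frobSec p f G W)), ∃ c : A → Γ(X, W),
        t = ∑ a ∈ S, c a • res (hW.trans h) (FrobFil.frobSec p f G U (b a)) := by
      intro t ht
      induction ht using Submodule.span_induction with
      | mem t ht =>
        obtain ⟨g, rfl⟩ := ht
        obtain ⟨c, rfl⟩ := hb.gen W (hW.trans h) g
        refine ⟨fun a ↦ c a ^ p, ?_⟩
        rw [map_sum]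
        exact Finset.sum_congr rfl fun a _ ↦ by rw [frobSec_smul, frobSec_res]
      | zero => exact ⟨0, by simp⟩
      | add t t' _ _ h1 h2 =>
        obtain ⟨c, rfl⟩ := h1
        obtain ⟨c', rfl⟩ := h2
        exact ⟨c + c', by simp only [Pi.add_apply, add_smul, Finset.sum_add_distrib]⟩
      | smul r t _ h1 =>
        obtain ⟨c, rfl⟩ := h1
        exact ⟨fun a ↦ r * c a, by simp only [mul_smul, ← Finset.smul_sum]⟩
    exact this _ hs
  -- To read off the coefficient `c a`, one needs a morphism out of F^*G that sends F^*(b a) to 1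
  -- and the other F^*(b a') to 0. It is adjoint to the p-th power of the coordinate function, which
  -- is linear over Frobenius. That coordinate exists only on `U`, so the target is the direct image
  -- of the structure sheaf of `U`.
  · let ψ (V : X.Opens) : Γ(G, V) →+ Γ(X, meetOpen U V) :=
      (powHom p Γ(X, meetOpen U V) (cast_eq_zero p f _)).toAddMonoidHom.comp
        (AddMonoidHom.mk' (fun s ↦ hb.coord a (meetOpen_le_left U V) (res (meetOpen_le_right U V) s))
          fun s t ↦ by rw [map_add, hb.coord_add _ _ _ ha])
    have hψ : ∀ V s, ψ V s =
      hb.coord a (meetOpen_le_left U V) (res (meetOpen_le_right U V) s) ^ p := fun _ _ ↦ rfl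
    let θ : G ⟶ (Scheme.Modules.pushforward (absFrobenius p f)).obj (openUnit U) :=
      homMk (N := (Scheme.Modules.pushforward (absFrobenius p f)).obj (openUnit U)) (fun V ↦ ψ V)
        (fun {V V'} i s ↦ by
          have h1 : meetOpen U V ≤ meetOpen U V' := U.ι.image_mono (U.ι.preimage_mono (leOfHom i))
          change rres h1 (ψ V' s) = ψ V (res (leOfHom i) s)
          rw [hψ, hψ, map_pow, ← hb.coord_res _ _ _ ha, res_res, res_res])
        (fun {V} r s ↦ by
          refine Eq.trans ?_ (openUnit_smul (r ^ p) (ψ V s)).symm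
          change ψ V (r • s) = _
          rw [hψ, hψ, res_smul, hb.coord_smul _ _ _ ha, mul_pow, map_pow])
    obtain ⟨q, hq⟩ := exists_frobPull_hom p f θ
    have hq' : ∀ a' ∈ S, q.app V (res h (FrobFil.frobSec p f G U (b a'))) =
        (show Γ(X, meetOpen U V) from if a' = a then 1 else 0) := by
      intro a' ha'
      rw [← frobSec_res, hq]
      refine (hψ V (res h (b a'))).trans ?_
      rw [hb.coord_eq (meetOpen_le_left U V) (c := fun i ↦ if i = a' then 1 else 0) _ ha]
      · split_ifs with h1 h2 h2
        · exact one_pow p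
        · exact absurd h1.symm h2
        · exact absurd h2.symm h1
        · exact zero_pow (Fact.out : p.Prime).ne_zero
      · simp [ha', res_res]
    have h1 := congrArg (q.app V) hc
    rw [app_sum, map_zero] at h1
    have h2 : ∑ a' ∈ S, rres (meetOpen_le_right U V) (c a') * (if a' = a then 1 else 0) = 0 := by
      refine Eq.trans (Finset.sum_congr rfl fun a' ha' ↦ ?_) h1
      rw [Scheme.Modules.Hom.app_smul, hq' a' ha']
      exact (openUnit_smul (c a') _).symm
    have h3 : rres (meetOpen_le_right U V) (c a) = 0 := by
      simpa [ha] using h2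
    have h4 := congrArg (rres (le_meetOpen h)) h3
    rwa [rres_rres, rres_self, map_zero, ← rres_self (c a)] at h4

end FrobeniusPullback

end

end FrobFil

universe v w

namespace FrobFil

noncomputable section

/-! ### p-bases and algebraic independence of coordinates on an algebra -/

section Coordinates
open scoped TensorProduct
open MvPolynomial

lemma isUnit_natCast_of_lt {R : Type*} [CommRing R] (p : ℕ) [Fact p.Prime] [CharP R p] {m : ℕ}
    (h0 : m ≠ 0) (hm : m < p) : IsUnit (m : R) := by
  rw [CharP.isUnit_natCast_iff (p := p) Fact.out]
  exact fun h ↦ absurd (Nat.le_of_dvd (Nat.pos_of_ne_zero h0) h) (by omega)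

lemma totalDegree_pderiv_le {R σ : Type*} [CommRing R] (P : MvPolynomial σ R) (j : σ) {N : ℕ}
    (h : P.totalDegree ≤ N + 1) : (pderiv j P).totalDegree ≤ N := by
  classical
  refine Finset.sup_le fun m hm ↦ ?_
  have h1 : coeff (m + Finsupp.single j 1) P ≠ 0 := by
    intro h0
    rw [mem_support_iff, coeff_pderiv, h0, zero_mul] at hm
    exact hm rfl
  have h2 := (le_totalDegree (mem_support_iff.mpr h1)).trans h
  rw [Finsupp.sum_add_index' (by simp) (by simp), Finsupp.sum_single_index rfl] at h2
  exact Nat.add_le_add_iff_right.mp h2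

variable {k : Type v} {B : Type w} [Field k] [CommRing B] [Algebra k B] {n : ℕ} {x : Fin n → B}

/-- The chain rule when the coefficients are constants for `D` and `D` is dual to the `j`-th
coordinate. It turns relations among the coordinates into relations of lower degree. -/
lemma derivation_eval₂ {R : Type*} [CommRing R] (φ : R →+* B) (D : Derivation k B B)
    (hφ : ∀ r, D (φ r) = 0) (j : Fin n) (hx : ∀ i, D (x i) = if i = j then 1 else 0)
    (P : MvPolynomial (Fin n) R) : D (eval₂ φ x P) = eval₂ φ x (pderiv j P) := by
  induction P using MvPolynomial.induction_on with
  | C a => simp [hφ]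
  | add P Q hP hQ => simp [hP, hQ]
  | mul_X P i hP =>
    rw [eval₂_mul, Derivation.leibniz, hP, Derivation.leibniz, eval₂_add, eval₂_X, hx]
    simp only [smul_eq_mul, eval₂_mul, eval₂_X, pderiv_X, Pi.single_apply, eq_comm (a := i)]
    split_ifs <;> simp

section
variable (p : ℕ) [Fact p.Prime]

/-- Polynomials in the coordinates, with constant coefficients and exponents less than `p`, vanish
only if they are zero. -/
lemma eq_zero_of_eval₂_eq_zero {R : Type*} [CommRing R] [CharP R p] (φ : R →+* B)
    (hinj : Function.Injective φ) (D : Fin n → Derivation k B B) (hφ : ∀ j r, D j (φ r) = 0)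
    (hx : ∀ j i, D j (x i) = if i = j then 1 else 0) (P : MvPolynomial (Fin n) R)
    (hdeg : ∀ m, coeff m P ≠ 0 → ∀ j, m j < p) (hP : eval₂ φ x P = 0) : P = 0 := by
  obtain ⟨N, hN⟩ : ∃ N, P.totalDegree ≤ N := ⟨_, le_rfl⟩
  induction N generalizing P with
  | zero =>
    rw [totalDegree_eq_zero_iff_eq_C.mp (Nat.le_zero.mp hN)] at hP ⊢
    rw [eval₂_C] at hP
    rw [(map_eq_zero_iff φ hinj).mp hP, C_0]
  | succ N ih =>
    -- Applying `D j` to the relation P(x) = 0 gives one of smaller degree, with exponents still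
    -- less than p, for the partial derivative; by induction that derivative is zero.
    have hd : ∀ j, pderiv j P = 0 := fun j ↦ by
      refine ih _ (fun m hm i ↦ ?_) ?_ (totalDegree_pderiv_le P j hN)
      · rw [coeff_pderiv] at hm
        have := hdeg _ (left_ne_zero_of_mul hm) i
        rw [Finsupp.add_apply] at this
        omega
      · rw [← derivation_eval₂ φ (D j) (hφ j) j (hx j), hP, map_zero]
    -- If m_j ≠ 0, the coefficient of ∂_j P at m − ε_j is m_j times that of P at m, and m_j is a
    -- unit because 0 < m_j < p.
    have hC : ∀ m, m ≠ 0 → coeff m P = 0 := by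
      intro m hm
      by_contra hne
      obtain ⟨j, hj⟩ := Finsupp.ne_iff.mp hm
      have h1 := coeff_pderiv (i := j) P (m - Finsupp.single j 1)
      rw [hd j, coeff_zero] at h1
      have h2 : m - Finsupp.single j 1 + Finsupp.single j 1 = m :=
        tsub_add_cancel_of_le (by
          rw [Finsupp.single_le_iff]; exact Nat.one_le_iff_ne_zero.mpr hj)
      have h3 : (((m - Finsupp.single j 1 : Fin n →₀ ℕ) j : R) + 1) = (m j : R) := by
        have := DFunLike.congr_fun h2 j
        rw [Finsupp.add_apply, Finsupp.single_eq_same] at this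
        rw [← this]; push_cast; ring
      rw [h2, h3] at h1
      exact hne ((isUnit_natCast_of_lt p hj (hdeg m hne j)).mul_left_eq_zero.mp h1.symm)
    have hPC : P = C (coeff 0 P) := by
      ext m
      by_cases hm : m = 0
      · simp [hm]
      · rw [hC m hm, coeff_C, if_neg (Ne.symm hm)]
    rw [hPC] at hP ⊢
    rw [eval₂_C] at hP
    rw [(map_eq_zero_iff φ hinj).mp hP, C_0]

/-- Vanishing partial derivatives force every exponent to be divisible by p, and over a perfect
field the coefficients have p-th roots. The degree drops strictly since deg P = p · deg Q with p ≥ 2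
and the bound on P is positive, which feeds the induction in `algebraicIndependent_of_derivation`.
-/
lemma exists_pow_eq_of_pderiv_eq_zero [CharP k p] [PerfectRing k p] (P : MvPolynomial (Fin n) k)
    (hP : ∀ j, pderiv j P = 0) {N : ℕ} (hN : P.totalDegree ≤ N + 1) :
    ∃ Q, Q ^ p = P ∧ Q.totalDegree ≤ N := by
  classical
  have hdvd : ∀ m ∈ P.support, ∀ j, p ∣ m j := by
    intro m hm j
    by_contra hne
    have hj : m j ≠ 0 := fun h ↦ hne (h ▸ dvd_zero p)
    have h1 := coeff_pderiv (i := j) P (m - Finsupp.single j 1)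
    rw [hP j, coeff_zero] at h1
    have h2 : m - Finsupp.single j 1 + Finsupp.single j 1 = m :=
      tsub_add_cancel_of_le (by
        rw [Finsupp.single_le_iff]; exact Nat.one_le_iff_ne_zero.mpr hj)
    have h3 : (((m - Finsupp.single j 1 : Fin n →₀ ℕ) j : k) + 1) = (m j : k) := by
      have := DFunLike.congr_fun h2 j
      rw [Finsupp.add_apply, Finsupp.single_eq_same] at this
      rw [← this]; push_cast; ring
    rw [h2, h3] at h1
    rcases mul_eq_zero.mp h1.symm with h | h
    · exact (mem_support_iff.mp hm) h
    · exact hne ((CharP.cast_eq_zero_iff k p _).mp h)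
  let q : (Fin n →₀ ℕ) → (Fin n →₀ ℕ) := fun m ↦ m.mapRange (· / p) (Nat.zero_div p)
  refine ⟨∑ m ∈ P.support, monomial (q m) ((frobeniusEquiv k p).symm (coeff m P)), ?_, ?_⟩
  · rw [sum_pow_char]
    conv_rhs => rw [P.as_sum]
    refine Finset.sum_congr rfl fun m hm ↦ ?_
    rw [monomial_pow, frobeniusEquiv_symm_pow_p]
    have hq : p • q m = m := by
      ext j
      simpa [q] using Nat.mul_div_cancel' (hdvd m hm j)
    rw [hq]
  · refine (totalDegree_finsetSum_le fun m hm ↦ ?_)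
    refine (totalDegree_monomial_le _ _).trans ?_
    have h1 := (le_totalDegree hm).trans hN
    rw [Finsupp.sum_fintype _ _ (by simp)] at h1 ⊢
    have h2 : p * ∑ i, q m i = ∑ i, m i := by
      rw [Finset.mul_sum]
      exact Finset.sum_congr rfl fun j _ ↦ by simpa [q] using Nat.mul_div_cancel' (hdvd m hm j)
    have h3 := (Fact.out : p.Prime).two_le
    change ∑ i, q m i ≤ N
    by_contra hlt
    push Not at hlt
    have : 2 * ∑ i, q m i ≤ p * ∑ i, q m i := Nat.mul_le_mul_right _ h3
    omega

/-- Coordinates on a reduced algebra are algebraically independent. -/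
lemma algebraicIndependent_of_derivation [CharP k p] [Nontrivial B] [IsReduced B] [PerfectRing k p]
    (D : Fin n → Derivation k B B)
    (hx : ∀ j i, D j (x i) = if i = j then 1 else 0) : AlgebraicIndependent k x := by
  rw [algebraicIndependent_iff]
  intro P hP
  obtain ⟨N, hN⟩ : ∃ N, P.totalDegree ≤ N := ⟨_, le_rfl⟩
  induction N generalizing P with
  | zero =>
    rw [totalDegree_eq_zero_iff_eq_C.mp (Nat.le_zero.mp hN)] at hP ⊢
    rw [aeval_C] at hP
    rw [(map_eq_zero_iff _ (algebraMap k B).injective).mp hP, C_0]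
  | succ N ih =>
    -- The derivatives are relations of smaller degree, hence zero. So P = Q^p, and since `B` is
    -- reduced Q is again a relation, of smaller degree.
    have hd : ∀ j, pderiv j P = 0 := fun j ↦ by
      refine ih _ ?_ (totalDegree_pderiv_le P j hN)
      rw [aeval_def, ← derivation_eval₂ _ (D j) (fun r ↦ (D j).map_algebraMap r) j (hx j),
        ← aeval_def, hP, map_zero]
    obtain ⟨Q, rfl, hQ⟩ := exists_pow_eq_of_pderiv_eq_zero p P hd hN
    rw [map_pow] at hP
    rw [ih Q (eq_zero_of_pow_eq_zero hP) hQ, zero_pow (Fact.out : p.Prime).ne_zero]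

/-- Noether normalization makes `B` integral over a polynomial ring in s variables. Comparing
transcendence degrees gives n ≤ s, and s is the dimension of that polynomial ring, which is at most
the dimension of `B` by lying over and going up. -/
lemma le_ringKrullDim_of_algebraicIndependent [IsDomain B] [Algebra.FiniteType k B]
    (hx : AlgebraicIndependent k x) : (n : WithBot ℕ∞) ≤ ringKrullDim B := by
  obtain ⟨s, g, hg, hint⟩ := exists_integral_inj_algHom_of_fg k B
  algebraize [g.toRingHom]
  have : IsScalarTower k (MvPolynomial (Fin s) k) B := .of_algebraMap_eq fun r ↦ (g.commutes r).symm
  have : FaithfulSMul (MvPolynomial (Fin s) k) B := (faithfulSMul_iff_algebraMap_injective _ _).mpr hg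
  have : Algebra.IsIntegral (MvPolynomial (Fin s) k) B := ⟨hint⟩
  have h1 : n ≤ s := by
    have h := hx.lift_cardinalMk_le_trdeg
    have h2 := lift_trdeg_add_eq k (MvPolynomial (Fin s) k) B
    rw [trdeg_eq_zero (R := MvPolynomial (Fin s) k), Cardinal.lift_zero, add_zero,
      MvPolynomial.trdeg_of_isDomain] at h2
    simp only [Cardinal.mk_fin, Cardinal.lift_natCast] at h h2
    rw [← Cardinal.lift_inj.{_, v}, Cardinal.lift_natCast, Cardinal.lift_lift] at h2
    rw [← Cardinal.lift_le.{v}, Cardinal.lift_natCast, Cardinal.lift_lift] at h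
    exact Nat.cast_le.mp (h.trans_eq h2.symm)
  have h2 : ringKrullDim (MvPolynomial (Fin s) k) = s := by simp
  have h3 : ringKrullDim (MvPolynomial (Fin s) k) ≤ ringKrullDim B := by
    refine iSup_le fun l ↦ ?_
    -- Lying over lifts the first prime of a chain and going up lifts the rest, with the same
    -- length.
    obtain ⟨P, hP, hPl⟩ := Ideal.nonempty_primesOver (S := B) l.head.asIdeal
    obtain ⟨L, hL, -⟩ := Ideal.exists_ltSeries_of_hasGoingUp l P
    rw [← hL]
    exact le_iSup (fun l : LTSeries (PrimeSpectrum B) ↦ (l.length : WithBot ℕ∞)) L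
  rw [h2] at h3
  exact le_trans (by exact_mod_cast h1) h3

/-- If the differentials of the coordinates generate, then every element is a polynomial in the
coordinates whose coefficients are `p`-th powers. -/
lemma exists_eval₂_frobenius [CharP k p] [CharP B p] [PerfectRing k p] [Algebra.FiniteType k B]
    (hx : Submodule.span B (Set.range fun j ↦ KaehlerDifferential.D k B (x j)) = ⊤) (b : B) :
    ∃ P : MvPolynomial (Fin n) B, eval₂ (frobenius B p) x P = b := by
  have : ExpChar B p := .prime Fact.out
  -- The claim amounts to `C = B` for the subalgebra generated over `k` by the coordinates and all
  -- p-th powers. `B` is finite over `C`, being of finite type and integral, and Ω of `B` over `C`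
  -- vanishes because the generating differentials do; so `B` is unramified over `C`.
  let C : Subalgebra k B := Algebra.adjoin k (Set.range x ∪ Set.range fun b : B ↦ b ^ p)
  have hC : ∀ b : B, b ^ p ∈ C := fun b ↦ Algebra.subset_adjoin (Or.inr ⟨b, rfl⟩)
  have hCx : ∀ j, x j ∈ C := fun j ↦ Algebra.subset_adjoin (Or.inl ⟨j, rfl⟩)
  have : Algebra.FiniteType C B := .of_restrictScalars_finiteType k C B
  have : Algebra.IsIntegral C B := ⟨fun b ↦ .of_pow (Fact.out : p.Prime).pos
    (isIntegral_algebraMap (x := (⟨b ^ p, hC b⟩ : C)))⟩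
  have : Module.Finite C B := Algebra.IsIntegral.finite
  have : Algebra.FormallyUnramified C B := by
    rw [Algebra.formallyUnramified_iff]
    have h : (⊤ : Submodule B (Ω[B⁄C])) = ⊥ := by
      rw [← LinearMap.range_eq_top.mpr (KaehlerDifferential.map_surjective k C B), ← Submodule.map_top, ← hx,
        Submodule.map_span, Submodule.span_eq_bot]
      rintro _ ⟨_, ⟨j, rfl⟩, rfl⟩
      rw [KaehlerDifferential.map_D]
      exact (KaehlerDifferential.D C B).map_algebraMap (⟨x j, hCx j⟩ : C)
    exact (Submodule.subsingleton_iff B).mp (subsingleton_of_bot_eq_top h.symm)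
  obtain ⟨t, ht, ht1⟩ := Algebra.FormallyUnramified.iff_exists_tensorProduct.mp this
  -- The kernel of multiplication B ⊗_C B → B is generated by the 1⊗s − s⊗1, whose p-th powers
  -- vanish because s^p lies in `C`. So `1 - t` is nilpotent, while `t` annihilates all these
  -- generators.
  have hnil : IsNilpotent (1 - t) := by
    have hmem : 1 - t ∈ KaehlerDifferential.ideal C B := by
      rw [KaehlerDifferential.ideal, RingHom.mem_ker]
      exact (map_sub _ _ _).trans (by rw [ht1, map_one, sub_self])
    rw [← KaehlerDifferential.span_range_eq_ideal] at hmem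
    rw [← mem_nilradical]
    refine Ideal.span_le.mpr ?_ hmem
    rintro _ ⟨s, rfl⟩
    refine mem_nilradical.mpr ⟨p, ?_⟩
    have hinj : Function.Injective (Algebra.TensorProduct.includeLeftRingHom : B →+* B ⊗[C] B) :=
      Function.LeftInverse.injective (g := Algebra.TensorProduct.lmul' C) fun b ↦ by simp
    have : CharP (B ⊗[C] B) p := charP_of_injective_ringHom hinj p
    have : ExpChar (B ⊗[C] B) p := .prime Fact.out
    change (1 ⊗ₜ[C] s - s ⊗ₜ[C] 1) ^ p = 0
    rw [sub_pow_char, Algebra.TensorProduct.tmul_pow, Algebra.TensorProduct.tmul_pow, one_pow,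
      sub_eq_zero]
    have h := TensorProduct.smul_tmul (R := C) (⟨s ^ p, hC s⟩ : C) (1 : B) (1 : B)
    rw [Algebra.smul_def, mul_one] at h
    exact h.symm
  have ht' : IsUnit t := by simpa using hnil.isUnit_one_sub
  -- Since `t` is a unit, 1⊗s = s⊗1 for every s: the inclusion of `C` is an epimorphism of rings,
  -- and a finite epimorphism is surjective.
  have hepi : Algebra.IsEpi C B := (Algebra.isEpi_iff_forall_one_tmul_eq C B).mpr fun s ↦
    sub_eq_zero.mp (ht'.mul_left_eq_zero.mp (ht s))
  obtain ⟨⟨b, hb⟩, rfl⟩ := Algebra.isEpi_iff_surjective_algebraMap_of_finite.mp hepi b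
  change ∃ P : MvPolynomial (Fin n) B, eval₂ (frobenius B p) x P = b
  induction hb using Algebra.adjoin_induction with
  | mem b hb =>
    rcases hb with ⟨j, rfl⟩ | ⟨b, rfl⟩
    · exact ⟨X j, eval₂_X _ _ _⟩
    · exact ⟨MvPolynomial.C b, eval₂_C _ _ _⟩
  | algebraMap r =>
    -- Constants from the perfect field `k` are themselves p-th powers.
    refine ⟨MvPolynomial.C (algebraMap k B ((frobeniusEquiv k p).symm r)), ?_⟩
    rw [eval₂_C, frobenius_def, ← map_pow, frobeniusEquiv_symm_pow_p]
  | add a b _ _ ha hb =>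
    obtain ⟨P, rfl⟩ := ha
    obtain ⟨Q, rfl⟩ := hb
    exact ⟨P + Q, eval₂_add _ _⟩
  | mul a b _ _ ha hb =>
    obtain ⟨P, rfl⟩ := ha
    obtain ⟨Q, rfl⟩ := hb
    exact ⟨P * Q, eval₂_mul _ _⟩

/-- Divide each exponent by p: the quotient is absorbed into the p-th power coefficient and the
remainder is the exponent β. -/
lemma exists_sum_pow_mul [CharP B p] (P : MvPolynomial (Fin n) B) :
    ∃ c : (Fin n → Fin p) → B, eval₂ (frobenius B p) x P = ∑ β, c β ^ p * ∏ j, x j ^ (β j : ℕ) := by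
  have : ExpChar B p := .prime Fact.out
  induction P using MvPolynomial.induction_on' with
  | monomial m a =>
    refine ⟨Pi.single (fun j ↦ ⟨m j % p, Nat.mod_lt _ (Fact.out : p.Prime).pos⟩)
      (a * ∏ j, x j ^ (m j / p)), ?_⟩
    rw [Finset.sum_eq_single (fun j ↦ ⟨m j % p, Nat.mod_lt _ (Fact.out : p.Prime).pos⟩)]
    · rw [eval₂_monomial, Pi.single_eq_same, mul_pow, ← Finset.prod_pow, frobenius_def,
        Finsupp.prod_fintype _ _ (by simp), mul_assoc, ← Finset.prod_mul_distrib]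
      congr 1
      refine Finset.prod_congr rfl fun j _ ↦ ?_
      rw [← pow_mul, ← pow_add, Nat.div_add_mod']
    · intro β _ hβ
      rw [Pi.single_eq_of_ne hβ, zero_pow (Fact.out : p.Prime).ne_zero, zero_mul]
    · simp
  | add P Q hP hQ =>
    obtain ⟨c, hc⟩ := hP
    obtain ⟨c', hc'⟩ := hQ
    refine ⟨c + c', ?_⟩
    rw [eval₂_add, hc, hc', ← Finset.sum_add_distrib]
    refine Finset.sum_congr rfl fun β _ ↦ ?_
    rw [Pi.add_apply, add_pow_char, add_mul]

/-- The sum is the value at `x`, with coefficients twisted by Frobenius, of a polynomial with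
exponents less than p. Derivations kill p-th powers and Frobenius is injective on a reduced ring, so
`eq_zero_of_eval₂_eq_zero` applies. -/
lemma eq_zero_of_sum_pow_mul [CharP B p] [IsReduced B] (D : Fin n → Derivation k B B)
    (hx : ∀ j i, D j (x i) = if i = j then 1 else 0) (c : (Fin n → Fin p) → B)
    (hc : ∑ β, c β ^ p * ∏ j, x j ^ (β j : ℕ) = 0) (β : Fin n → Fin p) : c β = 0 := by
  classical
  have : ExpChar B p := .prime Fact.out
  let e : (Fin n → Fin p) → (Fin n →₀ ℕ) := fun β ↦ Finsupp.equivFunOnFinite.symm fun j ↦ β j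
  have he : Function.Injective e := fun β γ h ↦ funext fun j ↦ Fin.ext (DFunLike.congr_fun h j)
  have hcoeff : ∀ m, coeff m (∑ β, monomial (e β) (c β)) = ∑ β, if e β = m then c β else 0 := by
    intro m
    simp only [coeff_sum, coeff_monomial]
  have h := eq_zero_of_eval₂_eq_zero p (frobenius B p) (frobenius_inj B p) D
    (fun j r ↦ by
      rw [frobenius_def, Derivation.leibniz_pow, ← Nat.cast_smul_eq_nsmul B, CharP.cast_eq_zero, zero_smul]) hx
    (∑ β, monomial (e β) (c β)) (fun m hm j ↦ by
      rw [hcoeff] at hm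
      obtain ⟨β, -, hβ⟩ := Finset.exists_ne_zero_of_sum_ne_zero hm
      obtain rfl : e β = m := by
        by_contra h
        exact hβ (if_neg h)
      exact (β j).2) (by
      rw [← hc, eval₂_sum]
      refine Finset.sum_congr rfl fun β _ ↦ ?_
      rw [eval₂_monomial, Finsupp.prod_fintype _ _ (by simp), frobenius_def]
      rfl)
  have h2 := hcoeff (e β)
  rw [h, coeff_zero] at h2
  rw [h2, Finset.sum_eq_single β (fun γ _ hγ ↦ if_neg fun h ↦ hγ (he h)) (by simp), if_pos rfl]

lemma exists_dual_derivations (ω : Module.Basis (Fin n) B (Ω[B⁄k]))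
    (hω : ∀ j, ω j = KaehlerDifferential.D k B (x j)) :
    ∃ D : Fin n → Derivation k B B, ∀ j i, D j (x i) = if i = j then 1 else 0 :=
  ⟨fun j ↦ (ω.coord j).compDer (KaehlerDifferential.D k B), fun j i ↦ by
    change ω.coord j (KaehlerDifferential.D k B (x i)) = _
    rw [← hω, Module.Basis.coord_apply, Module.Basis.repr_self, Finsupp.single_apply]⟩

/-- The monomials in the coordinates with exponents less than `p` form a `p`-basis. -/
lemma existsUnique_sum_pow_mul [CharP k p] [PerfectRing k p] [CharP B p] [IsReduced B]
    [Algebra.FiniteType k B] (ω : Module.Basis (Fin n) B (Ω[B⁄k]))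
    (hω : ∀ j, ω j = KaehlerDifferential.D k B (x j)) :
    (∀ b, ∃ c : (Fin n → Fin p) → B, b = ∑ β, c β ^ p * ∏ j, x j ^ (β j : ℕ)) ∧
    ∀ c : (Fin n → Fin p) → B, ∑ β, c β ^ p * ∏ j, x j ^ (β j : ℕ) = 0 → ∀ β, c β = 0 := by
  constructor
  · intro b
    obtain ⟨P, rfl⟩ := exists_eval₂_frobenius (x := x) p (by
      rw [← ω.span_eq]
      exact congrArg (fun z ↦ Submodule.span B (Set.range z)) (funext fun j ↦ (hω j).symm)) b
    exact exists_sum_pow_mul p P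
  · obtain ⟨D, hD⟩ := exists_dual_derivations ω hω
    exact fun c hc β ↦ eq_zero_of_sum_pow_mul p D hD c hc β

lemma le_ringKrullDim [CharP k p] [PerfectRing k p] [IsDomain B]
    [Algebra.FiniteType k B] (ω : Module.Basis (Fin n) B (Ω[B⁄k]))
    (hω : ∀ j, ω j = KaehlerDifferential.D k B (x j)) : (n : WithBot ℕ∞) ≤ ringKrullDim B := by
  obtain ⟨D, hD⟩ := exists_dual_derivations ω hω
  exact le_ringKrullDim_of_algebraicIndependent (algebraicIndependent_of_derivation p D hD)

end

end Coordinates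

/-! ### Étale coordinates on a smooth scheme -/

section SmoothCoordinates
open scoped TensorProduct

/-- In a submersive presentation the differentials of the variables not matched with a relation form
a basis of Ω; these variables are the coordinates. -/
lemma exists_basis_differentials (R B : Type*) [CommRing R] [CommRing B] [Algebra R B]
    [h : Algebra.IsStandardSmooth R B] :
    ∃ (n : ℕ) (x : Fin n → B) (ω : Module.Basis (Fin n) B (Ω[B⁄R])),
      ∀ j, ω j = KaehlerDifferential.D R B (x j) := by
  obtain ⟨ι, σ, _, _, ⟨P⟩⟩ := h.out
  let e := Finite.equivFin ((Set.range P.map)ᶜ : Set ι)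
  refine ⟨_, fun j ↦ P.val (e.symm j), P.basisKaehler.reindex e, fun j ↦ ?_⟩
  rw [Module.Basis.reindex_apply, P.basisKaehler_apply]

lemma exists_basis_differentials_localization {R B : Type*} (B' : Type*) [CommRing R] [CommRing B]
    [CommRing B'] [Algebra R B] [Algebra B B'] [Algebra R B'] [IsScalarTower R B B'] (g : B)
    [IsLocalization.Away g B'] {n : ℕ} {x : Fin n → B} (ω : Module.Basis (Fin n) B (Ω[B⁄R]))
    (hω : ∀ j, ω j = KaehlerDifferential.D R B (x j)) :
    ∃ ω' : Module.Basis (Fin n) B' (Ω[B'⁄R]),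
      ∀ j, ω' j = KaehlerDifferential.D R B' (algebraMap B B' (x j)) :=
  ⟨ω.ofIsLocalizedModule B' (Submonoid.powers g) (KaehlerDifferential.map R R B B'), fun j ↦ by
    rw [Module.Basis.ofIsLocalizedModule_apply, hω, KaehlerDifferential.map_D]⟩

variable {X : Scheme.{u}}

/-- The structure map `k ⟶ 𝒪_X(U)` of a scheme over `k`. -/
abbrev constHom {k : CommRingCat.{u}} (f : X ⟶ Spec k) (U : X.Opens) : k →+* Γ(X, U) :=
  ((constToPresheaf f).app (op U)).hom

lemma rres_constHom {k : CommRingCat.{u}} (f : X ⟶ Spec k) {U V : X.Opens} (h : V ≤ U) :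
    (rres h).comp (constHom f U) = constHom f V := by
  have := (constToPresheaf f).naturality (homOfLE h).op
  exact congrArg CommRingCat.Hom.hom (this.symm.trans (Category.id_comp _))

variable {k : Type u} [Field k] (f : X ⟶ Spec (.of k))

lemma exists_isStandardSmooth_constHom [Smooth f] (x : X) :
    ∃ V : X.Opens, IsAffineOpen V ∧ x ∈ V ∧ (constHom f V).IsStandardSmooth := by
  obtain ⟨U, hU, V, hV, hx, e, h⟩ := Smooth.exists_isStandardSmooth f x
  -- Spec of a field is a single point, so the affine open of the base supplied by smoothness is
  -- everything.
  have hU : U = ⊤ := by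
    refine top_le_iff.mp fun y _ ↦ ?_
    have : Subsingleton (Spec (.of k)) := inferInstanceAs (Subsingleton (PrimeSpectrum k))
    rw [Subsingleton.elim y (f x)]
    exact e hx
  subst hU
  refine ⟨V, hV, hx, ?_⟩
  have := RingHom.isStandardSmooth_respectsIso.2 _ (Scheme.ΓSpecIso (.of k)).symm.commRingCatIsoToRingEquiv h
  exact this

/-- `x` is a system of étale coordinates on `U`: their differentials form a frame of `Ω`, and the
monomials with exponents less than `p` are locally a `p`-basis of the structure sheaf. -/
structure IsCoordinates (p : ℕ) (f : X ⟶ Spec (.of k)) (U : X.Opens) {n : ℕ}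
    (x : Fin n → Γ(X, U)) : Prop where
  frame : IsFrame (Omega f) U Finset.univ fun j ↦ dd f U (x j)
  basis (V : X.Opens) (h : V ≤ U) (y : X) (hy : y ∈ V) : ∃ (W : X.Opens) (hW : W ≤ V), y ∈ W ∧
    (∀ b : Γ(X, W), ∃ c : (Fin n → Fin p) → Γ(X, W),
      b = ∑ β, c β ^ p * ∏ j, rres (hW.trans h) (x j) ^ (β j : ℕ)) ∧
    ∀ c : (Fin n → Fin p) → Γ(X, W),
      ∑ β, c β ^ p * ∏ j, rres (hW.trans h) (x j) ^ (β j : ℕ) = 0 → ∀ β, c β = 0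

lemma ringKrullDim_le_topologicalKrullDim {V : X.Opens} (hV : IsAffineOpen V) :
    ringKrullDim Γ(X, V) ≤ topologicalKrullDim X := by
  rw [← PrimeSpectrum.topologicalKrullDim_eq_ringKrullDim Γ(X, V)]
  change topologicalKrullDim (Spec Γ(X, V)) ≤ _
  rw [← IsHomeomorph.topologicalKrullDim_eq _ hV.isoSpec.hom.homeomorph.isHomeomorph]
  exact topologicalKrullDim_subspace_le X V

/-- A standard smooth affine neighbourhood has coordinates whose differentials are a basis. They
remain so on the nonempty basic opens, a basis of the topology of the neighbourhood, and the
ring-theoretic statements are applied there. Integrality of `X` makes these rings domains, hence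
reduced. -/
lemma exists_isCoordinates [IsAlgClosed k] (p : ℕ) [Fact p.Prime] [CharP k p] [IsIntegral X]
    [Smooth f] (x : X) :
    ∃ U : X.Opens, x ∈ U ∧ ∃ (n : ℕ) (t : Fin n → Γ(X, U)), IsCoordinates p f U t ∧
      n ≤ topologicalKrullDim X := by
  obtain ⟨V, hV, hx, hφ⟩ := exists_isStandardSmooth_constHom f x
  algebraize [constHom f V]
  obtain ⟨n, t, ω, hω⟩ := exists_basis_differentials k Γ(X, V)
  have key : ∀ g : Γ(X, V), ∀ y ∈ X.basicOpen g,
      letI := (constHom f (X.basicOpen g)).toAlgebra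
      IsDomain Γ(X, X.basicOpen g) ∧ CharP Γ(X, X.basicOpen g) p ∧
      Algebra.FiniteType k Γ(X, X.basicOpen g) ∧
      ∃ ω' : Module.Basis (Fin n) Γ(X, X.basicOpen g) (Ω[Γ(X, X.basicOpen g)⁄k]),
        ∀ j, ω' j = KaehlerDifferential.D k Γ(X, X.basicOpen g) (rres (X.basicOpen_le g) (t j)) := by
    intro g y hy
    let := (constHom f (X.basicOpen g)).toAlgebra
    let := (rres (X.basicOpen_le g)).toAlgebra
    have : IsScalarTower k Γ(X, V) Γ(X, X.basicOpen g) := .of_algebraMap_eq' (rres_constHom f _).symm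
    have : IsLocalization.Away g Γ(X, X.basicOpen g) := hV.isLocalization_basicOpen g
    have : Nonempty (X.basicOpen g) := ⟨⟨y, hy⟩⟩
    have : Algebra.FiniteType Γ(X, V) Γ(X, X.basicOpen g) :=
      have := IsLocalization.Away.finitePresentation (S := Γ(X, X.basicOpen g)) g
      inferInstance
    refine ⟨inferInstance, charP_of_injective_algebraMap (algebraMap k _).injective p, .trans (S := Γ(X, V)) inferInstance inferInstance, ?_⟩
    exact exists_basis_differentials_localization Γ(X, X.basicOpen g) g ω hω
  refine ⟨V, hx, n, t, ⟨?_, ?_⟩, ?_⟩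
  · refine isFrame_shf (preOmega f) Finset.univ
      (fun j ↦ (CommRingCat.KaehlerDifferential.d (f := (constToPresheaf f).app (op V)) (t j) :)) ?_
    intro W hW y hy
    obtain ⟨g, hg, hyg⟩ := hV.exists_basicOpen_le ⟨y, hy⟩ (hW hy)
    refine ⟨X.basicOpen g, hg, X.basicOpen_le g, hyg, ?_⟩
    let := (constHom f (X.basicOpen g)).toAlgebra
    obtain ⟨_, _, _, ω', hω'⟩ := key g y hyg
    have hsum : ∀ c : Fin n → Γ(X, X.basicOpen g), ∑ j, c j • ω' j =
        ∑ j, c j • pres (P := preOmega f) (X.basicOpen_le g)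
          (CommRingCat.KaehlerDifferential.d (f := (constToPresheaf f).app (op V)) (t j)) := by
      intro c
      refine Finset.sum_congr rfl fun j _ ↦ congrArg (fun z ↦ c j • z) ((hω' j).trans ?_)
      exact (PresheafOfModules.DifferentialsConstruction.relativeDifferentials'_map_d
        (constToPresheaf f) (homOfLE (X.basicOpen_le g)).op (t j)).symm
    refine ⟨fun s ↦ ?_, fun c hc ↦ ?_⟩
    · exact ⟨ω'.repr s, (ω'.sum_repr s).symm.trans (hsum _)⟩
    · exact fun j _ ↦ Fintype.linearIndependent_iff.mp ω'.linearIndependent c ((hsum c).trans hc) j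
  · intro W hW y hy
    obtain ⟨g, hg, hyg⟩ := hV.exists_basicOpen_le ⟨y, hy⟩ (hW hy)
    refine ⟨X.basicOpen g, hg, hyg, ?_⟩
    let := (constHom f (X.basicOpen g)).toAlgebra
    obtain ⟨_, _, _, ω', hω'⟩ := key g y hyg
    exact existsUnique_sum_pow_mul p ω' hω'
  · have : Nonempty V := ⟨⟨x, hx⟩⟩
    exact (le_ringKrullDim p ω hω).trans (ringKrullDim_le_topologicalKrullDim hV)

end SmoothCoordinates

/-! ### Frames adapted to a filtration defined by a connection -/

section Adapted

variable {X : Scheme.{u}} {M N : X.Modules} {U V : X.Opens}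

lemma tmul_smul (r : Γ(X, U)) (s : Γ(M, U)) (t : Γ(N, U)) : tmul s (r • t) = r • tmul s t := by
  rw [← smul_tmul, smul_tmul']

lemma sum_smul_tmul {B : Type*} (S : Finset B) (c : B → Γ(X, U)) (s : B → Γ(M, U)) (t : Γ(N, U)) :
    tmul (∑ b ∈ S, c b • s b) t = ∑ b ∈ S, c b • tmul (s b) t := by
  let g : Γ(M, U) →+ Γ(tens M N, U) := AddMonoidHom.mk' (fun s ↦ tmul s t) fun s s' ↦ add_tmul s s' t
  refine (map_sum g _ S).trans (Finset.sum_congr rfl fun b _ ↦ smul_tmul' _ _ _)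

open Classical in
/-- A preimage of a section under a morphism, or `0` if there is none. -/
def liftSec (φ : M ⟶ N) (s : Γ(N, U)) : Γ(M, U) := if h : ∃ t, φ.app U t = s then h.choose else 0

lemma app_liftSec (φ : M ⟶ N) {s : Γ(N, U)} (h : ∃ t, φ.app U t = s) : φ.app U (liftSec φ s) = s := by
  rw [liftSec, dif_pos h]
  exact h.choose_spec

/-- The elements of degree at least `i`. -/
def degGE {A : Type*} [Fintype A] (deg : A → ℕ) (i : ℕ) : Finset A :=
  Finset.univ.filter fun a ↦ i ≤ deg a

lemma mem_degGE {A : Type*} [Fintype A] {deg : A → ℕ} {i : ℕ} {a : A} :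
    a ∈ degGE deg i ↔ i ≤ deg a := by simp [degGE]

lemma degGE_subset {A : Type*} [Fintype A] (deg : A → ℕ) {i j : ℕ} (h : i ≤ j) :
    degGE deg j ⊆ degGE deg i := fun _ ha ↦ mem_degGE.mpr (h.trans (mem_degGE.mp ha))

/-- The elements of degree `i`. -/
def degEQ {A : Type*} [Fintype A] (deg : A → ℕ) (i : ℕ) : Finset A :=
  Finset.univ.filter fun a ↦ deg a = i

lemma mem_degEQ {A : Type*} [Fintype A] {deg : A → ℕ} {i : ℕ} {a : A} :
    a ∈ degEQ deg i ↔ deg a = i := by simp [degEQ]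

variable {k : CommRingCat.{u}} {f : X ⟶ Spec k} {W W₁ : X.Modules}

lemma secondForm_app (D : Connection f W) {W' : X.Modules} (ι : W' ⟶ W) (s : Γ(W', U)) :
    (secondForm D ι).app U s =
      (tensHom (cokernel.π ι) (𝟙 (Omega f))).app U (D.nabla U (ι.app U s)) := rfl

/-- A graded frame of `W` on which the connection `D` acts by lowering the degree, and for which
the elements of positive degree form a frame of `W₁`. -/
structure IsAdapted (D : Connection f W) (ι : W₁ ⟶ W) {A : Type*} [Fintype A] {m : ℕ}
    (w : A → Γ(W, U)) (ω : Fin m → Γ(Omega f, U)) (deg : A → ℕ) (lower : A → Fin m → A)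
    (coef : A → Fin m → Γ(X, U)) : Prop where
  nontrivial : Nontrivial Γ(X, U)
  frame : IsFrame W U Finset.univ w
  omega : IsFrame (Omega f) U Finset.univ ω
  nabla (a : A) : D.nabla U (w a) = ∑ j, coef a j • tmul (w (lower a j)) (ω j)
  deg_lower (a : A) (j : Fin m) : coef a j ≠ 0 → deg (lower a j) + 1 = deg a
  lower_inj (a a' : A) (j : Fin m) : coef a j ≠ 0 → coef a' j ≠ 0 → lower a j = lower a' j → a = a'
  exists_isUnit (a : A) : deg a ≠ 0 → ∃ j, IsUnit (coef a j)
  exists_lift (a : A) : 1 ≤ deg a → ∃ t, ι.app U t = w a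
  coeff_eq_zero (V : X.Opens) (h : V ≤ U) (t : Γ(W₁, V)) (c : A → Γ(X, V)) :
    ι.app V t = ∑ a, c a • res h (w a) → ∀ a, deg a < 1 → c a = 0

instance mono_filtration_hom (D : Connection f W) (ι : W₁ ⟶ W) [Mono ι] (i : ℕ) :
    Mono (filtration D ι i).hom := by
  match i with
  | 0 => exact inferInstanceAs (Mono (𝟙 W))
  | 1 => exact ‹Mono ι›
  | i + 2 =>
    have := mono_filtration_hom D ι (i + 1)
    exact inferInstanceAs (Mono (kernel.ι (secondForm D (filtration D ι (i + 1)).hom) ≫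
      (filtration D ι (i + 1)).hom))

instance mono_filtrationStep (D : Connection f W) (ι : W₁ ⟶ W) [Mono ι] (i : ℕ) :
    Mono (filtrationStep D ι i) := by
  have : Mono (filtrationStep D ι i ≫ (filtration D ι i).hom) := by
    rw [filtrationStep_hom]
    infer_instance
  exact mono_of_mono _ (filtration D ι i).hom

/-- The lift to the `i`-th term of the filtration of a section of `W`. -/
abbrev filLift (D : Connection f W) (ι : W₁ ⟶ W) (i : ℕ) (s : Γ(W, U)) :
    Γ((filtration D ι i).left, U) := liftSec (filtration D ι i).hom s

/-- The class in the graded piece of a section of `W`. -/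
abbrev grClass (D : Connection f W) (ι : W₁ ⟶ W) (i : ℕ) (s : Γ(W, U)) :
    Γ(graded D ι i, U) := (cokernel.π (filtrationStep D ι i)).app U (filLift D ι i s)

lemma IsAdapted.tensHom_nabla {D : Connection f W} {ι : W₁ ⟶ W} {A : Type*} [Fintype A] {m : ℕ}
    {w : A → Γ(W, U)} {ω : Fin m → Γ(Omega f, U)} {deg : A → ℕ} {lower : A → Fin m → A}
    {coef : A → Fin m → Γ(X, U)} (H : IsAdapted D ι w ω deg lower coef) {Q : X.Modules} (q : W ⟶ Q) (a : A) :
    (tensHom q (𝟙 (Omega f))).app U (D.nabla U (w a)) =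
      ∑ j, coef a j • tmul (q.app U (w (lower a j))) (ω j) := by
  rw [H.nabla, app_sum]
  refine Finset.sum_congr rfl fun j _ ↦ ?_
  rw [Scheme.Modules.Hom.app_smul, tensHom_app_tmul]
  rfl

namespace IsAdapted

variable {D : Connection f W} {ι : W₁ ⟶ W} [Mono ι] {A : Type*} [Fintype A] [DecidableEq A] {m : ℕ}
  {w : A → Γ(W, U)} {ω : Fin m → Γ(Omega f, U)} {deg : A → ℕ} {lower : A → Fin m → A}
  {coef : A → Fin m → Γ(X, U)} (H : IsAdapted D ι w ω deg lower coef)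

include H

lemma isFrame_of_lift (i : ℕ) (h1 : ∀ a, i ≤ deg a → ∃ t, (filtration D ι i).hom.app U t = w a)
    (h2 : ∀ (V : X.Opens) (h : V ≤ U) (t : Γ((filtration D ι i).left, V)) (c : A → Γ(X, V)),
      (filtration D ι i).hom.app V t = ∑ a, c a • res h (w a) → ∀ a, deg a < i → c a = 0) :
    IsFrame (filtration D ι i).left U (degGE deg i) fun a ↦ filLift D ι i (w a) :=
  isFrame_sub (Finset.subset_univ _) H.frame (fun a ha ↦ app_liftSec _ (h1 a (mem_degGE.mp ha)))
    fun V h t c e a _ ha ↦ h2 V h t c e a (by rwa [mem_degGE, not_le] at ha)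

/-- Together the two halves say that W_i is free on the `w a` with `deg a ≥ i` (`isFrame_of_lift`).
Passing to the next term: the form kills `w a` of higher degree because it lowers the degree by one
only, and it separates the elements of exact degree since their lowerings have unit coefficients and
do not collide. -/
lemma lift_and_coeff (i : ℕ) : (∀ a, i ≤ deg a → ∃ t, (filtration D ι i).hom.app U t = w a) ∧
    ∀ (V : X.Opens) (h : V ≤ U) (t : Γ((filtration D ι i).left, V)) (c : A → Γ(X, V)),
      (filtration D ι i).hom.app V t = ∑ a, c a • res h (w a) → ∀ a, deg a < i → c a = 0 := by
  match i with
  | 0 => exact ⟨fun a _ ↦ ⟨w a, rfl⟩, fun _ _ _ _ _ a ha ↦ absurd ha (Nat.not_lt_zero _)⟩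
  | 1 => exact ⟨H.exists_lift, H.coeff_eq_zero⟩
  | i + 2 =>
    obtain ⟨h1, h2⟩ := lift_and_coeff (i + 1)
    have hF := H.isFrame_of_lift (i + 1) h1 h2
    have hQ := isFrame_cokernel (Finset.subset_univ _) H.frame hF
      fun a ha ↦ app_liftSec _ (h1 a (mem_degGE.mp ha))
    have hπ : ∀ a, i + 1 ≤ deg a → (cokernel.π (filtration D ι (i + 1)).hom).app U (w a) = 0 := by
      intro a ha
      obtain ⟨t, ht⟩ := h1 a ha
      rw [← ht]
      exact app_eq_zero_of_comp (cokernel.condition _) t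
    have hform : ∀ a, i + 1 ≤ deg a →
        (secondForm D (filtration D ι (i + 1)).hom).app U (filLift D ι (i + 1) (w a)) =
        ∑ j, coef a j • tmul ((cokernel.π (filtration D ι (i + 1)).hom).app U (w (lower a j))) (ω j) := by
      intro a ha
      rw [secondForm_app, app_liftSec _ (h1 a ha), H.tensHom_nabla]
    constructor
    · intro a ha
      obtain ⟨t, ht⟩ := exists_of_kernel (secondForm D (filtration D ι (i + 1)).hom)
        (filLift D ι (i + 1) (w a)) (by
          rw [hform a (by omega)]
          refine Finset.sum_eq_zero fun j _ ↦ ?_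
          by_cases hc : coef a j = 0
          · rw [hc, zero_smul]
          · rw [hπ _ (by have := H.deg_lower a j hc; omega), zero_tmul, smul_zero])
      refine ⟨t, ?_⟩
      refine Eq.trans ?_ (app_liftSec _ (h1 a (by omega)))
      exact congrArg ((filtration D ι (i + 1)).hom.app U) ht
    · intro V h t c e
      let t' : Γ((filtration D ι (i + 1)).left, V) :=
        (kernel.ι (secondForm D (filtration D ι (i + 1)).hom)).app V t
      have e' : (filtration D ι (i + 1)).hom.app V t' = ∑ a, c a • res h (w a) := e
      have hlow := h2 V h t' c e'
      have ht' : t' = ∑ a ∈ degGE deg (i + 1), c a • res h (filLift D ι (i + 1) (w a)) := by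
        apply app_injective (filtration D ι (i + 1)).hom V
        rw [e', app_sum_smul]
        refine (Finset.sum_subset (Finset.subset_univ _) fun a _ ha ↦ ?_).symm.trans
          (Finset.sum_congr rfl fun a ha ↦ ?_)
        · rw [hlow a (by rwa [mem_degGE, not_le] at ha), zero_smul]
        · rw [app_liftSec _ (h1 a (mem_degGE.mp ha))]
      have hz : (secondForm D (filtration D ι (i + 1)).hom).app V t' = 0 :=
        app_eq_zero_of_comp (kernel.condition _) t
      -- The coordinates of the form of `t'` in the frame [w b] ⊗ ω_j of (W / W_{i+1}) ⊗ Ω. Pairs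
      -- with `deg b ≥ i + 1` contribute nothing, since those classes vanish in the quotient.
      let z : A × Fin m → Γ(X, V) := fun b ↦
        ∑ a ∈ degGE deg (i + 1), if lower a b.2 = b.1 then c a * rres h (coef a b.2) else 0
      have hz' : ∑ b ∈ (Finset.univ \ degGE deg (i + 1)) ×ˢ Finset.univ, z b • res h
          (tmul ((cokernel.π (filtration D ι (i + 1)).hom).app U (w b.1)) (ω b.2)) = 0 := by
        rw [← hz, ht', app_sum_smul]
        rw [Finset.sum_subset (Finset.subset_univ _) (fun b _ hb ↦ ?_)]
        · have hr : ∀ a ∈ degGE deg (i + 1), c a • res h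
              ((secondForm D (filtration D ι (i + 1)).hom).app U (filLift D ι (i + 1) (w a))) =
              ∑ b : A × Fin m, (if lower a b.2 = b.1 then c a * rres h (coef a b.2) else 0) • res h
                (tmul ((cokernel.π (filtration D ι (i + 1)).hom).app U (w b.1)) (ω b.2)) := by
            intro a ha
            rw [hform a (mem_degGE.mp ha), res_sum, Finset.smul_sum, Fintype.sum_prod_type_right]
            refine Finset.sum_congr rfl fun j _ ↦ ?_
            simp only [ite_smul, zero_smul]
            rw [Finset.sum_ite_eq, if_pos (Finset.mem_univ _), mul_smul]
          rw [Finset.sum_congr rfl hr, Finset.sum_comm]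
          exact Finset.sum_congr rfl fun b _ ↦ Finset.sum_smul
        · rw [hπ b.1 (by simpa [mem_degGE] using hb), zero_tmul, map_zero, smul_zero]
      have hzero := (hQ.tmul H.omega).ind V h z hz'
      intro a ha
      by_cases hai : deg a < i + 1
      · exact hlow a hai
      -- Here `deg a` is exactly `i + 1`. In a direction `j` with unit coefficient, `lower_inj`
      -- leaves `a` as the only contributor to the coordinate at `(lower a j, j)`, so `c a` times a
      -- unit is zero.
      obtain ⟨j, hj⟩ := H.exists_isUnit a (by omega)
      have := H.nontrivial
      have hne := hj.ne_zero
      have hd := H.deg_lower a j hne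
      have h0 := hzero (lower a j, j) (by simp [mem_degGE]; omega)
      have h3 : z (lower a j, j) = c a * rres h (coef a j) := by
        refine (Finset.sum_eq_single a (fun a' _ hne' ↦ ?_) (fun hn ↦ ?_)).trans (if_pos rfl)
        · by_cases hl : lower a' j = lower a j
          · have : coef a' j = 0 := by
              by_contra hc
              exact hne' (H.lower_inj a' a j hc hne hl)
            simp [this]
          · exact if_neg hl
        · exact absurd (mem_degGE.mpr (by omega)) hn
      rw [h3] at h0
      exact (hj.map (rres h)).mul_left_eq_zero.mp h0

lemma hom_filLift {i : ℕ} {a : A} (ha : i ≤ deg a) :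
    (filtration D ι i).hom.app U (filLift D ι i (w a)) = w a :=
  app_liftSec _ ((H.lift_and_coeff i).1 a ha)

lemma isFrame_filtration (i : ℕ) :
    IsFrame (filtration D ι i).left U (degGE deg i) fun a ↦ filLift D ι i (w a) :=
  H.isFrame_of_lift i (H.lift_and_coeff i).1 (H.lift_and_coeff i).2

lemma isFrame_quotient (i : ℕ) : IsFrame (cokernel (filtration D ι i).hom) U
    (Finset.univ \ degGE deg i) fun a ↦ (cokernel.π (filtration D ι i).hom).app U (w a) :=
  isFrame_cokernel (Finset.subset_univ _) H.frame (H.isFrame_filtration i)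
    fun _ ha ↦ H.hom_filLift (mem_degGE.mp ha)

lemma quotient_eq_zero {i : ℕ} {a : A} (ha : i ≤ deg a) :
    (cokernel.π (filtration D ι i).hom).app U (w a) = 0 := by
  rw [← H.hom_filLift ha]
  exact app_eq_zero_of_comp (cokernel.condition _) _

lemma filtrationStep_filLift {i : ℕ} {a : A} (ha : i + 1 ≤ deg a) :
    (filtrationStep D ι i).app U (filLift D ι (i + 1) (w a)) = filLift D ι i (w a) := by
  apply app_injective (filtration D ι i).hom U
  rw [H.hom_filLift (by omega), ← app_comp, filtrationStep_hom, H.hom_filLift ha]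

lemma isFrame_graded (i : ℕ) :
    IsFrame (graded D ι i) U (degEQ deg i) fun a ↦ grClass D ι i (w a) := by
  have h := isFrame_cokernel (degGE_subset deg (Nat.le_succ i)) (H.isFrame_filtration i)
    (H.isFrame_filtration (i + 1)) fun a ha ↦ H.filtrationStep_filLift (mem_degGE.mp ha)
  have hS : degGE deg i \ degGE deg i.succ = degEQ deg i := by
    ext a
    rw [Finset.mem_sdiff, mem_degGE, mem_degGE, mem_degEQ]
    omega
  rwa [hS] at h

lemma gradedIncl_grClass {i : ℕ} {a : A} (ha : i ≤ deg a) :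
    (gradedIncl D ι i).app U (grClass D ι i (w a)) =
      (cokernel.π (filtration D ι (i + 1)).hom).app U (w a) := by
  have h : cokernel.π (filtrationStep D ι i) ≫ gradedIncl D ι i =
      (filtration D ι i).hom ≫ cokernel.π (filtration D ι (i + 1)).hom :=
    cokernel.π_desc _ _ _
  refine congr(($h).app U (filLift D ι i (w a))).trans ?_
  rw [app_comp, H.hom_filLift ha]

/-- The classes of degree `i` are part of the frame of W / W_{i+1}, and this remains so after
tensoring with a frame of Ω. This injectivity makes the induced form unique. -/
lemma tensHom_gradedIncl_eq_zero (i : ℕ) (h : V ≤ U) (s : Γ(tens (graded D ι i) (Omega f), V))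
    (hs : (tensHom (gradedIncl D ι i) (𝟙 (Omega f))).app V s = 0) : s = 0 := by
  refine ((H.isFrame_graded i).tmul H.omega).app_eq_zero ?_ h s hs
  refine IsIndep.congr (isIndep_of_subset (S := (Finset.univ \ degGE deg (i + 1)) ×ˢ Finset.univ) ?_
    ((H.isFrame_quotient (i + 1)).tmul H.omega).ind) fun a ha ↦ ?_
  · refine Finset.product_subset_product_left fun a ha ↦ ?_
    rw [mem_degEQ] at ha
    rw [Finset.mem_sdiff, mem_degGE]
    exact ⟨Finset.mem_univ _, by omega⟩
  · rw [Finset.mem_product, mem_degEQ] at ha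
    rw [tensHom_app_tmul, H.gradedIncl_grClass ha.1.ge]
    rfl

lemma secondForm_filLift {i : ℕ} {a : A} (ha : i ≤ deg a) :
    (secondForm D (filtration D ι i).hom).app U (filLift D ι i (w a)) =
      ∑ j, coef a j • tmul ((cokernel.π (filtration D ι i).hom).app U (w (lower a j))) (ω j) := by
  rw [secondForm_app, H.hom_filLift ha, H.tensHom_nabla]

/-- The second fundamental form on the frame, as an element of the graded piece. -/
lemma tensHom_gradedIncl_sum {i : ℕ} {a : A} (ha : i + 1 ≤ deg a) :
    (tensHom (gradedIncl D ι i) (𝟙 (Omega f))).app U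
      (if deg a = i + 1 then ∑ j, coef a j • tmul (grClass D ι i (w (lower a j))) (ω j) else 0) =
    (secondForm D (filtration D ι (i + 1)).hom).app U (filLift D ι (i + 1) (w a)) := by
  rw [H.secondForm_filLift ha]
  split_ifs with hd
  · rw [app_sum]
    refine Finset.sum_congr rfl fun j _ ↦ ?_
    by_cases hc : coef a j = 0
    · rw [hc, zero_smul, zero_smul, map_zero]
    · rw [Scheme.Modules.Hom.app_smul, tensHom_app_tmul,
        H.gradedIncl_grClass (by have := H.deg_lower a j hc; omega)]
      rfl
  · rw [map_zero]
    refine (Finset.sum_eq_zero fun j _ ↦ ?_).symm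
    by_cases hc : coef a j = 0
    · rw [hc, zero_smul]
    · rw [H.quotient_eq_zero (by have := H.deg_lower a j hc; omega), zero_tmul, smul_zero]

end IsAdapted

/-- Adapted frames exist locally. -/
def IsLocallyAdapted (D : Connection f W) (ι : W₁ ⟶ W) : Prop :=
  ∀ x : X, ∃ U : X.Opens, x ∈ U ∧ ∃ (A : Type) (_ : Fintype A) (m : ℕ) (w : A → Γ(W, U))
    (ω : Fin m → Γ(Omega f, U)) (deg : A → ℕ) (lower : A → Fin m → A) (coef : A → Fin m → Γ(X, U)),
    IsAdapted D ι w ω deg lower coef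

variable {D : Connection f W} {ι : W₁ ⟶ W} [Mono ι]

namespace IsLocallyAdapted

variable (L : IsLocallyAdapted D ι)

include L

lemma isSubbundle_filtration (i : ℕ) : IsSubbundle (filtration D ι i).hom := by
  classical
  refine isSubbundle_of_frames fun x ↦ ?_
  obtain ⟨U, hx, A, _, m, w, ω, deg, lower, coef, H⟩ := L x
  exact ⟨U, hx, A, inferInstance, Finset.univ, degGE deg i, w, _, Finset.subset_univ _, H.frame,
    H.isFrame_filtration i, fun a ha ↦ H.hom_filLift (mem_degGE.mp ha)⟩

lemma mono_tensHom_gradedIncl (i : ℕ) : Mono (tensHom (gradedIncl D ι i) (𝟙 (Omega f))) := by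
  classical
  refine mono_of_local fun x ↦ ?_
  obtain ⟨U, hx, A, _, m, w, ω, deg, lower, coef, H⟩ := L x
  exact ⟨U, hx, fun V h s hs ↦ H.tensHom_gradedIncl_eq_zero i h s hs⟩

/-- On the frame, the form of W_{i+1} takes values in the graded piece tensored with Ω, so it
factors through that subobject. The factorization kills the kernel W_{i+2} of the form and descends
to the quotient; uniqueness comes from `mono_tensHom_gradedIncl`. -/
lemma existsUnique_isInduced (i : ℕ) : ∃! t, IsInduced D ι i t := by
  classical
  have := L.mono_tensHom_gradedIncl i
  obtain ⟨χ, hχ⟩ := exists_factor (secondForm D (filtration D ι (i + 1)).hom)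
    (tensHom (gradedIncl D ι i) (𝟙 (Omega f))) (by
      intro U s x hx
      obtain ⟨U', ⟨A, _, m, w, ω, deg, lower, coef, H⟩, V, hV, hV', hxV⟩ := exists_le_of_nhds L U x hx
      obtain ⟨c, hc⟩ := (H.isFrame_filtration (i + 1)).gen V hV' (res hV s)
      refine ⟨V, hV, hxV, ∑ a ∈ degGE deg (i + 1), c a • res hV' (if deg a = i + 1 then
        ∑ j, coef a j • tmul (grClass D ι i (w (lower a j))) (ω j) else 0), ?_⟩
      rw [hc, app_sum_smul, app_sum_smul]
      exact Finset.sum_congr rfl fun a ha ↦ by rw [H.tensHom_gradedIncl_sum (mem_degGE.mp ha)])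
  have hz : filtrationStep D ι (i + 1) ≫ χ = 0 := by
    rw [← cancel_mono (tensHom (gradedIncl D ι i) (𝟙 (Omega f))), Category.assoc, hχ, zero_comp]
    exact kernel.condition _
  refine ⟨cokernel.desc _ χ hz, ?_, fun t ht ↦ ?_⟩
  · change cokernel.π _ ≫ cokernel.desc _ χ hz ≫ _ = _
    rw [cokernel.π_desc_assoc, hχ]
  · have h1 : cokernel.π (filtrationStep D ι (i + 1)) ≫ t = χ :=
      (cancel_mono (tensHom (gradedIncl D ι i) (𝟙 (Omega f)))).mp
        ((Category.assoc (cokernel.π _) t _).trans (ht.trans hχ.symm))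
    exact (cancel_epi (cokernel.π (filtrationStep D ι (i + 1)))).mp
      (h1.trans (cokernel.π_desc _ _ _).symm)

lemma isInduced_gradedForm (i : ℕ) : IsInduced D ι i (gradedForm D ι i) := by
  have h : ∃ t, IsInduced D ι i t := (L.existsUnique_isInduced i).exists
  rw [gradedForm, dif_pos h]
  exact h.choose_spec

variable {A : Type*} [Fintype A] {m : ℕ}
  {w : A → Γ(W, U)} {ω : Fin m → Γ(Omega f, U)} {deg : A → ℕ} {lower : A → Fin m → A}
  {coef : A → Fin m → Γ(X, U)} (H : IsAdapted D ι w ω deg lower coef)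

include H

lemma gradedForm_grClass {i : ℕ} {a : A} (ha : deg a = i + 1) :
    (gradedForm D ι i).app U (grClass D ι (i + 1) (w a)) =
      ∑ j, coef a j • tmul (grClass D ι i (w (lower a j))) (ω j) := by
  classical
  have := L.mono_tensHom_gradedIncl i
  apply app_injective (tensHom (gradedIncl D ι i) (𝟙 (Omega f))) U
  have h := H.tensHom_gradedIncl_sum ha.ge
  rw [if_pos ha] at h
  rw [h]
  exact congr(($(L.isInduced_gradedForm i)).app U (filLift D ι (i + 1) (w a)))

end IsLocallyAdapted

/-! ### The iterated forms -/

/-- The index set of the frame of `Ω^{⊗(n+1)}` given by a frame of `Ω` with `m` elements. -/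
def PowIdx (m : ℕ) : ℕ → Type
  | 0 => Fin m
  | n + 1 => PowIdx m n × Fin m

instance (m : ℕ) : ∀ n, Fintype (PowIdx m n)
  | 0 => inferInstanceAs (Fintype (Fin m))
  | n + 1 =>
    letI := instFintypePowIdx m n
    inferInstanceAs (Fintype (PowIdx m n × Fin m))

/-- The frame of `Ω^{⊗(n+1)}` given by a frame of `Ω`. -/
def powFrame {m : ℕ} (ω : Fin m → Γ(Omega f, U)) : ∀ n, PowIdx m n → Γ(omegaPow f n, U)
  | 0, j => ω j
  | n + 1, J => tmul (powFrame ω n J.1) (ω J.2)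

lemma isFrame_powFrame {m : ℕ} {ω : Fin m → Γ(Omega f, U)} (hω : IsFrame (Omega f) U Finset.univ ω) :
    ∀ n, IsFrame (omegaPow f n) U Finset.univ (powFrame ω n)
  | 0 => hω
  | n + 1 => (isFrame_powFrame hω n).tmul hω

/-- The element reached by lowering along a sequence of directions. -/
def pathEnd {A : Type*} {m : ℕ} (lower : A → Fin m → A) : ∀ n, A → PowIdx m n → A
  | 0, a, j => lower a j
  | n + 1, a, J => pathEnd lower n (lower a J.2) J.1

/-- The product of the coefficients along a sequence of directions. -/
def pathCoef {A R : Type*} [Mul R] {m : ℕ} (lower : A → Fin m → A) (coef : A → Fin m → R) :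
    ∀ n, A → PowIdx m n → R
  | 0, a, j => coef a j
  | n + 1, a, J => coef a J.2 * pathCoef lower coef n (lower a J.2) J.1

/-- Each application of the form branches over all directions, so iteration gives a sum over
sequences. The first direction taken is the last tensor factor, matching the left-nested recursion
of `omegaPow` and `PowIdx`. -/
lemma IsLocallyAdapted.iteratedForm_grClass (L : IsLocallyAdapted D ι) {A : Type*} [Fintype A] {m : ℕ}
    {w : A → Γ(W, U)} {ω : Fin m → Γ(Omega f, U)} {deg : A → ℕ} {lower : A → Fin m → A}
    {coef : A → Fin m → Γ(X, U)} (H : IsAdapted D ι w ω deg lower coef) (n : ℕ) {a : A}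
    (ha : deg a = n + 1) :
    (iteratedForm D ι n).app U (grClass D ι (n + 1) (w a)) =
      ∑ J, pathCoef lower coef n a J •
        tmul (grClass D ι 0 (w (pathEnd lower n a J))) (powFrame ω n J) := by
  induction n generalizing a with
  | zero => exact L.gradedForm_grClass H ha
  | succ n ih =>
    have hterm : ∀ j, (tensHom (iteratedForm D ι n) (𝟙 (Omega f)) ≫
        tensAssoc (graded D ι 0) (omegaPow f n) (Omega f)).app U
          (coef a j • tmul (grClass D ι (n + 1) (w (lower a j))) (ω j)) =
        ∑ J : PowIdx m n, (coef a j * pathCoef lower coef n (lower a j) J) •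
          tmul (M := graded D ι 0) (N := omegaPow f (n + 1)) (grClass D ι 0 (w (pathEnd lower n (lower a j) J)))
            (tmul (powFrame ω n J) (ω j)) := by
      intro j
      by_cases hc : coef a j = 0
      · simp only [hc, zero_smul, map_zero, zero_mul, Finset.sum_const_zero]
        rfl
      · have hd := H.deg_lower a j hc
        rw [app_comp, Scheme.Modules.Hom.app_smul, tensHom_app_tmul, ih (by omega),
          sum_smul_tmul, Scheme.Modules.Hom.app_smul, app_sum, Finset.smul_sum]
        refine Finset.sum_congr rfl fun J _ ↦ ?_
        rw [Scheme.Modules.Hom.app_smul, mul_smul]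
        exact congrArg (fun z ↦ coef a j • pathCoef lower coef n (lower a j) J • z)
          (tensAssoc_app_tmul _ _ _)
    have h1 : (iteratedForm D ι (n + 1)).app U (grClass D ι (n + 1 + 1) (w a)) =
        (tensHom (iteratedForm D ι n) (𝟙 (Omega f)) ≫
          tensAssoc (graded D ι 0) (omegaPow f n) (Omega f)).app U
          ((gradedForm D ι (n + 1)).app U (grClass D ι (n + 1 + 1) (w a))) := rfl
    rw [h1, L.gradedForm_grClass H ha, app_sum, Finset.sum_congr rfl fun j _ ↦ hterm j]
    exact (Fintype.sum_prod_type_right (γ := Γ(tens (graded D ι 0) (omegaPow f (n + 1)), U))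
      fun J : PowIdx m n × Fin m ↦ (coef a J.2 * pathCoef lower coef n (lower a J.2) J.1) •
        tmul (M := graded D ι 0) (N := omegaPow f (n + 1))
          (grClass D ι 0 (w (pathEnd lower n (lower a J.2) J.1)))
          (tmul (powFrame ω n J.1) (ω J.2))).symm

/-! ### Sequences of lowering directions -/

section Paths

variable {A R : Type*} [CommRing R] {m : ℕ} {lower : A → Fin m → A} {coef : A → Fin m → R} {deg : A → ℕ}

lemma deg_pathEnd (h : ∀ a j, coef a j ≠ 0 → deg (lower a j) + 1 = deg a) (n : ℕ) {a : A}
    {J : PowIdx m n} (hJ : pathCoef lower coef n a J ≠ 0) :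
    deg (pathEnd lower n a J) + (n + 1) = deg a := by
  induction n generalizing a with
  | zero => exact h a J hJ
  | succ n ih =>
    have h1 := h a J.2 (left_ne_zero_of_mul hJ)
    have h2 := ih (right_ne_zero_of_mul hJ)
    change deg (pathEnd lower n (lower a J.2) J.1) + (n + 1 + 1) = deg a
    omega

/-- Each lowering step is injective where its coefficient is nonzero, so the start can be recovered
from the end by retracing the directions. -/
lemma pathEnd_inj (h : ∀ a a' j, coef a j ≠ 0 → coef a' j ≠ 0 → lower a j = lower a' j → a = a')
    (n : ℕ) {a a' : A} {J : PowIdx m n} (hJ : pathCoef lower coef n a J ≠ 0)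
    (hJ' : pathCoef lower coef n a' J ≠ 0) (e : pathEnd lower n a J = pathEnd lower n a' J) :
    a = a' := by
  induction n generalizing a a' with
  | zero => exact h a a' J hJ hJ' e
  | succ n ih =>
    exact h a a' J.2 (left_ne_zero_of_mul hJ) (left_ne_zero_of_mul hJ')
      (ih (right_ne_zero_of_mul hJ) (right_ne_zero_of_mul hJ') e)

lemma exists_isUnit_pathCoef [Nontrivial R] (h : ∀ a j, coef a j ≠ 0 → deg (lower a j) + 1 = deg a)
    (h' : ∀ a, deg a ≠ 0 → ∃ j, IsUnit (coef a j)) (n : ℕ) {a : A} (ha : deg a = n + 1) :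
    ∃ J : PowIdx m n, IsUnit (pathCoef lower coef n a J) := by
  induction n generalizing a with
  | zero => exact h' a (by omega)
  | succ n ih =>
    obtain ⟨j, hj⟩ := h' a (by omega)
    have := h a j hj.ne_zero
    obtain ⟨J, hJ⟩ := ih (a := lower a j) (by omega)
    exact ⟨(J, j), hj.mul hJ⟩

end Paths

end Adapted

/-! ### The shifted monomials -/

section Shift
open Polynomial

variable {R : Type*} [CommRing R]

/-- The coefficient of `Y ^ b` in `(Y - x) ^ m`. -/
def shiftCoef (x : R) (m b : ℕ) : R := ((X + C (-x)) ^ m).coeff b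

lemma natDegree_shift_le (x : R) (m : ℕ) : ((X + C (-x)) ^ m).natDegree ≤ m := by
  nontriviality R
  exact natDegree_pow_le.trans (by rw [natDegree_X_add_C, mul_one])

lemma sum_shiftCoef_mul_pow (x y : R) {m p : ℕ} (h : m < p) :
    ∑ b : Fin p, shiftCoef x m b * y ^ (b : ℕ) = (y - x) ^ m := by
  have h1 : ((X + C (-x)) ^ m).eval y = (y - x) ^ m := by simp [sub_eq_add_neg]
  rw [← h1, eval_eq_sum_range' ((natDegree_shift_le x m).trans_lt h),
    Fin.sum_univ_eq_sum_range (fun b ↦ shiftCoef x m b * y ^ b) p]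
  rfl

/-- Substituting Y − x for Y in (Y + x)^m gives Y^m. Hence the matrices of shift coefficients for x
and −x are inverse; m < p keeps all exponents in range. -/
lemma sum_shiftCoef_mul (x : R) {m p : ℕ} (h : m < p) (b : ℕ) :
    ∑ c : Fin p, shiftCoef (-x) m c * shiftCoef x c b = if m = b then 1 else 0 := by
  have h1 : ((X + C (- -x)) ^ m).comp (X + C (-x)) = X ^ m := by simp
  have h2 := congrArg (fun P ↦ P.coeff b) h1
  simp only [coeff_X_pow, comp, eval₂_eq_sum_range' _ ((natDegree_shift_le (-x) m).trans_lt h),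
    finsetSum_coeff, coeff_C_mul] at h2
  rw [Fin.sum_univ_eq_sum_range (fun c ↦ shiftCoef (-x) m c * shiftCoef x c b) p]
  simpa only [eq_comm (a := b), shiftCoef] using h2

lemma sum_prod_shiftCoef {n p : ℕ} (x : Fin n → R) (α β : Fin n → Fin p) :
    ∑ γ : Fin n → Fin p, (∏ j, shiftCoef (-x j) (α j) (γ j)) * ∏ j, shiftCoef (x j) (γ j) (β j) =
      if α = β then 1 else 0 := by
  simp only [← Finset.prod_mul_distrib]
  rw [← Fintype.piFinset_univ, ← Finset.prod_univ_sum (fun _ ↦ Finset.univ)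
    (fun j (c : Fin p) ↦ shiftCoef (-x j) (α j) (c : ℕ) * shiftCoef (x j) c (β j))]
  simp only [sum_shiftCoef_mul _ (Fin.is_lt _)]
  split_ifs with h
  · subst h
    simp
  · obtain ⟨j, hj⟩ := Function.ne_iff.mp h
    exact Finset.prod_eq_zero (Finset.mem_univ j) (if_neg fun h' ↦ hj (Fin.ext h'))

/-- This evaluates ∏_j (Y_j − x_j)^{α_j} at Y = x, so with 0^0 = 1 it is 1 for α = 0 and 0
otherwise. -/
lemma sum_prod_shiftCoef_mul {n p : ℕ} (x : Fin n → R) (α : Fin n → Fin p) :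
    ∑ β : Fin n → Fin p, (∏ j, shiftCoef (x j) (α j) (β j)) * ∏ j, x j ^ (β j : ℕ) =
      ∏ j, (0 : R) ^ (α j : ℕ) := by
  simp only [← Finset.prod_mul_distrib]
  rw [← Fintype.piFinset_univ, ← Finset.prod_univ_sum (fun _ ↦ Finset.univ)
    (fun j (c : Fin p) ↦ shiftCoef (x j) (α j) (c : ℕ) * x j ^ (c : ℕ))]
  refine Finset.prod_congr rfl fun j _ ↦ ?_
  rw [sum_shiftCoef_mul_pow _ _ (Fin.is_lt _), sub_self]

end Shift

/-! ### Differentials of shift coefficients and the calculus of exponents -/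

section ShiftDerivative

variable {X : Scheme.{u}} {k : CommRingCat.{u}} (f : X ⟶ Spec k) {U : X.Opens}

lemma dd_one : dd f U 1 = 0 := by simpa using dd_mul f (1 : Γ(X, U)) 1

lemma dd_natCast (n : ℕ) : dd f U (n : Γ(X, U)) = 0 := by
  rw [← nsmul_one, map_nsmul, dd_one, nsmul_zero]

lemma dd_prod {ι : Type*} [DecidableEq ι] (S : Finset ι) (g : ι → Γ(X, U)) :
    dd f U (∏ i ∈ S, g i) = ∑ i ∈ S, (∏ j ∈ S.erase i, g j) • dd f U (g i) := by
  induction S using Finset.induction_on with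
  | empty => simpa using dd_one f
  | insert a S ha ih =>
    rw [Finset.prod_insert ha, dd_mul, ih, Finset.sum_insert ha, Finset.erase_insert ha, add_comm,
      Finset.smul_sum]
    congr 1
    refine Finset.sum_congr rfl fun i hi ↦ ?_
    rw [Finset.erase_insert_of_ne (fun h : a = i ↦ ha (h ▸ hi)), Finset.prod_insert
      (fun h ↦ ha (Finset.mem_of_mem_erase h)), mul_smul]

/-- Differentiating (Y − x)^m in x gives −m (Y − x)^{m−1}; coefficientwise this is the identity
C(m,b)(m+1) = C(m+1,b)(m+1−b). The truncated `m - 1` at m = 0 is harmless because of the factor m.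
-/
lemma dd_shiftCoef (x : Γ(X, U)) (m b : ℕ) :
    dd f U (shiftCoef x m b) = (-(m : Γ(X, U)) * shiftCoef x (m - 1) b) • dd f U x := by
  rw [shiftCoef, shiftCoef, Polynomial.coeff_X_add_C_pow, Polynomial.coeff_X_add_C_pow, dd_mul,
    dd_natCast, smul_zero, zero_add, dd_pow, map_neg, smul_neg, smul_neg, ← neg_smul, smul_smul]
  congr 1
  rcases m with _ | m
  · simp
  by_cases hb : b ≤ m
  · have h1 := Nat.choose_mul_succ_eq m b
    have h2 : ((m.choose b : ℕ) : Γ(X, U)) * ((m + 1 : ℕ) : Γ(X, U)) =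
        (((m + 1).choose b : ℕ) : Γ(X, U)) * ((m + 1 - b : ℕ) : Γ(X, U)) := by
      rw [← Nat.cast_mul, ← Nat.cast_mul, h1]
    have h3 : m + 1 - b - 1 = m - b := by omega
    rw [h3, Nat.add_sub_cancel]
    linear_combination (-x) ^ (m - b) * h2
  · rw [Nat.add_sub_cancel, Nat.choose_eq_zero_of_lt (by omega : m < b),
      show m + 1 - b = 0 by omega]
    simp

end ShiftDerivative

/-- Decrease the exponent in the direction `j` by one. -/
def lowerExp {n p : ℕ} (α : Fin n → Fin p) (j : Fin n) : Fin n → Fin p :=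
  Function.update α j ⟨α j - 1, (Nat.sub_le _ _).trans_lt (α j).2⟩

lemma lowerExp_self {n p : ℕ} (α : Fin n → Fin p) (j : Fin n) :
    (lowerExp α j j : ℕ) = α j - 1 := by simp [lowerExp]

lemma lowerExp_of_ne {n p : ℕ} (α : Fin n → Fin p) {i j : Fin n} (h : i ≠ j) :
    lowerExp α j i = α i := by simp [lowerExp, h]

/-- The total degree of an exponent. -/
def degExp {n p : ℕ} (α : Fin n → Fin p) : ℕ := ∑ j, (α j : ℕ)

lemma degExp_eq_zero {n p : ℕ} {α : Fin n → Fin p} : degExp α = 0 ↔ ∀ j, (α j : ℕ) = 0 := by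
  simp [degExp]

lemma degExp_lowerExp {n p : ℕ} {α : Fin n → Fin p} {j : Fin n} (h : (α j : ℕ) ≠ 0) :
    degExp (lowerExp α j) + 1 = degExp α := by
  rw [degExp, degExp, ← Finset.add_sum_erase _ _ (Finset.mem_univ j),
    ← Finset.add_sum_erase _ _ (Finset.mem_univ j), lowerExp_self,
    Finset.sum_congr rfl fun i hi ↦ by rw [lowerExp_of_ne α (Finset.ne_of_mem_erase hi)]]
  omega

lemma degExp_le {n p : ℕ} (α : Fin n → Fin p) : degExp α ≤ (p - 1) * n := by
  rw [degExp]
  refine (Finset.sum_le_sum fun j _ ↦ (by have := (α j).2; omega : (α j : ℕ) ≤ p - 1)).trans ?_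
  simp [mul_comm]

lemma lowerExp_inj {n p : ℕ} {α α' : Fin n → Fin p} {j : Fin n} (h : (α j : ℕ) ≠ 0)
    (h' : (α' j : ℕ) ≠ 0) (e : lowerExp α j = lowerExp α' j) : α = α' := by
  funext i
  by_cases hi : i = j
  · subst hi
    have := congrArg (fun β : Fin n → Fin p ↦ (β i : ℕ)) e
    simp only [lowerExp_self] at this
    exact Fin.ext (by omega)
  · rw [← lowerExp_of_ne α hi, e, lowerExp_of_ne α' hi]

section ShiftProduct

variable {X : Scheme.{u}} {k : CommRingCat.{u}} (f : X ⟶ Spec k) {U : X.Opens}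

lemma dd_prod_shiftCoef {n p : ℕ} (x : Fin n → Γ(X, U)) (α β : Fin n → Fin p) :
    dd f U (∏ j, shiftCoef (x j) (α j) (β j)) =
      ∑ j, (-((α j : ℕ) : Γ(X, U)) * ∏ i, shiftCoef (x i) (lowerExp α j i) (β i)) • dd f U (x j) := by
  rw [dd_prod]
  refine Finset.sum_congr rfl fun j _ ↦ ?_
  have h : ∏ i ∈ Finset.univ.erase j, shiftCoef (x i) (lowerExp α j i) (β i) =
      ∏ i ∈ Finset.univ.erase j, shiftCoef (x i) (α i) (β i) :=
    Finset.prod_congr rfl fun i hi ↦ by rw [lowerExp_of_ne α (Finset.ne_of_mem_erase hi)]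
  rw [dd_shiftCoef, smul_smul, ← Finset.mul_prod_erase Finset.univ _ (Finset.mem_univ j), lowerExp_self, h]
  congr 1
  ring

end ShiftProduct

/-! ### The canonical filtration in étale coordinates -/

section Local

variable {X : Scheme.{u}} {U V W : X.Opens} {k : Type u} [Field k] (p : ℕ) [Fact p.Prime] [CharP k p]
  (f : X ⟶ Spec (.of k)) {E : X.Modules}

/-- A section of `E`, as a section of `F_* E`. -/
def pushSec (s : Γ(E, U)) : Γ(frobPush p f E, U) := s

lemma smul_pushSec (r : Γ(X, U)) (s : Γ(E, U)) : r • pushSec p f s = pushSec p f (r ^ p • s) := rfl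

lemma res_pushSec (h : V ≤ U) (s : Γ(E, U)) : res h (pushSec p f s) = pushSec p f (res h s) := rfl

lemma sum_pushSec {B : Type*} (S : Finset B) (s : B → Γ(E, U)) :
    ∑ b ∈ S, pushSec p f (s b) = pushSec p f (∑ b ∈ S, s b) := rfl

variable {n : ℕ} {t : Fin n → Γ(X, U)} {A : Type*} {e : A → Γ(E, U)}

/-- A function r acts on F_*E through r^p, so expanding each coefficient of a section of E in the
p-basis is the same as expanding the section in the t^β e_l. The p-basis property holds on small
open sets only, hence the local criterion. -/
lemma isFrame_frobPush [Fintype A] (ht : IsCoordinates p f U t) (he : IsFrame E U Finset.univ e) :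
    IsFrame (frobPush p f E) U Finset.univ
      fun a : (Fin n → Fin p) × A ↦ pushSec p f ((∏ j, t j ^ (a.1 j : ℕ)) • e a.2) := by
  have hsum : ∀ (W : X.Opens) (h : W ≤ U) (c : (Fin n → Fin p) × A → Γ(X, W)),
      ∑ a, c a • res h (pushSec p f ((∏ j, t j ^ (a.1 j : ℕ)) • e a.2)) =
      pushSec p f (∑ l, (∑ β, c (β, l) ^ p * ∏ j, rres h (t j) ^ (β j : ℕ)) • res h (e l)) := by
    intro W h c
    simp only [res_pushSec, smul_pushSec, sum_pushSec]
    congr 1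
    rw [Fintype.sum_prod_type_right]
    refine Finset.sum_congr rfl fun l _ ↦ ?_
    rw [Finset.sum_smul]
    refine Finset.sum_congr rfl fun β _ ↦ ?_
    rw [res_smul, smul_smul, map_prod]
    simp only [map_pow]
  refine isFrame_of_local (fun V h s y hy ↦ ?_) (fun V h c hc y hy ↦ ?_)
  · obtain ⟨W, hW, hyW, hgen, -⟩ := ht.basis V h y hy
    refine ⟨W, hW, hyW, ?_⟩
    obtain ⟨c, hc⟩ := he.gen V h s
    choose d hd using hgen
    refine ⟨fun a ↦ d (rres hW (c a.2)) a.1, ?_⟩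
    rw [hsum]
    change pushSec p f (res hW (show Γ(E, V) from s)) = _
    rw [hc, res_sum]
    congr 1
    refine Finset.sum_congr rfl fun l _ ↦ ?_
    rw [← hd (rres hW (c l)), res_res]
  · obtain ⟨W, hW, hyW, -, hind⟩ := ht.basis V h y hy
    refine ⟨W, hW, hyW, fun a _ ↦ ?_⟩
    have h1 := congrArg (res hW) hc
    rw [map_zero, res_sum] at h1
    simp only [res_res] at h1
    rw [hsum] at h1
    have h2 := he.ind W (hW.trans h) _ h1 a.2 (Finset.mem_univ _)
    exact hind (fun β ↦ rres hW (c (β, a.2))) h2 a.1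

lemma frobCounit_frobSec (s : Γ(E, U)) :
    (frobCounit p f E).app U (frobSec p f (frobPush p f E) U (pushSec p f s)) = s :=
  congr(($((Scheme.Modules.pullbackPushforwardAdjunction (absFrobenius p f)).right_triangle_components E)).app U s)

variable (t e) in
/-- The section of `F^* F_* E` given by a basis element of `E` and the monomial with exponent `α`
in the differences `1 ⊗ t_j - t_j ⊗ 1`. -/
def shiftSec (a : (Fin n → Fin p) × A) : Γ(frobPull p f (frobPush p f E), U) :=
  ∑ β : Fin n → Fin p, (∏ j, shiftCoef (t j) (a.1 j) (β j)) •
    frobSec p f (frobPush p f E) U (pushSec p f ((∏ j, t j ^ (β j : ℕ)) • e a.2))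

lemma isFrame_shiftSec [Fintype A] (ht : IsCoordinates p f U t) (he : IsFrame E U Finset.univ e) :
    IsFrame (frobPull p f (frobPush p f E)) U Finset.univ (shiftSec p f t e) := by
  classical
  -- The change of frame is the exponent matrix tensored with the identity on the index set of `e`;
  -- inverses are inherited from the exponent factor.
  have hδ : ∀ (P Q : (Fin n → Fin p) → (Fin n → Fin p) → Γ(X, U)),
      (∀ α β, ∑ γ, P α γ * Q γ β = if α = β then 1 else 0) → ∀ a b : (Fin n → Fin p) × A,
      ∑ c : (Fin n → Fin p) × A, (if a.2 = c.2 then P a.1 c.1 else 0) *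
        (if c.2 = b.2 then Q c.1 b.1 else 0) = if a = b then 1 else 0 := by
    intro P Q h a b
    rw [Fintype.sum_prod_type_right]
    simp only [ite_mul, zero_mul]
    rw [Finset.sum_eq_single a.2 (fun c _ hc ↦ by simp [Ne.symm hc]) (by simp)]
    by_cases hab : a.2 = b.2
    · simp [hab, h, Prod.ext_iff]
    · simp [hab, Prod.ext_iff]
  refine ((isFrame_frobPush p f ht he).frobSec p f).change _
    (fun a c ↦ if a.2 = c.2 then ∏ j, shiftCoef (t j) (a.1 j) (c.1 j) else 0)
    (fun a c ↦ if a.2 = c.2 then ∏ j, shiftCoef (-t j) (a.1 j) (c.1 j) else 0) (fun a _ ↦ ?_)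
    (fun a _ b _ ↦ ?_) (fun a _ b _ ↦ ?_)
  · rw [shiftSec, Fintype.sum_prod_type_right]
    simp only [ite_smul, zero_smul]
    rw [Finset.sum_eq_single a.2 (fun c _ hc ↦ by simp [Ne.symm hc]) (by simp)]
    simp
  · refine hδ (fun α γ ↦ ∏ j, shiftCoef (t j) (α j) (γ j)) (fun α γ ↦ ∏ j, shiftCoef (-t j) (α j) (γ j))
      (fun α β ↦ ?_) a b
    simpa only [neg_neg] using sum_prod_shiftCoef (fun j ↦ -t j) α β
  · exact hδ (fun α γ ↦ ∏ j, shiftCoef (-t j) (α j) (γ j)) (fun α γ ↦ ∏ j, shiftCoef (t j) (α j) (γ j))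
      (sum_prod_shiftCoef t) a b

/-- The sections F^*(t^β e_l) are horizontal, so ∇ only differentiates the shift coefficients. When
α_j = 0 the truncated `lowerExp` returns α itself, but the coefficient is then zero. -/
lemma nabla_shiftSec (a : (Fin n → Fin p) × A) :
    (cartier p f (frobPush p f E)).nabla U (shiftSec p f t e a) =
      ∑ j, (-((a.1 j : ℕ) : Γ(X, U))) • tmul (shiftSec p f t e (lowerExp a.1 j, a.2)) (dd f U (t j)) := by
  have h1 : ∀ j, tmul (shiftSec p f t e (lowerExp a.1 j, a.2)) (dd f U (t j)) =
      ∑ β : Fin n → Fin p, (∏ i, shiftCoef (t i) (lowerExp a.1 j i) (β i)) • tmul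
        (frobSec p f (frobPush p f E) U (pushSec p f ((∏ j, t j ^ (β j : ℕ)) • e a.2))) (dd f U (t j)) :=
    fun j ↦ sum_smul_tmul _ _ _ _
  simp only [h1, Finset.smul_sum]
  rw [Finset.sum_comm, shiftSec, map_sum]
  refine Finset.sum_congr rfl fun β _ ↦ ?_
  rw [Connection.leibniz, cartier_unit, smul_zero, zero_add, dd_prod_shiftCoef]
  let g : Γ(Omega f, U) →+ Γ(tens (frobPull p f (frobPush p f E)) (Omega f), U) :=
    AddMonoidHom.mk' (fun s ↦ tmul (frobSec p f (frobPush p f E) U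
      (pushSec p f ((∏ j, t j ^ (β j : ℕ)) • e a.2))) s) fun s s' ↦ tmul_add _ s s'
  refine (map_sum g _ _).trans (Finset.sum_congr rfl fun j _ ↦ ?_)
  rw [smul_smul]
  exact tmul_smul _ _ _

/-- The counit multiplies the two tensor factors, so it sets 1⊗t_j equal to t_j⊗1 and kills every
monomial of positive degree in the differences. -/
lemma frobCounit_shiftSec (a : (Fin n → Fin p) × A) :
    (frobCounit p f E).app U (shiftSec p f t e a) = if degExp a.1 = 0 then e a.2 else 0 := by
  rw [shiftSec, app_sum]
  simp only [Scheme.Modules.Hom.app_smul, frobCounit_frobSec, smul_smul]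
  rw [← Finset.sum_smul, sum_prod_shiftCoef_mul]
  split_ifs with h
  · rw [degExp_eq_zero] at h
    simp [h]
  · rw [degExp_eq_zero, not_forall] at h
    obtain ⟨j, hj⟩ := h
    rw [Finset.prod_eq_zero (Finset.mem_univ j) (zero_pow hj), zero_smul]

end Local

/-! ### The canonical filtration: adapted frames, the forms and their images -/

section Canonical

variable {X : Scheme.{u}} {M N : X.Modules} {U V : X.Opens}

lemma isFrame_oneSec (U : X.Opens) :
    IsFrame (structureModule X) U Finset.univ fun _ : Unit ↦ (oneSec X U : Γ(unitMod X, U)) := by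
  refine ⟨fun V h s ↦ ?_, fun V h c hc a _ ↦ ?_⟩
  · obtain ⟨r, hr⟩ := exists_eq_smul_oneSec (X := X) s
    exact ⟨fun _ ↦ r, hr.trans (by rw [← res_oneSec h]; simp; rfl)⟩
  · refine smul_oneSec_injective (X := X) (U := V) ?_
    refine Eq.trans ?_ (hc.trans (zero_smul Γ(X, V) (oneSec X V)).symm)
    rw [← res_oneSec h]
    simp
    rfl

lemma IsFrame.isIndep_app {A : Type*} {S : Finset A} {b : A → Γ(M, U)} (hb : IsFrame M U S b)
    (φ : M ⟶ N) [Mono φ] : IsIndep N U S fun a ↦ φ.app U (b a) := by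
  intro V h c hc
  rw [← app_sum_smul] at hc
  exact hb.ind V h c (app_injective φ V (hc.trans (map_zero _).symm))

lemma isVectorBundle_structureModule (X : Scheme.{u}) : IsVectorBundle (structureModule X) :=
  isVectorBundle_of_frames fun _ ↦ ⟨⊤, trivial, Unit, _, _, isFrame_oneSec ⊤⟩

lemma imageSubobject_le {P Q R : X.Modules} (φ : P ⟶ R) (ψ : Q ⟶ R) [Mono φ] [Mono ψ]
    (h : ∀ x : X, ∃ U : X.Opens, x ∈ U ∧ ∃ (A : Type) (S : Finset A) (b : A → Γ(P, U))
      (b' : A → Γ(Q, U)), IsFrame P U S b ∧ ∀ a ∈ S, φ.app U (b a) = ψ.app U (b' a)) :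
    imageSubobject φ ≤ imageSubobject ψ := by
  rw [imageSubobject_mono, imageSubobject_mono]
  obtain ⟨χ, hχ⟩ := exists_factor φ ψ fun U s x hx ↦ by
    obtain ⟨U', ⟨A, S, b, b', hb, e⟩, V, hV, hV', hxV⟩ := exists_le_of_nhds h U x hx
    obtain ⟨c, hc⟩ := hb.gen V hV' (res hV s)
    refine ⟨V, hV, hxV, ∑ a ∈ S, c a • res hV' (b' a), ?_⟩
    rw [hc, app_sum_smul, app_sum_smul]
    exact Finset.sum_congr rfl fun a ha ↦ by rw [e a ha]
  exact Subobject.mk_le_mk_of_comm χ hχ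

/-- The section of `Ω^{⊗(i+1)}` that describes the form `S_{i+1}` in coordinates. -/
def formSec {k : Type u} [Field k] (p : ℕ) (f : X ⟶ Spec (.of k)) {n : ℕ} (t : Fin n → Γ(X, U)) (i : ℕ) (α : Fin n → Fin p) : Γ(omegaPow f i, U) :=
  ∑ J, pathCoef lowerExp (fun α j ↦ -((α j : ℕ) : Γ(X, U))) i α J • powFrame (fun j ↦ dd f U (t j)) i J

lemma tmul_formSec {k : Type u} [Field k] (p : ℕ) (f : X ⟶ Spec (.of k)) {n : ℕ} (t : Fin n → Γ(X, U))
    (s : Γ(M, U)) (i : ℕ) (α : Fin n → Fin p) : tmul s (formSec p f t i α) =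
    ∑ J, pathCoef lowerExp (fun α j ↦ -((α j : ℕ) : Γ(X, U))) i α J •
      tmul s (powFrame (fun j ↦ dd f U (t j)) i J) := by
  let g : Γ(omegaPow f i, U) →+ Γ(tens M (omegaPow f i), U) :=
    AddMonoidHom.mk' (fun v ↦ tmul s v) fun v v' ↦ tmul_add _ v v'
  exact (map_sum g _ _).trans (Finset.sum_congr rfl fun J _ ↦ tmul_smul _ _ _)

lemma charP_of_nontrivial {k : Type u} [Field k] (p : ℕ) [CharP k p]
    (f : X ⟶ Spec (.of k)) [Nontrivial Γ(X, U)] : CharP Γ(X, U) p :=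
  charP_of_injective_ringHom (constHom f U).injective p

lemma IsCoordinates.restrict {k : Type u} [Field k] (p : ℕ) (f : X ⟶ Spec (.of k)) {n : ℕ}
    {t : Fin n → Γ(X, U)} (ht : IsCoordinates p f U t) (h : V ≤ U) :
    IsCoordinates p f V fun j ↦ rres h (t j) where
  frame := (ht.frame.restrict h).congr fun j _ ↦ (map_dd f (homOfLE h) (t j)).symm
  basis W hW y hy := by simpa only [rres_rres] using ht.basis W (hW.trans h) y hy

variable {k : Type u} [Field k] (p : ℕ)
  [Fact p.Prime] [CharP k p] (f : X ⟶ Spec (.of k)) {E : X.Modules}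

variable {n : ℕ} {t : Fin n → Γ(X, U)} {A : Type*} [Fintype A] {e : A → Γ(E, U)}

/-- Supplies the geometric input of the abstract induction. Units come from 0 < α_j < p, and the
coefficient condition on E_1 from the fact that the counit carries the degree zero members onto the
frame of E and kills the others. -/
lemma isAdapted_shiftSec [Nontrivial Γ(X, U)] (ht : IsCoordinates p f U t)
    (he : IsFrame E U Finset.univ e) :
    IsAdapted (cartier p f (frobPush p f E)) (kernel.ι (frobCounit p f E)) (shiftSec p f t e)
      (fun j ↦ dd f U (t j)) (fun a ↦ degExp a.1) (fun a j ↦ (lowerExp a.1 j, a.2))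
      (fun a j ↦ -((a.1 j : ℕ) : Γ(X, U))) where
  nontrivial := inferInstance
  frame := isFrame_shiftSec p f ht he
  omega := ht.frame
  nabla := nabla_shiftSec p f
  deg_lower a j h := degExp_lowerExp fun h0 ↦ h (by rw [h0, Nat.cast_zero, neg_zero])
  lower_inj a a' j h h' e := Prod.ext
    (lowerExp_inj (j := j) (fun h0 ↦ h (by rw [h0, Nat.cast_zero, neg_zero]))
      (fun h0 ↦ h' (by rw [h0, Nat.cast_zero, neg_zero])) (Prod.mk.inj e).1)
    (Prod.mk.inj e).2
  exists_isUnit a h := by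
    rw [Ne, degExp_eq_zero, not_forall] at h
    obtain ⟨j, hj⟩ := h
    have := charP_of_nontrivial p f (U := U)
    exact ⟨j, (isUnit_natCast_of_lt p hj (a.1 j).2).neg⟩
  exists_lift a ha := exists_of_kernel _ _ (by
    rw [frobCounit_shiftSec, if_neg (by omega)])
  coeff_eq_zero V h s c hc a ha := by
    have h1 := congrArg ((frobCounit p f E).app V) hc
    rw [app_sum_smul] at h1
    have h2 : (frobCounit p f E).app V ((kernel.ι (frobCounit p f E)).app V s) = 0 :=
      app_eq_zero_of_comp (kernel.condition _) s
    rw [h2, Fintype.sum_prod_type_right] at h1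
    have h3 : ∑ l, c (a.1, l) • res h (e l) = 0 := by
      rw [h1]
      refine Finset.sum_congr rfl fun l _ ↦ ?_
      rw [Finset.sum_eq_single a.1 (fun α _ hα ↦ ?_) (by simp), frobCounit_shiftSec,
        if_pos (show degExp a.1 = 0 by omega)]
      rw [frobCounit_shiftSec, if_neg, map_zero, smul_zero]
      intro h0
      have h0' : degExp a.1 = 0 := by omega
      rw [degExp_eq_zero] at h0 h0'
      exact hα (funext fun j ↦ Fin.ext ((h0 j).trans (h0' j).symm))
    exact he.ind V h (fun l ↦ c (a.1, l)) h3 a.2 (Finset.mem_univ _)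

/-- Locally, there are étale coordinates and a frame of a given vector bundle. -/
lemma exists_isCoordinates_and_frame [IsAlgClosed k] [IsIntegral X] [Smooth f]
    (hE : IsVectorBundle E) (x : X) : ∃ U : X.Opens, x ∈ U ∧ Nontrivial Γ(X, U) ∧
      ∃ (n : ℕ) (t : Fin n → Γ(X, U)), IsCoordinates p f U t ∧ n ≤ topologicalKrullDim X ∧
      ∃ (r : ℕ) (e : Fin r → Γ(E, U)), IsFrame E U Finset.univ e := by
  obtain ⟨U, hxU, n, t, ht, hn⟩ := exists_isCoordinates f p x
  obtain ⟨V, hxV, r, e, he⟩ := hE.exists_frame x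
  have : Nonempty ↥(U ⊓ V) := ⟨⟨x, hxU, hxV⟩⟩
  exact ⟨U ⊓ V, ⟨hxU, hxV⟩, inferInstance, n, _, ht.restrict p f inf_le_left, hn, r, _,
    he.restrict inf_le_right⟩

lemma isLocallyAdapted_cartier [IsAlgClosed k] [IsIntegral X] [Smooth f] (hE : IsVectorBundle E) :
    IsLocallyAdapted (cartier p f (frobPush p f E)) (kernel.ι (frobCounit p f E)) := fun x ↦ by
  obtain ⟨U, hx, _, n, t, ht, -, r, e, he⟩ := exists_isCoordinates_and_frame p f hE x
  exact ⟨U, hx, _, inferInstance, n, _, _, _, _, _, isAdapted_shiftSec p f ht he⟩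

lemma isZero_canFil [IsAlgClosed k] [IsIntegral X] [Smooth f] (hE : IsVectorBundle E) {d : ℕ}
    (hd : topologicalKrullDim X = d) {i : ℕ} (hi : (p - 1) * d < i) :
    IsZero (canFil p f E i).left := by
  classical
  rw [IsZero.iff_id_eq_zero]
  refine hom_eq_of_locally fun U s x hx ↦ ?_
  obtain ⟨U', ⟨_, n, t, ht, hn, r, e, he⟩, V, hV, hV', hxV⟩ :=
    exists_le_of_nhds (exists_isCoordinates_and_frame p f hE) U x hx
  refine ⟨V, hV, hxV, ?_⟩
  obtain ⟨c, hc⟩ := ((isAdapted_shiftSec p f ht he).isFrame_filtration i).gen V hV' (res hV s)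
  -- Exponents have degree at most (p−1)n, and n ≤ d, so none has degree `i` or more and the frame
  -- of E_i is empty.
  have hempty : degGE (fun a : (Fin n → Fin p) × Fin r ↦ degExp a.1) i = ∅ := by
    refine Finset.eq_empty_of_forall_notMem fun a ha ↦ ?_
    rw [mem_degGE] at ha
    have h1 := degExp_le a.1
    have h2 : n ≤ d := by
      rw [hd] at hn
      exact_mod_cast hn
    have h3 := Nat.mul_le_mul_left (p - 1) h2
    omega
  rw [hempty, Finset.sum_empty] at hc
  exact (congrArg _ hc).trans ((map_zero _).trans ((congrArg _ hc).trans (map_zero _)).symm)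

lemma pathCoef_prod {R B C : Type*} [Mul R] (lower : B → Fin n → B) (coef : B → Fin n → R) (i : ℕ)
    (a : B × C) (J : PowIdx n i) :
    pathCoef (fun (a : B × C) j ↦ (lower a.1 j, a.2)) (fun a j ↦ coef a.1 j) i a J =
      pathCoef lower coef i a.1 J := by
  induction i generalizing a with
  | zero => rfl
  | succ i ih => exact congrArg (coef a.1 J.2 * ·) (ih (lower a.1 J.2, a.2) J.1)

lemma pathEnd_prod {B C : Type*} (lower : B → Fin n → B) (i : ℕ) (a : B × C) (J : PowIdx n i) :
    pathEnd (fun (a : B × C) j ↦ (lower a.1 j, a.2)) i a J = (pathEnd lower i a.1 J, a.2) := by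
  induction i generalizing a with
  | zero => rfl
  | succ i ih => exact ih (lower a.1 J.2, a.2) J.1

lemma canGrZero_grClass (s : Γ(frobPull p f (frobPush p f E), U)) :
    (canGrZero p f E).app U
      (grClass (cartier p f (frobPush p f E)) (kernel.ι (frobCounit p f E)) 0 s) =
      (frobCounit p f E).app U s := by
  have h : filLift (cartier p f (frobPush p f E)) (kernel.ι (frobCounit p f E)) 0 s = s :=
    app_liftSec (𝟙 (frobPull p f (frobPush p f E))) ⟨s, rfl⟩
  refine Eq.trans ?_ (congrArg ((frobCounit p f E).app U) h)
  exact congr(($(cokernel.π_desc (kernel.ι (frobCounit p f E)) (frobCounit p f E)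
    (kernel.condition (frobCounit p f E)))).app U _)

/-- The class of a shifted monomial in the graded piece. -/
abbrev shiftClass (t : Fin n → Γ(X, U)) (e : A → Γ(E, U)) (i : ℕ) (a : (Fin n → Fin p) × A) :
    Γ(canGr p f E i, U) :=
  grClass (cartier p f (frobPush p f E)) (kernel.ι (frobCounit p f E)) i (shiftSec p f t e a)

section

variable [Nontrivial Γ(X, U)]

lemma isFrame_shiftClass (ht : IsCoordinates p f U t) (he : IsFrame E U Finset.univ e) (i : ℕ) :
    IsFrame (canGr p f E i) U (degEQ (fun a : (Fin n → Fin p) × A ↦ degExp a.1) i)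
      (shiftClass p f t e i) := by
  classical
  exact (isAdapted_shiftSec p f ht he).isFrame_graded i

/-- A path of length i + 1 with nonzero weight starting in degree i + 1 ends at the exponent 0,
whose class in E_0 / E_1 maps to `e a.2`. The other paths have weight zero, so their ends do not
matter. -/
lemma canForm_shiftClass [IsAlgClosed k] [IsIntegral X] [Smooth f] (hE : IsVectorBundle E) (ht : IsCoordinates p f U t)
    (he : IsFrame E U Finset.univ e) (i : ℕ)
    {a : (Fin n → Fin p) × A} (ha : degExp a.1 = i + 1) :
    (canForm p f E i).app U (shiftClass p f t e (i + 1) a) = tmul (e a.2) (formSec p f t i a.1) := by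
  have H := isAdapted_shiftSec p f ht he
  have h1 := (isLocallyAdapted_cartier p f hE).iteratedForm_grClass H i ha
  let q : graded (cartier p f (frobPush p f E)) (kernel.ι (frobCounit p f E)) 0 ⟶ E := canGrZero p f E
  refine (congrArg ((tensHom q (𝟙 (omegaPow f i))).app U) h1).trans ?_
  rw [app_sum]
  let g : Γ(omegaPow f i, U) →+ Γ(tens E (omegaPow f i), U) :=
    AddMonoidHom.mk' (fun s ↦ tmul (e a.2) s) fun s s' ↦ tmul_add _ s s'
  refine Eq.trans ?_ (map_sum g _ _).symm
  refine Finset.sum_congr rfl fun J _ ↦ ?_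
  refine Eq.trans ?_ (tmul_smul _ _ _).symm
  rw [Scheme.Modules.Hom.app_smul, tensHom_app_tmul]
  have hc := pathCoef_prod lowerExp (fun (α : Fin n → Fin p) j ↦ -((α j : ℕ) : Γ(X, U))) i a J
  rw [hc]
  by_cases h0 : pathCoef lowerExp (fun (α : Fin n → Fin p) j ↦ -((α j : ℕ) : Γ(X, U))) i a.1 J = 0
  · rw [h0, zero_smul, zero_smul]
  · have hd := deg_pathEnd (deg := fun a : (Fin n → Fin p) × A ↦ degExp a.1) H.deg_lower i
      (a := a) (J := J) (by rwa [hc])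
    have hd0 : degExp (pathEnd (fun (a : (Fin n → Fin p) × A) j ↦ (lowerExp a.1 j, a.2)) i a J).1 = 0 := by
      omega
    refine congrArg (fun z ↦ _ • z) ?_
    refine congr_arg₂ tmul ?_ rfl
    refine (canGrZero_grClass p f _).trans ?_
    rw [frobCounit_shiftSec, if_pos hd0, pathEnd_prod]

/-- In degree `i + 1`, the coefficients along paths have a permuted triangular submatrix. -/
lemma exists_path (f : X ⟶ Spec (.of k)) (i : ℕ) :
    ∃ κ : {α : Fin n → Fin p // degExp α = i + 1} → PowIdx n i, ∀ α,
      IsUnit (pathCoef lowerExp (fun (α : Fin n → Fin p) j ↦ -((α j : ℕ) : Γ(X, U))) i α.1 (κ α)) ∧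
      ∀ α', α' ≠ α →
        pathCoef lowerExp (fun (α : Fin n → Fin p) j ↦ -((α j : ℕ) : Γ(X, U))) i α'.1 (κ α) = 0 := by
  have := charP_of_nontrivial p f (U := U)
  have hdeg : ∀ (α : Fin n → Fin p) (j : Fin n), -((α j : ℕ) : Γ(X, U)) ≠ 0 →
      degExp (lowerExp α j) + 1 = degExp α :=
    fun α j h ↦ degExp_lowerExp fun h0 ↦ h (by rw [h0, Nat.cast_zero, neg_zero])
  have hunit : ∀ α : Fin n → Fin p, degExp α ≠ 0 → ∃ j, IsUnit (-((α j : ℕ) : Γ(X, U))) := by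
    intro α h
    rw [Ne, degExp_eq_zero, not_forall] at h
    obtain ⟨j, hj⟩ := h
    exact ⟨j, (isUnit_natCast_of_lt p hj (α j).2).neg⟩
  -- Always lower in a direction where the exponent is nonzero: the weight is a product of units.
  choose κ hκ using fun α : {α : Fin n → Fin p // degExp α = i + 1} ↦
    exists_isUnit_pathCoef hdeg hunit i α.2
  refine ⟨κ, fun α ↦ ⟨hκ α, fun α' hne ↦ ?_⟩⟩
  by_contra h0
  have h1 := deg_pathEnd hdeg i h0
  have h2 := deg_pathEnd hdeg i (hκ α).ne_zero
  rw [α.2] at h2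
  rw [α'.2] at h1
  have hinj : ∀ (α α' : Fin n → Fin p) (j : Fin n), -((α j : ℕ) : Γ(X, U)) ≠ 0 →
      -((α' j : ℕ) : Γ(X, U)) ≠ 0 → lowerExp α j = lowerExp α' j → α = α' :=
    fun α α' j h h' e ↦ lowerExp_inj (fun h0 ↦ h (by rw [h0, Nat.cast_zero, neg_zero]))
      (fun h0 ↦ h' (by rw [h0, Nat.cast_zero, neg_zero])) e
  refine hne (Subtype.ext (pathEnd_inj hinj i h0 (hκ α).ne_zero ?_))
  -- Both paths have length equal to the degree of their start, so both end at the zero exponent,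
  -- and `pathEnd_inj` forces the starts to agree.
  have h3 := degExp_eq_zero.mp (show degExp _ = 0 from Nat.add_right_cancel (h1.trans (Nat.zero_add _).symm))
  have h4 := degExp_eq_zero.mp (show degExp _ = 0 from Nat.add_right_cancel (h2.trans (Nat.zero_add _).symm))
  exact funext fun j ↦ Fin.ext ((h3 j).trans (h4 j).symm)

/-- The classes of shifted monomials, indexed by the exponents of the given degree. -/
lemma isFrame_shiftClass_subtype (ht : IsCoordinates p f U t) (he : IsFrame E U Finset.univ e) (i : ℕ) :
    IsFrame (canGr p f E i) U Finset.univ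
      fun a : {α : Fin n → Fin p // degExp α = i} × A ↦ shiftClass p f t e i (a.1.1, a.2) := by
  have hbij : Set.BijOn (fun a : {α : Fin n → Fin p // degExp α = i} × A ↦ (a.1.1, a.2))
      ((Finset.univ : Finset ({α : Fin n → Fin p // degExp α = i} × A)) : Set _) (degEQ (fun a : (Fin n → Fin p) × A ↦ degExp a.1) i) := by
    refine ⟨fun a _ ↦ mem_degEQ.mpr a.1.2, fun a _ a' _ h ↦ ?_, fun a ha ↦ ?_⟩
    · obtain ⟨h1, h2⟩ := Prod.mk.inj h
      exact Prod.ext (Subtype.ext h1) h2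
    · exact ⟨(⟨a.1, (mem_degEQ (a := a)).mp ha⟩, a.2), Finset.mem_coe.mpr (Finset.mem_univ _), rfl⟩
  exact (isFrame_shiftClass p f ht he i).reindex _ hbij fun _ _ ↦ Eq.refl (shiftClass p f t e i _)

end

variable [IsAlgClosed k] [IsIntegral X] [Smooth f]

/-- In the frames w_{α,l} and e_l ⊗ dt_J the matrix is diagonal in l, and by `exists_path` the
columns (l, κ α) form an invertible diagonal block. -/
lemma isSubbundle_canForm (hE : IsVectorBundle E) (i : ℕ) : IsSubbundle (canForm p f E i) := by
  classical
  refine isSubbundle_of_matrix fun x ↦ ?_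
  obtain ⟨U, hx, _, n, t, ht, -, r, e, he⟩ := exists_isCoordinates_and_frame p f hE x
  obtain ⟨κ, hκ⟩ := exists_path (X := X) (U := U) (n := n) p f i
  refine ⟨U, hx, _, Fin r × PowIdx n i, inferInstance, Finset.univ, Finset.univ, _, _,
    fun a ↦ (a.2, κ a.1),
    fun a b ↦ if a.2 = b.1 then pathCoef lowerExp (fun α j ↦ -((α j : ℕ) : Γ(X, U))) i a.1.1 b.2 else 0,
    isFrame_shiftClass_subtype p f ht he (i + 1), he.tmul (isFrame_powFrame ht.frame i),
    fun _ _ ↦ by simp, ?_, fun a _ ↦ ?_, fun a _ a' _ haa' ↦ ?_, fun a _ ↦ ?_⟩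
  · rintro ⟨α, l⟩ - ⟨α', l'⟩ - h
    obtain ⟨hl, hα⟩ := Prod.mk.inj h
    refine Prod.ext ?_ hl
    by_contra hne
    have h1 := (hκ α').2 α hne
    rw [← hα] at h1
    exact (hκ α).1.ne_zero h1
  · rw [canForm_shiftClass p f hE ht he i a.1.2, tmul_formSec]
    symm
    refine (Fintype.sum_prod_type _).trans ?_
    simp only [ite_smul, zero_smul]
    rw [Finset.sum_eq_single a.2 (fun l _ hl ↦ by simp [Ne.symm hl]) (by simp)]
    simp
  · by_cases hl : a.2 = a'.2
    · exact (if_pos hl).trans ((hκ a'.1).2 a.1 fun h ↦ haa' (Prod.ext h hl))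
    · exact if_neg hl
  · change IsUnit (ite (a.2 = a.2) _ _)
    rw [if_pos rfl]
    exact (hκ a.1).1

lemma canForm_structureModule_shiftClass [Nontrivial Γ(X, U)] (ht : IsCoordinates p f U t) (i : ℕ)
    {a : (Fin n → Fin p) × Unit} (ha : degExp a.1 = i + 1) :
    (canForm p f (structureModule X) i ≫ tensUnit (omegaPow f i)).app U
      (shiftClass p f t (E := structureModule X) (fun _ : Unit ↦ (oneSec X U : Γ(unitMod X, U))) (i + 1) a) =
      formSec p f t i a.1 := by
  have h := canForm_shiftClass p f (isVectorBundle_structureModule X) ht (isFrame_oneSec U) i ha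
  refine (congrArg ((tensUnit (omegaPow f i)).app U) h).trans ?_
  refine (tensUnit_app_tmul (1 : Γ(X, U)) _).trans ?_
  rw [one_smul]

lemma isSubbundle_canForm_structureModule (i : ℕ) :
    IsSubbundle (canForm p f (structureModule X) i ≫ tensUnit (omegaPow f i)) := by
  classical
  refine isSubbundle_of_matrix fun x ↦ ?_
  obtain ⟨U, hx, _, n, t, ht, -, -⟩ :=
    exists_isCoordinates_and_frame p f (isVectorBundle_structureModule X) x
  obtain ⟨κ, hκ⟩ := exists_path (X := X) (U := U) (n := n) p f i
  refine ⟨U, hx, _, PowIdx n i, inferInstance, Finset.univ, Finset.univ, _, _,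
    fun a ↦ κ a.1, fun a J ↦ pathCoef lowerExp (fun α j ↦ -((α j : ℕ) : Γ(X, U))) i a.1.1 J,
    isFrame_shiftClass_subtype p f ht (isFrame_oneSec U) (i + 1), isFrame_powFrame ht.frame i,
    fun _ _ ↦ by simp, ?_, fun a _ ↦ ?_, fun a _ a' _ haa' ↦ ?_, fun a _ ↦ (hκ a.1).1⟩
  · rintro ⟨α, l⟩ - ⟨α', l'⟩ - h
    refine Prod.ext ?_ rfl
    by_contra hne
    have h1 := (hκ α').2 α hne
    rw [← show κ α = κ α' from h] at h1
    exact (hκ α).1.ne_zero h1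
  · exact canForm_structureModule_shiftClass p f ht i a.1.2
  · exact (hκ a'.1).2 a.1 fun h ↦ haa' (Prod.ext h rfl)

/-- The form for E = 𝒪_X is a monomorphism, so it identifies the graded piece with its image. This
transfers frames and the subbundle property to G_{i+1}. -/
lemma exists_iso_gSubIncl (i : ℕ) :
    ∃ ε : canGr p f (structureModule X) (i + 1) ≅
      image (canForm p f (structureModule X) i ≫ tensUnit (omegaPow f i)),
      ε.hom ≫ gSubIncl p f i = canForm p f (structureModule X) i ≫ tensUnit (omegaPow f i) := by
  have hφ := (isSubbundle_canForm_structureModule p f i).mono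
  let φ := canForm p f (structureModule X) i ≫ tensUnit (omegaPow f i)
  have h1 : Mono (factorThruImage φ) := by
    have : Mono (factorThruImage φ ≫ image.ι φ) := by rwa [image.fac]
    exact mono_of_mono _ (image.ι φ)
  have h2 : IsIso (factorThruImage φ) := isIso_of_mono_of_epi _
  exact ⟨asIso (factorThruImage φ), image.fac φ⟩

lemma isSubbundle_gSubIncl (i : ℕ) : IsSubbundle (gSubIncl p f i) := by
  obtain ⟨ε, hε⟩ := exists_iso_gSubIncl p f i
  have h := (isSubbundle_canForm_structureModule p f i).iso_comp ε.symm
  have e : ε.symm.hom ≫ canForm p f (structureModule X) i ≫ tensUnit (omegaPow f i) = gSubIncl p f i :=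
    (Iso.inv_comp_eq ε).mpr hε.symm
  exact e ▸ h

/-- Local frames of `E ⊗ G_{i+1}` and of the graded piece with the same images. -/
lemma exists_frames (hE : IsVectorBundle E) (i : ℕ) (x : X) : ∃ U : X.Opens, x ∈ U ∧
    ∃ (A : Type) (S : Finset A)
      (b : A → Γ(tens E (image (canForm p f (structureModule X) i ≫ tensUnit (omegaPow f i))), U))
      (b' : A → Γ(canGr p f E (i + 1), U)), IsFrame _ U S b ∧ IsFrame _ U S b' ∧
      ∀ a ∈ S, (tensHom (𝟙 E) (gSubIncl p f i)).app U (b a) = (canForm p f E i).app U (b' a) := by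
  obtain ⟨U, hx, _, n, t, ht, -, r, e, he⟩ := exists_isCoordinates_and_frame p f hE x
  obtain ⟨ε, hε⟩ := exists_iso_gSubIncl (X := X) p f i
  have hG := (isFrame_shiftClass_subtype p f ht (isFrame_oneSec U) (i + 1)).map_iso ε.hom
  have hF := isFrame_shiftClass_subtype p f ht he (i + 1)
  refine ⟨U, hx, _, Finset.univ, _, _, he.tmul hG, hF.reindex (T := Finset.univ)
    (fun a ↦ (a.2.1, a.1)) ⟨fun _ _ ↦ by simp, ?_, ?_⟩ fun _ _ ↦ rfl, fun a _ ↦ ?_⟩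
  · rintro ⟨l, α, u⟩ - ⟨l', α', u'⟩ - h
    obtain ⟨h1, h2⟩ := Prod.mk.inj h
    exact Prod.ext h2 (Prod.ext h1 rfl)
  · rintro ⟨α, l⟩ -
    exact ⟨(l, α, ()), by simp, rfl⟩
  · rw [tensHom_app_tmul]
    refine Eq.trans ?_ (canForm_shiftClass p f hE ht he i a.2.1.2).symm
    refine congr_arg₂ tmul rfl ?_
    refine Eq.trans ?_ (canForm_structureModule_shiftClass p f ht i (a := (a.2.1.1, a.2.2)) a.2.1.2)
    exact congr(($hε).app U _)

lemma mono_tensHom_gSubIncl (hE : IsVectorBundle E) (i : ℕ) :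
    Mono (tensHom (𝟙 E) (gSubIncl p f i)) := by
  have := (isSubbundle_canForm p f hE i).mono
  refine mono_of_local fun x ↦ ?_
  obtain ⟨U, hx, A, S, b, b', hb, hb', h⟩ := exists_frames p f hE i x
  exact ⟨U, hx, fun V hV s hs ↦ hb.app_eq_zero ((hb'.isIndep_app (canForm p f E i)).congr h) hV s hs⟩

/-- Both images are generated locally by the same sections e_l ⊗ σ_α, as `exists_frames` records;
inclusion in each direction is then a factorization checked on frames. -/
lemma imageSubobject_canForm (hE : IsVectorBundle E) (i : ℕ) :
    imageSubobject (canForm p f E i) = imageSubobject (tensHom (𝟙 E) (gSubIncl p f i)) := by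
  have := (isSubbundle_canForm p f hE i).mono
  have := mono_tensHom_gSubIncl p f hE i
  refine le_antisymm (imageSubobject_le _ _ fun x ↦ ?_) (imageSubobject_le _ _ fun x ↦ ?_)
  · obtain ⟨U, hx, A, S, b, b', hb, hb', h⟩ := exists_frames p f hE i x
    exact ⟨U, hx, A, S, b', b, hb', fun a ha ↦ (h a ha).symm⟩
  · obtain ⟨U, hx, A, S, b, b', hb, hb', h⟩ := exists_frames p f hE i x
    exact ⟨U, hx, A, S, b, b', hb, h⟩

end Canonical

end
end FrobFil

/-- The index `n` stands for the form S_{n+1} and for G_{n+1}. The `∃!` clause shows that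
`gradedForm` is always the induced form and never its default value 0, so `canForm` is the intended
composite. Equality of images is stated in the lattice of subobjects of E ⊗ Ω^{⊗(n+1)}. -/
theorem proposition4p1 {k : Type u} [Field k] [IsAlgClosed k] (p : ℕ) [Fact p.Prime] [CharP k p]
    (X : Scheme.{u}) [IsIntegral X] (f : X ⟶ Spec (.of k)) [Smooth f]
    (hf : FrobFil.IsProjective f) (d : ℕ) (hd : topologicalKrullDim X = d) :
    (∀ E : X.Modules, FrobFil.IsVectorBundle E →
      (∀ i : ℕ, FrobFil.IsSubbundle (FrobFil.canFil p f E i).hom) ∧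
      (∀ i : ℕ, (p - 1) * d < i → IsZero (FrobFil.canFil p f E i).left)) ∧
    (∀ E : X.Modules, FrobFil.IsVectorBundle E → ∀ n : ℕ,
      (∃! t, FrobFil.IsInduced (FrobFil.cartier p f (FrobFil.frobPush p f E))
        (kernel.ι (FrobFil.frobCounit p f E)) n t) ∧
      FrobFil.IsSubbundle (FrobFil.canForm p f E n)) ∧
    (∀ n : ℕ, FrobFil.IsSubbundle (FrobFil.gSubIncl p f n) ∧
      ∀ E : X.Modules, FrobFil.IsVectorBundle E →
        Mono (FrobFil.tensHom (𝟙 E) (FrobFil.gSubIncl p f n)) ∧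
        imageSubobject (FrobFil.canForm p f E n) =
          imageSubobject (FrobFil.tensHom (𝟙 E) (FrobFil.gSubIncl p f n))) := by
  refine ⟨fun E hE ↦ ⟨fun i ↦ ?_, fun i hi ↦ ?_⟩, fun E hE n ↦ ⟨?_, ?_⟩, fun n ↦ ⟨?_, fun E hE ↦ ⟨?_, ?_⟩⟩⟩
  · exact (FrobFil.isLocallyAdapted_cartier p f hE).isSubbundle_filtration i
  · exact FrobFil.isZero_canFil p f hE hd hi
  · exact (FrobFil.isLocallyAdapted_cartier p f hE).existsUnique_isInduced n
  · exact FrobFil.isSubbundle_canForm p f hE n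
  · exact FrobFil.isSubbundle_gSubIncl p f n
  · exact FrobFil.mono_tensHom_gSubIncl p f hE n
  · exact FrobFil.imageSubobject_canForm p f hE n
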